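/- For each sample size $n\ge 1$ let $p=p_n\ge 2$ and $K=K_n\ge 2$, and let $(\boldsymbol x_i,g_i)$, $i=1,\dots,n$, be independent pairs with $\boldsymbol x_i\in\mathbb R^p$ and class label $g_i\in\{1,\dots,K\}$, such that $P(g_i=k)=\pi_k$ and $\boldsymbol x_i\mid g_i=k\sim\mathcal N(\boldsymbol\mu_k,\boldsymbol\Sigma_W)$, with $\sum_k\pi_k=1$ and $\sum_k\pi_k\boldsymbol\mu_k=0$. All of $p,K,\pi_k,\boldsymbol\mu_k,\boldsymbol\Sigma_W$ may depend on $n$, but $0<\pi_{\min}\le\pi_k\le\pi_{\max}<1$ with constants $\pi_{\min},\pi_{\max}$ that do not. Let $\boldsymbol\Sigma_T=\mathrm{Cov}(\boldsymbol x_i)$ be positive definite, let $\boldsymbol\Delta\in\mathbb R^{p\times(K-1)}$ have columns $$\boldsymbol\Delta_r=\frac{\sqrt{\pi_{r+1}}\sum_{k=1}^r\pi_k(\boldsymbol\mu_k-\boldsymbol\mu_{r+1})}{\sqrt{\sum_{k=1}^r\pi_k\sum_{k=1}^{r+1}\pi_k}},$$ and put $\boldsymbol B^*=\boldsymbol\Sigma_T^{-1}\boldsymbol\Delta$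 and $\tau=\max_j\sqrt{(\boldsymbol\Sigma_W)_{jj}+\max_k\mu_{kj}^2}$. For a matrix $\boldsymbol A$ let $\|\boldsymbol A\|_{1,2}$ be the sum of the Euclidean norms of its rows, and let $\boldsymbol A_S$ be $\boldsymbol A$ with the rows outside $S$ replaced by zero. Let $\boldsymbol X\in\mathbb R^{n\times p}$ have rows $\boldsymbol x_i^\top$, either as they are or column-centered (the result holds in both cases). Let $\boldsymbol Z\in\{0,1\}^{n\times K}$ be the class indicator matrix, $n_k$ the size of class $k$ in the sample, and $\boldsymbol Y=\boldsymbol Z\widetilde{\boldsymbol\Theta}$, where the $l$-th column ($l=1,\dots,K-1$) of $\widetilde{\boldsymbol\Theta}\in\mathbb R^{K\times(K-1)}$ has its first $l$ entries equal to $\sqrt{n\,n_{l+1}/(\sum_{i\le l}n_i\sum_{i\le l+1}n_i)}$, its entry $l+1$ equal to $-\sqrt{n\sum_{i\le l}n_i/(n_{l+1}\sum_{i\le l+1}n_i)}$, and zeros below (a fraction with denominator $0$ is read as $0$). Let $$\widehat{\boldsymbol B}\in\arg\min_{\boldsymbol B\in\mathbb R^{p\times(K-1)}}\Big\{\frac1{2n}\|\boldsymbol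 Y-\boldsymbol X\boldsymbol B\|_F^2+\lambda\|\boldsymbol B\|_{1,2}\Big\},\qquad \lambda=C\tau\sqrt{\frac{(K-1)\log p}{n}}.$$ Let $s\ge 1$ be the number of nonzero rows of $\boldsymbol B^*$. Assume $\log p=o(n)$ and $s^2\log p=o(n)$, and assume that $\boldsymbol\Sigma_T^{1/2}$ satisfies $\mathrm{RE}(s,3,K)$ with parameter $\gamma>0$ ($\gamma$ may depend on $n$): for all $S\subset\{1,\dots,p\}$ with $\mathrm{card}(S)\le s$ and all $\boldsymbol A\in\mathbb R^{p\times(K-1)}$ with $\|\boldsymbol A_{S^c}\|_{1,2}\le 3\|\boldsymbol A_S\|_{1,2}$, $$\|\boldsymbol\Sigma_T^{1/2}\boldsymbol A\|_F^2\ge\|\boldsymbol A_S\|_F^2/\gamma .$$ There is an absolute constant $C_0>0$ such that, for every constant $C\ge C_0$ and every sequence of models and estimators as above, $$\mathrm{Tr}\{(\widehat{\boldsymbol B}-\boldsymbol B^*)^\top\boldsymbol\Sigma_T(\widehat{\boldsymbol B}-\boldsymbol B^*)\}=O_p\Big\{\lambda_{\max}(\boldsymbol\Sigma_T)\tau^2\gamma^2\frac{(K-1)s\log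 p}{n}\Big\},\qquad \|\widehat{\boldsymbol B}-\boldsymbol B^*\|_F^2=O_p\Big(\tau^2\gamma^2\frac{(K-1)s\log p}{n}\Big).$$ Here $b_n=O_p(a_n)$ means that for every $\varepsilon>0$ there is $M_\varepsilon$ with $P(|b_n|/a_n>M_\varepsilon)<\varepsilon$ for all $n\ge1$. -/

import Mathlib

open MeasureTheory ProbabilityTheory Filter
open scoped Matrix MatrixOrder

universe u

noncomputable section

namespace OptimalScoring

/-! ### Matrix norms and row operations -/

/-- Euclidean norm of the `i`-th row. -/
def rowNorm {q r : ℕ} (A : Matrix (Fin q) (Fin r) ℝ) (i : Fin q) : ℝ :=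
  √(∑ j, A i j ^ 2)

/-- Mixed norm `‖A‖_{1,2}`: the sum of the Euclidean norms of the rows. -/
def norm12 {q r : ℕ} (A : Matrix (Fin q) (Fin r) ℝ) : ℝ :=
  ∑ i, rowNorm A i

/-- Squared Frobenius norm `‖A‖_F²`. -/
def frobSq {q r : ℕ} (A : Matrix (Fin q) (Fin r) ℝ) : ℝ :=
  ∑ i, ∑ j, A i j ^ 2

/-- `A_S`: the rows of `A` outside `S` are replaced by zero. -/
def rowRestrict {q r : ℕ} (S : Finset (Fin q)) (A : Matrix (Fin q) (Fin r) ℝ) :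
    Matrix (Fin q) (Fin r) ℝ :=
  Matrix.of fun i j => if i ∈ S then A i j else 0

open Classical in
/-- Row support of a matrix. -/
def rowSupport {q r : ℕ} (A : Matrix (Fin q) (Fin r) ℝ) : Finset (Fin q) :=
  Finset.univ.filter fun i => rowNorm A i ≠ 0

/-- Largest eigenvalue of a real symmetric matrix. -/
def lambdaMax {q : ℕ} (A : Matrix (Fin q) (Fin q) ℝ) : ℝ :=
  sSup (spectrum ℝ A)

/-- Group restricted eigenvalue condition `RE(s, c, K)` with parameter `γ`. -/
def GroupRE {q p : ℕ} (s : ℕ) (c : ℝ) (K : ℕ) (Q : Matrix (Fin q) (Fin p) ℝ) (γ : ℝ) : Prop :=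
  0 < γ ∧ ∀ S : Finset (Fin p), S.card ≤ s → ∀ A : Matrix (Fin p) (Fin (K - 1)) ℝ,
    norm12 (rowRestrict Sᶜ A) ≤ c * norm12 (rowRestrict S A) →
      frobSq (rowRestrict S A) / γ ≤ frobSq (Q * A)

/-! ### Helpers for the orthogonal contrasts -/

/-- The sum of the first `t` entries of `a`. -/
def partialSum {K : ℕ} (a : Fin K → ℝ) (t : ℕ) : ℝ :=
  ∑ i with i.val < t, a i

/-- The class that the contrast `l` compares with all the preceding classes. The contrast that is
usually numbered `l + 1` has index `l` here, and compares class `l + 1` (counted from zero) with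
the classes `0, …, l`. -/
def nextClass {K : ℕ} (l : Fin (K - 1)) : Fin K :=
  ⟨l.val + 1, by omega⟩

/-! ### Population quantities

`prior k` is the probability of class `k`, `mean k` its mean vector and `SW` the common
within-class covariance matrix. -/

/-- Marginal law of a feature vector: the Gaussian mixture over the classes. -/
def featureLaw {p K : ℕ} (prior : Fin K → ℝ) (mean : Fin K → EuclideanSpace ℝ (Fin p))
    (SW : Matrix (Fin p) (Fin p) ℝ) : Measure (EuclideanSpace ℝ (Fin p)) :=
  ∑ k, ENNReal.ofReal (prior k) • multivariateGaussian (mean k) SW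

/-- `Σ_T`, the marginal covariance matrix of a feature vector. -/
def totalCov {p K : ℕ} (prior : Fin K → ℝ) (mean : Fin K → EuclideanSpace ℝ (Fin p))
    (SW : Matrix (Fin p) (Fin p) ℝ) : Matrix (Fin p) (Fin p) ℝ :=
  Matrix.of fun i j => covariance (fun v => v i) (fun v => v j) (featureLaw prior mean SW)

/-- `Δ`, the matrix of orthogonal mean contrasts. -/
def contrasts {p K : ℕ} (prior : Fin K → ℝ) (mean : Fin K → EuclideanSpace ℝ (Fin p)) :
    Matrix (Fin p) (Fin (K - 1)) ℝ :=
  Matrix.of fun j r =>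
    √(prior (nextClass r)) *
        (∑ k with k.val < r.val + 1, prior k * (mean k j - mean (nextClass r) j)) /
      √(partialSum prior (r.val + 1) * partialSum prior (r.val + 2))

/-- `B* = Σ_T⁻¹ Δ`. -/
def Bstar {p K : ℕ} (prior : Fin K → ℝ) (mean : Fin K → EuclideanSpace ℝ (Fin p))
    (SW : Matrix (Fin p) (Fin p) ℝ) : Matrix (Fin p) (Fin (K - 1)) ℝ :=
  (totalCov prior mean SW)⁻¹ * contrasts prior mean

/-- `τ = max_j √(σ_j² + max_k μ_{kj}²)`, where `σ_j²` is the `j`-th diagonal entry of `SW`. -/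
def tau {p K : ℕ} (mean : Fin K → EuclideanSpace ℝ (Fin p)) (SW : Matrix (Fin p) (Fin p) ℝ) : ℝ :=
  ⨆ j : Fin p, √(SW j j + ⨆ k : Fin K, mean k j ^ 2)

/-! ### The sample and the estimator -/

/-- `(x i, z i)`, `i < n`, are independent pairs of a feature vector and a class label; the label
is `k` with probability `prior k`, and given the label `k` the feature vector is Gaussian with
mean `mean k` and covariance matrix `SW`. -/
structure IsSample {Ω : Type u} [MeasurableSpace Ω] (P : Measure Ω) {n p K : ℕ}
    (x : Fin n → Ω → EuclideanSpace ℝ (Fin p)) (z : Fin n → Ω → Fin K)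
    (prior : Fin K → ℝ) (mean : Fin K → EuclideanSpace ℝ (Fin p))
    (SW : Matrix (Fin p) (Fin p) ℝ) : Prop where
  measurable_x : ∀ i, Measurable (x i)
  measurable_z : ∀ i, Measurable (z i)
  indep : iIndepFun (fun i ω => (x i ω, z i ω)) P
  prob_class : ∀ i k, P (z i ⁻¹' {k}) = ENNReal.ofReal (prior k)
  law_given_class : ∀ i k, (cond P (z i ⁻¹' {k})).map (x i) = multivariateGaussian (mean k) SW

/-- The data matrix whose rows are the feature vectors. -/
def dataMatrix {n p : ℕ} (x : Fin n → EuclideanSpace ℝ (Fin p)) : Matrix (Fin n) (Fin p) ℝ :=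
  Matrix.of fun i j => x i j

/-- Column-centering: the column means are subtracted. -/
def centerColumns {n p : ℕ} (X : Matrix (Fin n) (Fin p) ℝ) : Matrix (Fin n) (Fin p) ℝ :=
  Matrix.of fun i j => X i j - (∑ i', X i' j) / n

/-- `Z`, the class indicator matrix. -/
def indicatorMatrix {n K : ℕ} (z : Fin n → Fin K) : Matrix (Fin n) (Fin K) ℝ :=
  Matrix.of fun i k => if z i = k then 1 else 0

/-- `n_k`, the number of observations in class `k`. -/
def classSize {n K : ℕ} (z : Fin n → Fin K) (k : Fin K) : ℝ :=
  ((Finset.univ.filter fun i => z i = k).card : ℝ)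

/-- The explicit matrix of optimal scores. -/
def scores {n K : ℕ} (z : Fin n → Fin K) : Matrix (Fin K) (Fin (K - 1)) ℝ :=
  Matrix.of fun k l =>
    let N : ℕ → ℝ := partialSum (classSize z)
    let m : ℝ := classSize z (nextClass l)
    if k.val < l.val + 1 then √(n * m / (N (l.val + 1) * N (l.val + 2)))
    else if k.val = l.val + 1 then -√(n * N (l.val + 1) / (m * N (l.val + 2)))
    else 0

/-- `Y`, the indicator matrix times the matrix of scores. -/
def response {n K : ℕ} (z : Fin n → Fin K) : Matrix (Fin n) (Fin (K - 1)) ℝ :=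
  indicatorMatrix z * scores z

/-- The objective `(2n)⁻¹ ‖Y - X B‖_F² + lam ‖B‖_{1,2}`. -/
def objective {n p r : ℕ} (Y : Matrix (Fin n) (Fin r) ℝ) (X : Matrix (Fin n) (Fin p) ℝ)
    (lam : ℝ) (B : Matrix (Fin p) (Fin r) ℝ) : ℝ :=
  (2 * (n : ℝ))⁻¹ * frobSq (Y - X * B) + lam * norm12 B

/-- `b n = O_p(a n)`, for `a n > 0`, over all sample sizes `n ≥ 1`; the random variables for
different `n` may live on different probability spaces. -/
def IsBigOInProb {Ω : ℕ → Type u} [∀ n, MeasurableSpace (Ω n)] (P : ∀ n, Measure (Ω n))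
    (b : ∀ n, Ω n → ℝ) (a : ℕ → ℝ) : Prop :=
  ∀ ε : ℝ, 0 < ε → ∃ M : ℝ, ∀ n : ℕ, 1 ≤ n →
    P n {ω | M < |b n ω| / a n} < ENNReal.ofReal ε

end OptimalScoring

end

open OptimalScoring

/-! Write `x` for a feature vector, `g` for its label and `θ_l(g)` for the population score
`scoreFun prior l g`. The scores are centred with unit second moment, and `E[x θ_l(g)] = Δ_l`
(`contrasts_eq_sum`). So `B*_l = Σ_T⁻¹ Δ_l` is the population least squares coefficient of `θ_l(g)`
on `x`. The residual `θ_l(g) - xᵀB*_l` is uncorrelated with `x` (`integral_linFun_mul_residual`) and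
has second moment `1 - B*_lᵀ Σ_T B*_l`, which lies in `[0, 1]`. The estimator is thus a group lasso
for a regression with sub-Gaussian random design and uncorrelated noise; the sample scores differ
from the population scores by `O(n^{-1/2})`.

The randomness is confined to the event `IsGoodSample`, with two main ingredients. (1) A lower
isometry (`lower_isometry`): for all `v`, the sample second moment of `vᵀx` is at least `vᵀΣ_T v / 2
- c τ² (log p / n) ‖v‖₁²`. It is proved at sums of `m ≍ n / log p` signed basis vectors, by a union
bound over a one-sided tail that needs only fourth moments, and extended to all `v` by Maurey's
averaging argument (`quadForm_ge_of_signedBasis`). (2) A noise bound. Bernstein's inequality holds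
with a variance proxy `2048 τ²` that is free of `piMin`, so the maximum norm of the noise is below
`200 τ √(log p / n)`; this is why the threshold for `C` is absolute. The failure probability is a
negative power of `p`, which is not small for bounded `p`. For `p < p₀` Chebyshev's inequality in
whitened coordinates bounds the noise instead by `n^{-1/2}` times the `Σ_T`-norm, a parametric
remainder.

On a good sample, `basic_inequality`, the isometry and the restricted eigenvalue condition reduce to
the scalar `oracle_bound`. Let `r = τ² γ s log p / n`. On the cone with small `r`, the restricted
eigenvalue condition absorbs the defect of the isometry and yields the fast rate. When `r` is not
small, the slow rate `λ ‖B*‖_{1,2}` is already of the right order, because the restricted eigenvalue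
condition at `B*` and the energy bound give `‖B*‖_{1,2}² ≤ s γ (K - 1)`. Off the cone only the
parametric remainder survives.

Since `K ≤ 1 / piMin`, sums and union bounds over classes cost constants. Testing the restricted
eigenvalue condition on one coordinate gives `γ τ² ≥ 1` and `γ λ_max ≥ 1`; the latter turns the
prediction bound `(K - 1) r` into the stated one. Good samples are likely once `n` is large and `log
p / n` is small. For each of the finitely many other `n` the error is bounded outright, because `Y`
takes finitely many values. -/

namespace OptimalScoring

/-! ### Concentration of sums of independent, identically distributed variables -/

section IID

variable {Ω S : Type*} [MeasurableSpace Ω] [MeasurableSpace S] {P : Measure Ω} {Q : Measure S}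
  {n : ℕ} {ζ : Fin n → Ω → S}

/-- `ζ i`, `i < n`, are independent with common law `Q`. -/
structure IsIID (P : Measure Ω) (Q : Measure S) (ζ : Fin n → Ω → S) : Prop where
  measurable : ∀ i, Measurable (ζ i)
  indep : iIndepFun ζ P
  law : ∀ i, P.map (ζ i) = Q

lemma IsIID.lintegral_comp (h : IsIID P Q ζ) (i : Fin n) {f : S → ENNReal} (hf : Measurable f) :
    ∫⁻ ω, f (ζ i ω) ∂P = ∫⁻ y, f y ∂Q := by
  rw [← h.law i, lintegral_map hf (h.measurable i)]

lemma IsIID.lintegral_exp_sum (h : IsIID P Q ζ) {f : S → ℝ} (hf : Measurable f) :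
    ∫⁻ ω, ENNReal.ofReal (Real.exp (∑ i, f (ζ i ω))) ∂P
      = (∫⁻ y, ENNReal.ofReal (Real.exp (f y)) ∂Q) ^ n := by
  have hg : Measurable fun y => ENNReal.ofReal (Real.exp (f y)) := by fun_prop
  have h1 := lintegral_prod_eq_prod_lintegral_of_indepFun (μ := P) Finset.univ
    (fun (i : Fin n) ω => ENNReal.ofReal (Real.exp (f (ζ i ω))))
    (h.indep.comp (fun _ y => ENNReal.ofReal (Real.exp (f y))) (fun _ => hg))
    (fun i => hg.comp (h.measurable i))
  have h2 : ∀ ω, ENNReal.ofReal (Real.exp (∑ i, f (ζ i ω)))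
      = ∏ i, ENNReal.ofReal (Real.exp (f (ζ i ω))) := fun ω => by
    rw [Real.exp_sum, ENNReal.ofReal_prod_of_nonneg fun i _ => (Real.exp_pos _).le]
  simp_rw [h2, h1, fun i => h.lintegral_comp i hg]
  simp

lemma IsIID.chernoff (h : IsIID P Q ζ) {f : S → ℝ} (hf : Measurable f) {β : ℝ}
    (hβ : ∫⁻ y, ENNReal.ofReal (Real.exp (f y)) ∂Q ≤ ENNReal.ofReal (Real.exp β)) (a : ℝ) :
    P {ω | a ≤ ∑ i, f (ζ i ω)} ≤ ENNReal.ofReal (Real.exp (n * β - a)) := by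
  have hm : Measurable fun ω => ENNReal.ofReal (Real.exp (∑ i, f (ζ i ω))) := by
    have : ∀ i, Measurable fun ω => f (ζ i ω) := fun i => hf.comp (h.measurable i)
    exact (Real.measurable_exp.comp (Finset.measurable_sum _ fun i _ => this i)).ennreal_ofReal
  have h1 := mul_meas_ge_le_lintegral (μ := P) hm (ENNReal.ofReal (Real.exp a))
  rw [h.lintegral_exp_sum hf] at h1
  have h2 : {ω | a ≤ ∑ i, f (ζ i ω)} = {ω | ENNReal.ofReal (Real.exp a)
      ≤ ENNReal.ofReal (Real.exp (∑ i, f (ζ i ω)))} := by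
    ext ω
    simp [ENNReal.ofReal_le_ofReal_iff (Real.exp_pos _).le]
  rw [← h2] at h1
  have h3 : ENNReal.ofReal (Real.exp (n * β - a))
      = ENNReal.ofReal (Real.exp β) ^ n / ENNReal.ofReal (Real.exp a) := by
    rw [← ENNReal.ofReal_pow (Real.exp_pos _).le,
      ← ENNReal.ofReal_div_of_pos (Real.exp_pos _), Real.exp_sub, Real.exp_nat_mul]
  rw [h3, ENNReal.le_div_iff_mul_le (Or.inl (by simp [Real.exp_pos])) (Or.inl (by simp)), mul_comm]
  exact h1.trans (by gcongr)

/-- For `x ≥ 0` insert `e^x ≤ 1 + x e^x` into its own right side. For `x ≤ 0`, multiplying `1 + x ≤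
e^x` by `x` gives the stronger bound `1 + x + x²`. -/
lemma exp_le_one_add_add_sq_mul_exp_abs (x : ℝ) :
    Real.exp x ≤ 1 + x + x ^ 2 * Real.exp |x| := by
  have h1 : Real.exp x - 1 ≤ x * Real.exp x := by
    have := Real.one_sub_le_exp_neg x
    have h := mul_le_mul_of_nonneg_right this (Real.exp_pos x).le
    rw [← Real.exp_add] at h
    simp at h
    linarith
  rcases le_total 0 x with hx | hx
  · rw [abs_of_nonneg hx]
    nlinarith [mul_le_mul_of_nonneg_left h1 hx]
  · rw [abs_of_nonpos hx]
    have h2 : 1 + x ≤ Real.exp x := by linarith [Real.add_one_le_exp x]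
    have h3 : 1 ≤ Real.exp (-x) := Real.one_le_exp (by linarith)
    nlinarith [mul_le_mul_of_nonpos_left h2 hx, mul_le_mul_of_nonneg_left h3 (sq_nonneg x)]

/-- Invert `1 + x + x²/2 ≤ e^x`: the product `(1 + x²/2 + x)(1 + x²/2 - x) = 1 + x⁴/4` is at least
`1`. -/
lemma exp_neg_le_of_nonneg {x : ℝ} (hx : 0 ≤ x) : Real.exp (-x) ≤ 1 - x + x ^ 2 / 2 := by
  have h := Real.quadratic_le_exp_of_nonneg hx
  rw [Real.exp_neg, inv_le_iff_one_le_mul₀ (Real.exp_pos x)]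
  have h2 : (0:ℝ) ≤ 1 - x + x ^ 2 / 2 := by nlinarith [sq_nonneg (x - 1)]
  nlinarith [mul_le_mul_of_nonneg_left h h2, sq_nonneg (x ^ 2)]

/-- Bound for the moment generating function of a centred variable. -/
lemma lintegral_exp_mul_le [IsProbabilityMeasure Q] {f : S → ℝ} (hf : Measurable f)
    (hint : Integrable f Q) (h0 : ∫ y, f y ∂Q = 0) {t₀ V : ℝ} (hV : 0 ≤ V)
    (hfV : ∫⁻ y, ENNReal.ofReal (f y ^ 2 * Real.exp (t₀ * |f y|)) ∂Q ≤ ENNReal.ofReal V)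
    {t : ℝ} (ht : |t| ≤ t₀) :
    ∫⁻ y, ENNReal.ofReal (Real.exp (t * f y)) ∂Q ≤ ENNReal.ofReal (Real.exp (t ^ 2 * V)) := by
  have hgm : Measurable fun y => f y ^ 2 * Real.exp (t₀ * |f y|) := by fun_prop
  have hg0 : ∀ y, 0 ≤ f y ^ 2 * Real.exp (t₀ * |f y|) := fun y => by positivity
  have hg : Integrable (fun y => f y ^ 2 * Real.exp (t₀ * |f y|)) Q :=
    (lintegral_ofReal_ne_top_iff_integrable hgm.aestronglyMeasurable (ae_of_all _ hg0)).1
      (ne_top_of_le_ne_top ENNReal.ofReal_ne_top hfV)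
  have hgV : ∫ y, f y ^ 2 * Real.exp (t₀ * |f y|) ∂Q ≤ V := by
    rw [integral_eq_lintegral_of_nonneg_ae (ae_of_all _ hg0) hgm.aestronglyMeasurable]
    exact ENNReal.toReal_le_of_le_ofReal hV hfV
  have hpt : ∀ y, Real.exp (t * f y)
      ≤ 1 + t * f y + t ^ 2 * (f y ^ 2 * Real.exp (t₀ * |f y|)) := fun y => by
    refine (exp_le_one_add_add_sq_mul_exp_abs _).trans ?_
    rw [abs_mul, mul_pow, mul_assoc]
    gcongr
  have hI : Integrable (fun y => 1 + t * f y + t ^ 2 * (f y ^ 2 * Real.exp (t₀ * |f y|))) Q :=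
    ((integrable_const _).add (hint.const_mul t)).add (hg.const_mul _)
  calc ∫⁻ y, ENNReal.ofReal (Real.exp (t * f y)) ∂Q
      ≤ ∫⁻ y, ENNReal.ofReal (1 + t * f y + t ^ 2 * (f y ^ 2 * Real.exp (t₀ * |f y|))) ∂Q :=
        lintegral_mono fun y => ENNReal.ofReal_le_ofReal (hpt y)
    _ = ENNReal.ofReal (∫ y, (1 + t * f y + t ^ 2 * (f y ^ 2 * Real.exp (t₀ * |f y|))) ∂Q) := by
        rw [ofReal_integral_eq_lintegral_ofReal hI
          (ae_of_all _ fun y => (Real.exp_pos _).le.trans (hpt y))]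
    _ ≤ _ := by
        refine ENNReal.ofReal_le_ofReal ?_
        have hI' : Integrable (fun y => 1 + t * f y) Q := (integrable_const _).add (hint.const_mul t)
        rw [integral_add hI' (hg.const_mul _),
          integral_add (integrable_const _) (hint.const_mul t), integral_const_mul,
          integral_const_mul, h0]
        simp only [integral_const, probReal_univ, smul_eq_mul, mul_one, mul_zero, add_zero]
        have := mul_le_mul_of_nonneg_left hgV (sq_nonneg t)
        linarith [Real.add_one_le_exp (t ^ 2 * V)]

/-- Bernstein's inequality. -/
lemma IsIID.bernstein [IsProbabilityMeasure Q] (h : IsIID P Q ζ) {f : S → ℝ} (hf : Measurable f)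
    (hint : Integrable f Q) (h0 : ∫ y, f y ∂Q = 0) {t₀ V : ℝ} (hV : 0 < V)
    (hfV : ∫⁻ y, ENNReal.ofReal (f y ^ 2 * Real.exp (t₀ * |f y|)) ∂Q ≤ ENNReal.ofReal V)
    {a : ℝ} (ha : 0 ≤ a) (hat : a ≤ 2 * V * t₀) :
    P {ω | n * a ≤ |∑ i, f (ζ i ω)|} ≤ ENNReal.ofReal (2 * Real.exp (-(n * a ^ 2 / (4 * V)))) := by
  -- The minimiser of `t² V - t a`; the assumption on `a` keeps it below `t₀`.
  set t : ℝ := a / (2 * V) with ht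
  have ht0 : 0 ≤ t := by positivity
  have htt : t ≤ t₀ := by rw [ht, div_le_iff₀ (by positivity)]; linarith
  have key : n * (t ^ 2 * V) - t * (n * a) = -(n * a ^ 2 / (4 * V)) := by
    rw [ht]; field_simp; ring
  rcases eq_or_lt_of_le ht0 with ht1 | ht1
  · have ha0 : a = 0 := by
      have := ht1.symm
      rw [ht, div_eq_zero_iff] at this
      rcases this with h | h
      · exact h
      · linarith
    have hP : P Set.univ ≤ 1 ∨ n = 0 := by
      rcases Nat.eq_zero_or_pos n with hn | hn
      · exact Or.inr hn
      · left
        have : P.map (ζ ⟨0, hn⟩) Set.univ = Q Set.univ := by rw [h.law]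
        rw [Measure.map_apply (h.measurable _) MeasurableSet.univ] at this
        simpa using this.le
    -- For `a = 0` the right side is `2`. Here `P` is not assumed to be a probability measure, but
    -- the Chernoff bound for the zero function shows that its mass is at most `1`.
    have := h.chernoff (f := fun _ => (0:ℝ)) measurable_const (β := 0) (by simp) 0
    simp only [Finset.sum_const_zero, le_refl, Set.ofPred_true, mul_zero, sub_zero,
      Real.exp_zero] at this
    refine (measure_mono (Set.subset_univ _)).trans (this.trans (ENNReal.ofReal_le_ofReal ?_))
    simp [ha0]
  have hp := h.chernoff (f := fun y => t * f y) (by fun_prop)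
    (lintegral_exp_mul_le hf hint h0 hV.le hfV (t := t) (by rwa [abs_of_nonneg ht0])) (t * (n * a))
  have hm := h.chernoff (f := fun y => (-t) * f y) (by fun_prop)
    (lintegral_exp_mul_le hf hint h0 hV.le hfV (t := -t) (by rwa [abs_neg, abs_of_nonneg ht0]))
    (t * (n * a))
  rw [neg_sq] at hm
  rw [key] at hp hm
  have hsub : {ω | n * a ≤ |∑ i, f (ζ i ω)|} ⊆ {ω | t * (n * a) ≤ ∑ i, t * f (ζ i ω)}
      ∪ {ω | t * (n * a) ≤ ∑ i, (-t) * f (ζ i ω)} := by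
    intro ω hω
    simp only [Set.mem_ofPred_eq, Set.mem_union, ← Finset.mul_sum] at hω ⊢
    rcases le_abs.1 hω with h1 | h1
    · left; gcongr
    · right
      have := mul_le_mul_of_nonneg_left h1 ht0
      linarith
  refine (measure_mono hsub).trans ((measure_union_le _ _).trans ((add_le_add hp hm).trans ?_))
  rw [← ENNReal.ofReal_add (Real.exp_pos _).le (Real.exp_pos _).le, two_mul]

/-- Lower tail of a sum of squares, from a bound for the fourth moment. -/
lemma IsIID.lower_tail_sq [IsProbabilityMeasure Q] (h : IsIID P Q ζ) {f : S → ℝ}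
    (hf : Measurable f) {σ2 κ : ℝ} (hσ : 0 < σ2) (hκ : 0 < κ)
    (h2 : Integrable (fun y => f y ^ 2) Q) (h4 : Integrable (fun y => f y ^ 4) Q)
    (hE2 : ∫ y, f y ^ 2 ∂Q = σ2) (hE4 : ∫ y, f y ^ 4 ∂Q ≤ κ * σ2 ^ 2) :
    P {ω | ∑ i, f (ζ i ω) ^ 2 ≤ n * (σ2 / 2)} ≤ ENNReal.ofReal (Real.exp (-(n / (8 * κ)))) := by
  -- The minimiser of `-t σ2 / 2 + t² κ σ2² / 2`, with minimum `-1 / (8 κ)`. No exponential moment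
  -- is needed, since `f ^ 2` is nonnegative and only its lower tail is bounded.
  set t : ℝ := 1 / (2 * κ * σ2) with ht
  have ht0 : 0 < t := by positivity
  have hI : Integrable (fun y => 1 - t * f y ^ 2 + t ^ 2 / 2 * f y ^ 4) Q :=
    ((integrable_const _).sub (h2.const_mul t)).add (h4.const_mul _)
  have hpt : ∀ y, Real.exp (-t * f y ^ 2) ≤ 1 - t * f y ^ 2 + t ^ 2 / 2 * f y ^ 4 := fun y => by
    have := exp_neg_le_of_nonneg (x := t * f y ^ 2) (by positivity)
    rw [neg_mul]
    refine this.trans_eq ?_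
    ring
  have hβ : ∫⁻ y, ENNReal.ofReal (Real.exp (-t * f y ^ 2)) ∂Q
      ≤ ENNReal.ofReal (Real.exp (-t * σ2 + t ^ 2 / 2 * (κ * σ2 ^ 2))) := by
    calc _ ≤ ∫⁻ y, ENNReal.ofReal (1 - t * f y ^ 2 + t ^ 2 / 2 * f y ^ 4) ∂Q :=
          lintegral_mono fun y => ENNReal.ofReal_le_ofReal (hpt y)
      _ = ENNReal.ofReal (∫ y, (1 - t * f y ^ 2 + t ^ 2 / 2 * f y ^ 4) ∂Q) := by
          rw [ofReal_integral_eq_lintegral_ofReal hI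
            (ae_of_all _ fun y => (Real.exp_pos _).le.trans (hpt y))]
      _ ≤ _ := by
          refine ENNReal.ofReal_le_ofReal ?_
          have hI' : Integrable (fun y => 1 - t * f y ^ 2) Q :=
            (integrable_const _).sub (h2.const_mul t)
          rw [integral_add hI' (h4.const_mul _),
            integral_sub (integrable_const _) (h2.const_mul t), integral_const_mul,
            integral_const_mul, hE2]
          simp only [integral_const, probReal_univ, smul_eq_mul, mul_one]
          have := mul_le_mul_of_nonneg_left hE4 (show 0 ≤ t ^ 2 / 2 by positivity)
          linarith [Real.add_one_le_exp (-t * σ2 + t ^ 2 / 2 * (κ * σ2 ^ 2))]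
  have hc := h.chernoff (f := fun y => -t * f y ^ 2) (by fun_prop) hβ (-t * (n * (σ2 / 2)))
  have key : n * (-t * σ2 + t ^ 2 / 2 * (κ * σ2 ^ 2)) - -t * (n * (σ2 / 2)) = -(n / (8 * κ)) := by
    rw [ht]; field_simp; ring
  rw [key] at hc
  refine (measure_mono fun ω hω => ?_).trans hc
  simp only [Set.mem_ofPred_eq, ← Finset.mul_sum] at hω ⊢
  exact mul_le_mul_of_nonpos_left hω (by linarith)

/-- Chebyshev's inequality. -/
lemma IsIID.chebyshev [IsProbabilityMeasure P] (h : IsIID P Q ζ) {f : S → ℝ} (hf : Measurable f)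
    (hL2 : MemLp f 2 Q) (h0 : ∫ y, f y ∂Q = 0) {V : ℝ} (hV : ∫ y, f y ^ 2 ∂Q ≤ V)
    {a : ℝ} (ha : 0 < a) (hn : 0 < n) :
    P {ω | √(a * n) ≤ |∑ i, f (ζ i ω)|} ≤ ENNReal.ofReal (V / a) := by
  have hmem : ∀ i, MemLp (fun ω => f (ζ i ω)) 2 P := fun i =>
    MemLp.comp_measurePreserving (g := f) hL2 ⟨h.measurable i, h.law i⟩
  have hint : ∀ i, ∫ ω, f (ζ i ω) ∂P = 0 := fun i => by
    rw [← h0, ← h.law i, integral_map (h.measurable i).aemeasurable hf.aestronglyMeasurable]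
  have hvar : ∀ i, Var[fun ω => f (ζ i ω); P] ≤ V := fun i => by
    rw [variance_of_integral_eq_zero (hmem i).aemeasurable (hint i)]
    refine le_trans (le_of_eq ?_) hV
    have : Measurable fun y => f y ^ 2 := by fun_prop
    rw [← h.law i, integral_map (h.measurable i).aemeasurable this.aestronglyMeasurable]
  have hind : iIndepFun (fun i ω => f (ζ i ω)) P := h.indep.comp (fun _ => f) (fun _ => hf)
  have hsum := IndepFun.variance_sum (μ := P) (s := Finset.univ) (X := fun i ω => f (ζ i ω))
    (fun i _ => hmem i) (fun i _ j _ hij => hind.indepFun hij)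
  have hfun : (∑ i, fun ω => f (ζ i ω)) = fun ω => ∑ i, f (ζ i ω) := by ext; simp
  have hn' : (0:ℝ) < n := by exact_mod_cast hn
  have hE : ∫ ω, ∑ i, f (ζ i ω) ∂P = 0 := by
    rw [integral_finsetSum _ fun i _ => (hmem i).integrable (by norm_num)]
    simp [hint]
  have hc := meas_ge_le_variance_div_sq (μ := P) (X := fun ω => ∑ i, f (ζ i ω))
    (hfun ▸ memLp_finsetSum' _ fun i _ => hmem i) (c := √(a * n)) (by positivity)
  rw [hE] at hc
  simp only [sub_zero] at hc
  refine hc.trans (ENNReal.ofReal_le_ofReal ?_)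
  rw [Real.sq_sqrt (by positivity), ← hfun, hsum]
  have : ∑ i, Var[fun ω => f (ζ i ω); P] ≤ n * V :=
    (Finset.sum_le_sum fun i _ => hvar i).trans (by simp)
  rw [div_le_div_iff₀ (by positivity) ha]
  nlinarith

end IID

/-! ### Gaussian integrals -/

/-- By `x² ≤ 2 m² + 2 (x - m)²`, the exponent is at most `1/4 + (x - m)² / (4 w)`, which uses up
half of the Gaussian exponent. What remains integrates to `e^{1/4} √2 ≤ 2`. The Dirac case `w = 0`
is separate; it occurs because the covariance matrix is only semidefinite. -/
lemma lintegral_exp_sq_gaussianReal (m : ℝ) (w : NNReal) {V : ℝ} (hV : 0 < V)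
    (h : m ^ 2 + w ≤ V) :
    ∫⁻ x, ENNReal.ofReal (Real.exp (x ^ 2 / (8 * V))) ∂(gaussianReal m w) ≤ 2 := by
  have hw0 : (0 : ℝ) ≤ w := w.2
  have hm0 := sq_nonneg m
  have hexp : Real.exp (1 / 4) ≤ √2 := by
    apply Real.le_sqrt_of_sq_le
    rw [← Real.exp_nat_mul]
    norm_num
    have h1 : Real.exp (1 / 2) ^ 2 = Real.exp 1 := by rw [← Real.exp_nat_mul]; norm_num
    have h2 := Real.exp_one_lt_d9
    nlinarith [Real.exp_pos (1 / 2)]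
  rcases eq_or_ne w 0 with hw | hw
  · rw [hw, gaussianReal_zero_var, lintegral_dirac' _ (by fun_prop)]
    have : m ^ 2 / (8 * V) ≤ 1 / 4 := by
      rw [div_le_iff₀ (by positivity)]; nlinarith
    have h2 : Real.exp (m ^ 2 / (8 * V)) ≤ 2 := by
      refine (Real.exp_le_exp.2 this).trans (hexp.trans ?_)
      rw [Real.sqrt_le_left (by norm_num)]; norm_num
    simpa using ENNReal.ofReal_le_ofReal h2
  · have hwpos : (0 : ℝ) < w := by positivity
    have hmeas : Measurable fun x : ℝ => ENNReal.ofReal (Real.exp (x ^ 2 / (8 * V))) := by fun_prop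
    rw [gaussianReal_of_var_ne_zero m hw,
      lintegral_withDensity_eq_lintegral_mul _ (measurable_gaussianPDF m w) hmeas]
    set c : ℝ := (√(2 * Real.pi * w))⁻¹ * Real.exp (1 / 4) with hc
    have hc0 : 0 ≤ c := by positivity
    have hpt : ∀ x : ℝ, gaussianPDFReal m w x * Real.exp (x ^ 2 / (8 * V))
        ≤ c * Real.exp (-(1 / (4 * w)) * (x - m) ^ 2) := fun x => by
      rw [gaussianPDFReal_def, hc]
      simp only []
      rw [mul_assoc (√(2 * Real.pi * w))⁻¹, mul_assoc (√(2 * Real.pi * w))⁻¹, ← Real.exp_add,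
        ← Real.exp_add]
      refine mul_le_mul_of_nonneg_left (Real.exp_le_exp.2 ?_) (by positivity)
      have h1 : x ^ 2 / (8 * V) ≤ m ^ 2 / (4 * V) + (x - m) ^ 2 / (4 * V) := by
        rw [← add_div, div_le_div_iff₀ (by positivity) (by positivity)]
        nlinarith [mul_nonneg hV.le (sq_nonneg (x - 2 * m))]
      have h2 : m ^ 2 / (4 * V) ≤ 1 / 4 := by
        rw [div_le_iff₀ (by positivity)]; nlinarith
      have h3 : (x - m) ^ 2 / (4 * V) ≤ (x - m) ^ 2 / (4 * w) := by
        gcongr; linarith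
      have h4 : -(x - m) ^ 2 / (2 * w) + (x - m) ^ 2 / (4 * w) = -(1 / (4 * w)) * (x - m) ^ 2 := by
        field_simp; ring
      linarith
    have hval : ∫ x : ℝ, c * Real.exp (-(1 / (4 * w)) * (x - m) ^ 2) = Real.exp (1 / 4) * √2 := by
      rw [integral_const_mul, integral_sub_right_eq_self
        (fun x : ℝ => Real.exp (-(1 / (4 * (w : ℝ))) * x ^ 2)) m, integral_gaussian, hc,
        show Real.pi / (1 / (4 * (w : ℝ))) = 2 * (2 * Real.pi * w) by field_simp; ring,
        Real.sqrt_mul (show (0 : ℝ) ≤ 2 by norm_num) (2 * Real.pi * w)]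
      have h0 : √(2 * Real.pi * w) ≠ 0 := by positivity
      generalize √(2 * Real.pi * w) = y at h0 ⊢
      field_simp
    have hint : Integrable (fun x : ℝ => c * Real.exp (-(1 / (4 * w)) * (x - m) ^ 2)) :=
      ((integrable_exp_neg_mul_sq (b := 1 / (4 * (w : ℝ))) (by positivity)).comp_sub_right m).const_mul c
    calc _ ≤ ∫⁻ x, ENNReal.ofReal (c * Real.exp (-(1 / (4 * w)) * (x - m) ^ 2)) := by
          refine lintegral_mono fun x => ?_
          simp only [Pi.mul_apply, gaussianPDF]
          rw [← ENNReal.ofReal_mul (gaussianPDFReal_nonneg _ _ _)]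
          exact ENNReal.ofReal_le_ofReal (hpt x)
      _ = ENNReal.ofReal (Real.exp (1 / 4) * √2) := by
          rw [← ofReal_integral_eq_lintegral_ofReal hint
            (ae_of_all _ fun x => by positivity), hval]
      _ ≤ ENNReal.ofReal 2 := by
          refine ENNReal.ofReal_le_ofReal ?_
          nlinarith [Real.mul_self_sqrt (show (0:ℝ) ≤ 2 by norm_num), Real.sqrt_nonneg 2]
      _ = 2 := by simp

/-! ### Linear functionals of a Gaussian vector -/

section Multivariate

variable {p : ℕ} {μ : EuclideanSpace ℝ (Fin p)} {S : Matrix (Fin p) (Fin p) ℝ}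

/-- The linear functional with coefficients `b`. -/
noncomputable def linFun {p : ℕ} (b : Fin p → ℝ) : StrongDual ℝ (EuclideanSpace ℝ (Fin p)) :=
  innerSL ℝ (WithLp.toLp 2 b)

lemma linFun_apply (b : Fin p → ℝ) (v : EuclideanSpace ℝ (Fin p)) :
    linFun b v = ∑ j, b j * v j := by
  simp [linFun, PiLp.inner_apply, mul_comm]

lemma linFun_smul_add (a : ℝ) (b b' : Fin p → ℝ) (v : EuclideanSpace ℝ (Fin p)) :
    linFun (a • b + b') v = a * linFun b v + linFun b' v := by
  simp [linFun_apply, add_mul, Finset.sum_add_distrib, Finset.mul_sum, mul_assoc]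

lemma linFun_single [DecidableEq (Fin p)] (j : Fin p) (v : EuclideanSpace ℝ (Fin p)) :
    linFun (Pi.single j 1) v = v j := by
  simp [linFun_apply, Pi.single_apply]

lemma integral_linFun (b : Fin p → ℝ) :
    ∫ v, linFun b v ∂(multivariateGaussian μ S) = linFun b μ := by
  rw [(linFun b).integral_comp_id_comm IsGaussian.integrable_id]
  simp

lemma variance_linFun (hS : S.PosSemidef) (b : Fin p → ℝ) :
    Var[linFun b; multivariateGaussian μ S] = b ⬝ᵥ S *ᵥ b := by
  rw [← covariance_self (by fun_prop)]
  have := covarianceBilin_apply_eq_cov (μ := multivariateGaussian μ S)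
    IsGaussian.memLp_two_id (WithLp.toLp 2 b) (WithLp.toLp 2 b)
  rw [covarianceBilin_multivariateGaussian hS] at this
  exact this.symm

lemma map_linFun (hS : S.PosSemidef) (b : Fin p → ℝ) :
    (multivariateGaussian μ S).map (linFun b)
      = gaussianReal (linFun b μ) (b ⬝ᵥ S *ᵥ b).toNNReal := by
  rw [IsGaussian.map_eq_gaussianReal, integral_linFun, variance_linFun hS]

lemma dotProduct_mulVec_nonneg (hS : S.PosSemidef) (b : Fin p → ℝ) : 0 ≤ b ⬝ᵥ S *ᵥ b := by
  simpa using hS.dotProduct_mulVec_nonneg b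

lemma lintegral_exp_sq_linFun (hS : S.PosSemidef) (b : Fin p → ℝ) (c : ℝ) {V : ℝ} (hV : 0 < V)
    (h : (linFun b μ + c) ^ 2 + b ⬝ᵥ S *ᵥ b ≤ V) :
    ∫⁻ v, ENNReal.ofReal (Real.exp ((linFun b v + c) ^ 2 / (8 * V)))
      ∂(multivariateGaussian μ S) ≤ 2 := by
  have hf : Measurable fun x : ℝ => ENNReal.ofReal (Real.exp (x ^ 2 / (8 * V))) := by fun_prop
  have hf' : Measurable fun x : ℝ => ENNReal.ofReal (Real.exp ((x + c) ^ 2 / (8 * V))) := by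
    fun_prop
  have h1 := lintegral_map (μ := multivariateGaussian μ S) hf' (linFun b).measurable
  have h2 := lintegral_map (μ := gaussianReal (linFun b μ) (b ⬝ᵥ S *ᵥ b).toNNReal) hf
    (measurable_add_const c)
  rw [← h1, map_linFun hS, ← h2, gaussianReal_map_add_const]
  refine lintegral_exp_sq_gaussianReal _ _ hV ?_
  rwa [Real.coe_toNNReal _ (dotProduct_mulVec_nonneg hS b)]

lemma memLp_linFun_add (b : Fin p → ℝ) (c : ℝ) (q : ENNReal) (hq : q ≠ ⊤) :
    MemLp (fun v => linFun b v + c) q (multivariateGaussian μ S) := by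
  have : MemLp id q (multivariateGaussian μ S) := IsGaussian.memLp_id _ q hq
  exact ((linFun b).comp_memLp' this).add (memLp_const c)

lemma integral_sq_linFun (hS : S.PosSemidef) (b : Fin p → ℝ) (c : ℝ) :
    ∫ v, (linFun b v + c) ^ 2 ∂(multivariateGaussian μ S)
      = (linFun b μ + c) ^ 2 + b ⬝ᵥ S *ᵥ b := by
  have h := variance_eq_sub (memLp_linFun_add (μ := μ) (S := S) b c 2 (by simp))
  have hv : Var[fun v => linFun b v + c; multivariateGaussian μ S] = b ⬝ᵥ S *ᵥ b := by
    rw [← variance_linFun (μ := μ) hS b]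
    exact variance_add_const (by fun_prop) c
  have hi : Integrable (fun v => linFun b v) (multivariateGaussian μ S) :=
    (linFun b).integrable_comp IsGaussian.integrable_id
  have hE : ∫ v, (linFun b v + c) ∂(multivariateGaussian μ S) = linFun b μ + c := by
    rw [integral_add hi (integrable_const _), integral_linFun]
    simp
  rw [hv, hE] at h
  simp only [Pi.pow_apply] at h
  linarith

end Multivariate

/-! ### The law of a single observation -/

section Mixture

variable {p K : ℕ} {prior : Fin K → ℝ} {mean : Fin K → EuclideanSpace ℝ (Fin p)}
  {SW : Matrix (Fin p) (Fin p) ℝ}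

/-- The joint law of a feature vector and its class label. -/
noncomputable def obsLaw (prior : Fin K → ℝ) (mean : Fin K → EuclideanSpace ℝ (Fin p))
    (SW : Matrix (Fin p) (Fin p) ℝ) : Measure (EuclideanSpace ℝ (Fin p) × Fin K) :=
  ∑ k, ENNReal.ofReal (prior k) • (multivariateGaussian (mean k) SW).map fun v => (v, k)

lemma measurable_pair (k : Fin K) :
    Measurable fun v : EuclideanSpace ℝ (Fin p) => (v, k) := by fun_prop

lemma lintegral_obsLaw {f : EuclideanSpace ℝ (Fin p) × Fin K → ENNReal} (hf : Measurable f) :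
    ∫⁻ y, f y ∂(obsLaw prior mean SW)
      = ∑ k, ENNReal.ofReal (prior k) * ∫⁻ v, f (v, k) ∂(multivariateGaussian (mean k) SW) := by
  rw [obsLaw, lintegral_finsetSum_measure]
  refine Finset.sum_congr rfl fun k _ => ?_
  rw [lintegral_smul_measure, lintegral_map hf (measurable_pair k), smul_eq_mul]

lemma lintegral_obsLaw_le (hprior : ∀ k, 0 ≤ prior k)
    {f : EuclideanSpace ℝ (Fin p) × Fin K → ENNReal} (hf : Measurable f) {g : Fin K → ℝ}
    (hg : ∀ k, 0 ≤ g k)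
    (h : ∀ k, ∫⁻ v, f (v, k) ∂(multivariateGaussian (mean k) SW) ≤ ENNReal.ofReal (g k)) :
    ∫⁻ y, f y ∂(obsLaw prior mean SW) ≤ ENNReal.ofReal (∑ k, prior k * g k) := by
  rw [lintegral_obsLaw hf, ENNReal.ofReal_sum_of_nonneg fun k _ => mul_nonneg (hprior k) (hg k)]
  refine Finset.sum_le_sum fun k _ => ?_
  rw [ENNReal.ofReal_mul (hprior k)]
  gcongr
  exact h k

lemma integrable_obsLaw {f : EuclideanSpace ℝ (Fin p) × Fin K → ℝ} (hf : Measurable f)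
    (h : ∀ k, Integrable (fun v => f (v, k)) (multivariateGaussian (mean k) SW)) :
    Integrable f (obsLaw prior mean SW) := by
  rw [obsLaw, integrable_finsetSum_measure]
  intro k _
  refine Integrable.smul_measure ?_ ENNReal.ofReal_ne_top
  rw [integrable_map_measure hf.aestronglyMeasurable (measurable_pair k).aemeasurable]
  exact h k

lemma integral_obsLaw (hprior : ∀ k, 0 ≤ prior k) {f : EuclideanSpace ℝ (Fin p) × Fin K → ℝ}
    (hf : Measurable f)
    (h : ∀ k, Integrable (fun v => f (v, k)) (multivariateGaussian (mean k) SW)) :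
    ∫ y, f y ∂(obsLaw prior mean SW)
      = ∑ k, prior k * ∫ v, f (v, k) ∂(multivariateGaussian (mean k) SW) := by
  rw [obsLaw, integral_finsetSum_measure]
  · refine Finset.sum_congr rfl fun k _ => ?_
    rw [integral_smul_measure, integral_map (measurable_pair k).aemeasurable
      hf.aestronglyMeasurable, ENNReal.toReal_ofReal (hprior k), smul_eq_mul]
  · intro k _
    refine Integrable.smul_measure ?_ ENNReal.ofReal_ne_top
    rw [integrable_map_measure hf.aestronglyMeasurable (measurable_pair k).aemeasurable]
    exact h k

lemma isProbabilityMeasure_obsLaw (hprior : ∀ k, 0 ≤ prior k) (hsum : ∑ k, prior k = 1) :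
    IsProbabilityMeasure (obsLaw prior mean SW) := by
  constructor
  have := lintegral_obsLaw (prior := prior) (mean := mean) (SW := SW)
    (f := fun _ => 1) measurable_const
  simp only [lintegral_const, one_mul, measure_univ, mul_one] at this
  rw [this, ← ENNReal.ofReal_sum_of_nonneg fun k _ => hprior k, hsum, ENNReal.ofReal_one]

/-- Splitting over the label turns the conditional description of the sample into one common joint
law. All later probability estimates use only independence and `obsLaw`. -/
lemma IsSample.isIID {Ω : Type*} [MeasurableSpace Ω] {P : Measure Ω} [IsProbabilityMeasure P]
    {n : ℕ} {x : Fin n → Ω → EuclideanSpace ℝ (Fin p)} {z : Fin n → Ω → Fin K}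
    (h : IsSample P x z prior mean SW) :
    IsIID P (obsLaw prior mean SW) fun i ω => (x i ω, z i ω) := by
  refine ⟨fun i => (h.measurable_x i).prodMk (h.measurable_z i), h.indep, fun i => ?_⟩
  ext s hs
  have hz : ∀ k, MeasurableSet (z i ⁻¹' {k}) := fun k =>
    h.measurable_z i (measurableSet_singleton k)
  rw [Measure.map_apply ((h.measurable_x i).prodMk (h.measurable_z i)) hs]
  have h1 : (fun ω => (x i ω, z i ω)) ⁻¹' s
      = ⋃ k, (z i ⁻¹' {k} ∩ x i ⁻¹' ((fun v => (v, k)) ⁻¹' s)) := by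
    ext ω
    simp
  have hsk : ∀ k, MeasurableSet ((fun v : EuclideanSpace ℝ (Fin p) => (v, k)) ⁻¹' s) := fun k =>
    measurable_pair k hs
  rw [h1, measure_iUnion, tsum_fintype, obsLaw, Measure.finsetSum_apply]
  · refine Finset.sum_congr rfl fun k _ => ?_
    rw [Measure.smul_apply, Measure.map_apply (measurable_pair k) hs, ← h.law_given_class i k,
      Measure.map_apply (h.measurable_x i) (hsk k), smul_eq_mul, ← h.prob_class i k, mul_comm,
      cond_mul_eq_inter (hz k)]
  · intro k l hkl
    refine Set.disjoint_left.2 fun ω hω hω' => hkl ?_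
    have e1 : z i ω = k := by simpa using hω.1
    have e2 : z i ω = l := by simpa using hω'.1
    rw [← e1, e2]
  · exact fun k => (hz k).inter (h.measurable_x i (hsk k))

/-- An affine functional of the feature vector, with an intercept that depends on the class. -/
noncomputable def affFun (b : Fin p → ℝ) (c : Fin K → ℝ) (y : EuclideanSpace ℝ (Fin p) × Fin K) : ℝ :=
  linFun b y.1 + c y.2

lemma measurable_affFun (b : Fin p → ℝ) (c : Fin K → ℝ) : Measurable (affFun b c) := by
  have h1 : Measurable fun y : EuclideanSpace ℝ (Fin p) × Fin K => linFun b y.1 :=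
    (linFun b).measurable.comp measurable_fst
  have h2 : Measurable fun y : EuclideanSpace ℝ (Fin p) × Fin K => c y.2 :=
    (measurable_of_countable c).comp measurable_snd
  exact h1.add h2

lemma affFun_add (b b' : Fin p → ℝ) (c c' : Fin K → ℝ) (y : EuclideanSpace ℝ (Fin p) × Fin K) :
    affFun (b + b') (c + c') y = affFun b c y + affFun b' c' y := by
  have := linFun_smul_add 1 b b' y.1
  simp only [one_smul, one_mul] at this
  simp only [affFun, this, Pi.add_apply]
  ring

/-- The second moment of an affine functional in the class `k`. -/
noncomputable def classMoment (mean : Fin K → EuclideanSpace ℝ (Fin p)) (SW : Matrix (Fin p) (Fin p) ℝ)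
    (b : Fin p → ℝ) (c : Fin K → ℝ) (k : Fin K) : ℝ :=
  (linFun b (mean k) + c k) ^ 2 + b ⬝ᵥ SW *ᵥ b

lemma classMoment_nonneg (hS : SW.PosSemidef) (b : Fin p → ℝ) (c : Fin K → ℝ) (k : Fin K) :
    0 ≤ classMoment mean SW b c k :=
  add_nonneg (sq_nonneg _) (dotProduct_mulVec_nonneg hS b)

lemma memLp_affFun (b : Fin p → ℝ) (c : Fin K → ℝ) (k : Fin K) (q : ENNReal) (hq : q ≠ ⊤) :
    MemLp (fun v => affFun b c (v, k)) q (multivariateGaussian (mean k) SW) :=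
  memLp_linFun_add b (c k) q hq

lemma integral_affFun (hprior : ∀ k, 0 ≤ prior k) (b : Fin p → ℝ) (c : Fin K → ℝ) :
    ∫ y, affFun b c y ∂(obsLaw prior mean SW)
      = ∑ k, prior k * (linFun b (mean k) + c k) := by
  rw [integral_obsLaw hprior (measurable_affFun b c) fun k =>
    (memLp_affFun b c k 1 (by simp)).integrable le_rfl]
  refine Finset.sum_congr rfl fun k _ => ?_
  have hi : Integrable (fun v => linFun b v) (multivariateGaussian (mean k) SW) :=
    (linFun b).integrable_comp IsGaussian.integrable_id
  simp only [affFun]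
  rw [integral_add hi (integrable_const _), integral_linFun]
  simp

lemma integrable_affFun_pow (b : Fin p → ℝ) (c : Fin K → ℝ) (q : ℕ) :
    Integrable (fun y => affFun b c y ^ q) (obsLaw prior mean SW) := by
  refine integrable_obsLaw ((measurable_affFun b c).pow_const q) fun k => ?_
  have h := (memLp_affFun (mean := mean) (SW := SW) b c k (q : ENNReal) (by simp)).integrable_norm_pow'
  refine h.mono' ?_ (ae_of_all _ fun v => ?_)
  · exact (((measurable_affFun b c).comp (measurable_pair k)).pow_const q).aestronglyMeasurable
  · rw [norm_pow]

lemma memLp_two_affFun (b : Fin p → ℝ) (c : Fin K → ℝ) :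
    MemLp (affFun b c) 2 (obsLaw prior mean SW) :=
  (memLp_two_iff_integrable_sq (measurable_affFun b c).aestronglyMeasurable).2
    (integrable_affFun_pow b c 2)

lemma integral_affFun_sq (hprior : ∀ k, 0 ≤ prior k) (hS : SW.PosSemidef)
    (b : Fin p → ℝ) (c : Fin K → ℝ) :
    ∫ y, affFun b c y ^ 2 ∂(obsLaw prior mean SW)
      = ∑ k, prior k * classMoment mean SW b c k := by
  rw [integral_obsLaw hprior ((measurable_affFun b c).pow_const 2) fun k =>
    (memLp_affFun b c k 2 (by simp)).integrable_sq]
  refine Finset.sum_congr rfl fun k _ => ?_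
  rw [classMoment, ← integral_sq_linFun hS]
  rfl

lemma lintegral_exp_sq_affFun (hS : SW.PosSemidef) (b : Fin p → ℝ) (c : Fin K → ℝ) (k : Fin K)
    {V : ℝ} (hV : 0 < V) (h : classMoment mean SW b c k ≤ V) :
    ∫⁻ v, ENNReal.ofReal (Real.exp (affFun b c (v, k) ^ 2 / (8 * V)))
      ∂(multivariateGaussian (mean k) SW) ≤ 2 :=
  lintegral_exp_sq_linFun hS b (c k) hV h

end Mixture

/-! ### Score functions -/

section Scores

variable {K : ℕ}

lemma partialSum_succ (a : Fin K → ℝ) (l : Fin (K - 1)) :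
    partialSum a (l.val + 2) = partialSum a (l.val + 1) + a (nextClass l) := by
  have : (Finset.univ.filter fun i : Fin K => i.val < l.val + 2)
      = insert (nextClass l) (Finset.univ.filter fun i : Fin K => i.val < l.val + 1) := by
    ext i
    simp only [Finset.mem_filter, Finset.mem_univ, true_and, Finset.mem_insert, nextClass,
      Fin.ext_iff]
    omega
  rw [partialSum, this, Finset.sum_insert (by simp [nextClass]), add_comm]
  rfl

lemma le_partialSum {a : Fin K → ℝ} (ha : ∀ k, 0 ≤ a k) {k : Fin K} {t : ℕ} (hk : k.val < t) :
    a k ≤ partialSum a t :=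
  Finset.single_le_sum (fun i _ => ha i) (by simp [hk])

lemma partialSum_le_sum {a : Fin K → ℝ} (ha : ∀ k, 0 ≤ a k) (t : ℕ) :
    partialSum a t ≤ ∑ k, a k :=
  Finset.sum_le_sum_of_subset_of_nonneg (Finset.filter_subset _ _) fun i _ _ => ha i

lemma partialSum_div (a : Fin K → ℝ) (c : ℝ) (t : ℕ) :
    partialSum (fun k => a k / c) t = partialSum a t / c := by
  simp [partialSum, Finset.sum_div]

/-- The score of the class `k` for the contrast `l`, for class weights `a`. -/
noncomputable def scoreFun (a : Fin K → ℝ) (l : Fin (K - 1)) (k : Fin K) : ℝ :=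
  if k.val < l.val + 1 then
    √(a (nextClass l) / (partialSum a (l.val + 1) * partialSum a (l.val + 2)))
  else if k.val = l.val + 1 then
    -√(partialSum a (l.val + 1) / (a (nextClass l) * partialSum a (l.val + 2)))
  else 0

/-- Sample and population scores are one and the same function, evaluated at the class frequencies
and at the priors; their distance is then a matter of the Lipschitz bound `abs_scoreFun_sub_le`. -/
lemma scores_eq_scoreFun {n : ℕ} (hn : 0 < n) (z : Fin n → Fin K) (k : Fin K) (l : Fin (K - 1)) :
    scores z k l = scoreFun (fun k => classSize z k / n) l k := by
  have hn' : (n : ℝ) ≠ 0 := by positivity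
  have key : ∀ u v w : ℝ, u / n / (v / n * (w / n)) = n * u / (v * w) := fun u v w => by
    rw [div_mul_div_comm, div_div_div_eq]
    rw [show u * (n * n : ℝ) = n * (n * u) by ring, mul_div_mul_left _ _ hn']
  simp only [scores, scoreFun, Matrix.of_apply, partialSum_div, key]

/-- A score has only two nonzero values, one on the preceding classes and one on the next class. The
cases `F = id` and `F = (·) ^ 2` give the mean, the contrasts and the second moment. -/
lemma sum_mul_scoreFun (a : Fin K → ℝ) (l : Fin (K - 1)) (g : Fin K → ℝ) (F : ℝ → ℝ)
    (hF : F 0 = 0) :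
    ∑ k, a k * g k * F (scoreFun a l k)
      = F √(a (nextClass l) / (partialSum a (l.val + 1) * partialSum a (l.val + 2)))
          * ∑ k with k.val < l.val + 1, a k * g k
        + a (nextClass l) * g (nextClass l) *
          F (-√(partialSum a (l.val + 1) / (a (nextClass l) * partialSum a (l.val + 2)))) := by
  have h1 : ∀ k : Fin K, a k * g k * F (scoreFun a l k)
      = (if k.val < l.val + 1 then
          F √(a (nextClass l) / (partialSum a (l.val + 1) * partialSum a (l.val + 2)))
            * (a k * g k) else 0)
        + (if k = nextClass l then a (nextClass l) * g (nextClass l) *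
          F (-√(partialSum a (l.val + 1) / (a (nextClass l) * partialSum a (l.val + 2)))) else 0) := by
    intro k
    unfold scoreFun
    by_cases h : k.val < l.val + 1
    · have : k ≠ nextClass l := fun e => by rw [e] at h; simp [nextClass] at h
      simp only [h, this, if_true, if_false]
      ring
    · by_cases h' : k.val = l.val + 1
      · have : k = nextClass l := Fin.ext h'
        subst this
        simp [nextClass]
      · have : k ≠ nextClass l := fun e => h' (by rw [e]; rfl)
        simp [h, h', this, hF]
  simp_rw [h1, Finset.sum_add_distrib, Finset.sum_ite_eq', Finset.mem_univ, if_true,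
    ← Finset.sum_filter, ← Finset.mul_sum]

variable {a : Fin K → ℝ} (ha : ∀ k, 0 < a k)
include ha

lemma partialSum_pos (l : Fin (K - 1)) : 0 < partialSum a (l.val + 1) := by
  have hK : 0 < K := by have := l.isLt; omega
  exact (ha ⟨0, hK⟩).trans_le (le_partialSum (fun k => (ha k).le) (by simp))

/-- The balance between the positive value of the score times the mass of the preceding classes and
the size of the negative value times the mass of the next class. -/
lemma sqrt_score_aux (l : Fin (K - 1)) :
    √(a (nextClass l) / (partialSum a (l.val + 1) * partialSum a (l.val + 2)))
        * partialSum a (l.val + 1)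
      = a (nextClass l) *
        √(partialSum a (l.val + 1) / (a (nextClass l) * partialSum a (l.val + 2))) := by
  have hN := partialSum_pos ha l
  have hq := ha (nextClass l)
  have hN' : 0 < partialSum a (l.val + 2) := by rw [partialSum_succ]; positivity
  set N := partialSum a (l.val + 1)
  set N' := partialSum a (l.val + 2)
  set q := a (nextClass l)
  have h1 : √(q / (N * N')) * N = √(q / (N * N') * N ^ 2) := by
    rw [Real.sqrt_mul (by positivity), Real.sqrt_sq hN.le]
  have h2 : q * √(N / (q * N')) = √(N / (q * N') * q ^ 2) := by
    rw [Real.sqrt_mul (by positivity), Real.sqrt_sq hq.le, mul_comm]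
  rw [h1, h2]
  congr 1
  field_simp

lemma sum_scoreFun_eq_zero (l : Fin (K - 1)) : ∑ k, a k * scoreFun a l k = 0 := by
  have h := sum_mul_scoreFun a l (fun _ => 1) id rfl
  simp only [mul_one, id] at h
  rw [h]
  have := sqrt_score_aux ha l
  have e : ∑ k with k.val < l.val + 1, a k = partialSum a (l.val + 1) := rfl
  rw [e, this]
  ring

lemma sum_scoreFun_sq (l : Fin (K - 1)) : ∑ k, a k * scoreFun a l k ^ 2 = 1 := by
  have h := sum_mul_scoreFun a l (fun _ => 1) (fun x => x ^ 2) (by norm_num)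
  simp only [mul_one] at h
  have hN := partialSum_pos ha l
  have hq := ha (nextClass l)
  have hN' := partialSum_succ a l
  have e : ∑ k with k.val < l.val + 1, a k = partialSum a (l.val + 1) := rfl
  rw [h, e, neg_sq, hN', Real.sq_sqrt (by positivity), Real.sq_sqrt (by positivity)]
  field_simp
  ring

-- Identifies `Δ` with the cross moment of features and scores. The terms with the mean of the next
-- class combine by the balance `sqrt_score_aux`.
omit ha in
lemma contrasts_eq_sum {p : ℕ} (ha : ∀ k, 0 < a k) (mean : Fin K → EuclideanSpace ℝ (Fin p))
    (j : Fin p) (l : Fin (K - 1)) :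
    contrasts a mean j l = ∑ k, a k * mean k j * scoreFun a l k := by
  have h := sum_mul_scoreFun a l (fun k => mean k j) id rfl
  simp only [id] at h
  rw [h]
  have h3 := sqrt_score_aux ha l
  have hq := ha (nextClass l)
  have e : ∑ k with k.val < l.val + 1, a k * (mean k j - mean (nextClass l) j)
      = ∑ k with k.val < l.val + 1, a k * mean k j
        - partialSum a (l.val + 1) * mean (nextClass l) j := by
    simp only [mul_sub, Finset.sum_sub_distrib, partialSum, Finset.sum_mul]
  rw [contrasts, Matrix.of_apply, e, mul_div_right_comm, ← Real.sqrt_div hq.le]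
  linear_combination -(mean (nextClass l) j) * h3

-- Write the difference of roots as the difference of squares over their sum. The squares have
-- denominators at least `β ^ 4`, and the sum of the roots is at least `β` because `u / (v * w) ≥ u
-- ≥ β ^ 2`.
omit ha in
lemma abs_sqrt_div_sub_le {β u v w u' v' w' η : ℝ} (hβ : 0 < β)
    (hu : β ≤ u) (hv : β ≤ v) (hw : β ≤ w) (hu1 : u ≤ 1) (hv1 : v ≤ 1) (hw1 : w ≤ 1)
    (hu' : β ≤ u') (hv' : β ≤ v') (hw' : β ≤ w') (hu1' : u' ≤ 1) (hv1' : v' ≤ 1) (hw1' : w' ≤ 1)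
    (h1 : |u - u'| ≤ η) (h2 : |v - v'| ≤ η) (h3 : |w - w'| ≤ η) :
    |√(u / (v * w)) - √(u' / (v' * w'))| ≤ 3 * η / β ^ 5 := by
  have hβ1 : β ≤ 1 := hu.trans hu1
  have hu0 := hβ.trans_le hu
  have hv0 := hβ.trans_le hv
  have hw0 := hβ.trans_le hw
  have hu0' := hβ.trans_le hu'
  have hv0' := hβ.trans_le hv'
  have hw0' := hβ.trans_le hw'
  have hη : 0 ≤ η := (abs_nonneg _).trans h1
  have hvw1 : v * w ≤ 1 := by nlinarith
  have hsq : β ≤ √(u / (v * w)) := by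
    apply Real.le_sqrt_of_sq_le
    rw [le_div_iff₀ (by positivity)]
    nlinarith
  have hs' := Real.sqrt_nonneg (u' / (v' * w'))
  have e1 := Real.sq_sqrt (show 0 ≤ u / (v * w) by positivity)
  have e2 := Real.sq_sqrt (show 0 ≤ u' / (v' * w') by positivity)
  set s := √(u / (v * w))
  set s' := √(u' / (v' * w'))
  have hdiff : |u / (v * w) - u' / (v' * w')| ≤ 3 * η / β ^ 4 := by
    rw [div_sub_div _ _ (by positivity) (by positivity), abs_div,
      abs_of_pos (show 0 < v * w * (v' * w') by positivity)]
    have hn : |u * (v' * w') - v * w * u'| ≤ 3 * η := by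
      have : u * (v' * w') - v * w * u'
          = (u - u') * (v' * w') - u' * w' * (v - v') - u' * v * (w - w') := by ring
      rw [this]
      have b1 : |(u - u') * (v' * w')| ≤ η := by
        rw [abs_mul, abs_of_pos (show 0 < v' * w' by positivity)]
        have : v' * w' ≤ 1 := by nlinarith
        nlinarith [abs_nonneg (u - u')]
      have b2 : |u' * w' * (v - v')| ≤ η := by
        rw [abs_mul, abs_of_pos (show 0 < u' * w' by positivity)]
        have : u' * w' ≤ 1 := by nlinarith
        nlinarith [abs_nonneg (v - v')]
      have b3 : |u' * v * (w - w')| ≤ η := by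
        rw [abs_mul, abs_of_pos (show 0 < u' * v by positivity)]
        have : u' * v ≤ 1 := by nlinarith
        nlinarith [abs_nonneg (w - w')]
      calc _ ≤ |(u - u') * (v' * w') - u' * w' * (v - v')| + |u' * v * (w - w')| := abs_sub _ _
        _ ≤ |(u - u') * (v' * w')| + |u' * w' * (v - v')| + |u' * v * (w - w')| := by
          gcongr; exact abs_sub _ _
        _ ≤ _ := by linarith
    have hd : β ^ 4 ≤ v * w * (v' * w') := by
      calc β ^ 4 = β * β * (β * β) := by ring
        _ ≤ _ := by gcongr
    gcongr
  have hmul : |s - s'| * β ≤ 3 * η / β ^ 4 := by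
    refine le_trans ?_ hdiff
    rw [← e1, ← e2, sq_sub_sq, abs_mul, mul_comm, abs_of_nonneg (by linarith : 0 ≤ s + s')]
    gcongr
    linarith
  rw [← le_div_iff₀ hβ] at hmul
  refine hmul.trans_eq ?_
  field_simp

omit ha in
/-- The scores are Lipschitz functions of the class weights. -/
lemma abs_scoreFun_sub_le {a' : Fin K → ℝ} {β η : ℝ} (hβ : 0 < β) (hη : 0 ≤ η)
    (ha : ∀ k, β ≤ a k) (ha' : ∀ k, β ≤ a' k) (hs : ∑ k, a k = 1) (hs' : ∑ k, a' k = 1)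
    (h : ∀ k, |a k - a' k| ≤ η) (l : Fin (K - 1)) (k : Fin K) :
    |scoreFun a l k - scoreFun a' l k| ≤ 3 * (K * η) / β ^ 5 := by
  have hK0 : 0 < K := by have := l.isLt; omega
  have hK : (1 : ℝ) ≤ K := by exact_mod_cast hK0
  have ha0 : ∀ k, 0 ≤ a k := fun k => hβ.le.trans (ha k)
  have ha0' : ∀ k, 0 ≤ a' k := fun k => hβ.le.trans (ha' k)
  have hle : ∀ t, partialSum a t ≤ 1 := fun t => hs ▸ partialSum_le_sum ha0 t
  have hle' : ∀ t, partialSum a' t ≤ 1 := fun t => hs' ▸ partialSum_le_sum ha0' t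
  have hge : ∀ t, β ≤ partialSum a (t + 1) := fun t =>
    (ha ⟨0, hK0⟩).trans (le_partialSum ha0 (by simp))
  have hge' : ∀ t, β ≤ partialSum a' (t + 1) := fun t =>
    (ha' ⟨0, hK0⟩).trans (le_partialSum ha0' (by simp))
  have h1 : ∀ k, a k ≤ 1 := fun k => hs ▸ Finset.single_le_sum (fun i _ => ha0 i) (by simp)
  have h1' : ∀ k, a' k ≤ 1 := fun k => hs' ▸ Finset.single_le_sum (fun i _ => ha0' i) (by simp)
  have hd : ∀ t, |partialSum a t - partialSum a' t| ≤ K * η := fun t => by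
    rw [partialSum, partialSum, ← Finset.sum_sub_distrib]
    refine (Finset.abs_sum_le_sum_abs _ _).trans ((Finset.sum_le_sum fun i _ => h i).trans ?_)
    rw [Finset.sum_const, nsmul_eq_mul]
    gcongr
    exact (Finset.card_filter_le _ _).trans (by simp)
  have hd1 : ∀ k, |a k - a' k| ≤ K * η := fun k => (h k).trans (by nlinarith)
  unfold scoreFun
  split_ifs
  · exact abs_sqrt_div_sub_le hβ (ha _) (hge _) (hge _) (h1 _) (hle _) (hle _) (ha' _) (hge' _)
      (hge' _) (h1' _) (hle' _) (hle' _) (hd1 _) (hd _) (hd _)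
  · rw [neg_sub_neg, abs_sub_comm]
    exact abs_sqrt_div_sub_le hβ (hge _) (ha _) (hge _) (hle _) (h1 _) (hle _) (hge' _) (ha' _)
      (hge' _) (hle' _) (h1' _) (hle' _) (hd _) (hd1 _) (hd _)
  · simp only [sub_zero, abs_zero]
    positivity

end Scores

/-! ### Population moments -/

section Population

variable {p K : ℕ} {prior : Fin K → ℝ} {mean : Fin K → EuclideanSpace ℝ (Fin p)}
  {SW : Matrix (Fin p) (Fin p) ℝ} {piMin : ℝ}

/-- The standing assumptions on the parameters of the population. -/
structure IsPopulation (prior : Fin K → ℝ) (mean : Fin K → EuclideanSpace ℝ (Fin p))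
    (SW : Matrix (Fin p) (Fin p) ℝ) (piMin : ℝ) : Prop where
  two_le_p : 2 ≤ p
  two_le_K : 2 ≤ K
  piMin_pos : 0 < piMin
  piMin_le : ∀ k, piMin ≤ prior k
  sum_prior : ∑ k, prior k = 1
  posSemidef : SW.PosSemidef
  posDef : (totalCov prior mean SW).PosDef
  mean_zero : ∑ k, prior k • mean k = 0

namespace IsPopulation

variable (h : IsPopulation prior mean SW piMin)
include h

lemma prior_pos (k : Fin K) : 0 < prior k := h.piMin_pos.trans_le (h.piMin_le k)

lemma prior_nonneg (k : Fin K) : 0 ≤ prior k := (h.prior_pos k).le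

lemma prior_le_one (k : Fin K) : prior k ≤ 1 :=
  h.sum_prior ▸ Finset.single_le_sum (fun i _ => h.prior_nonneg i) (Finset.mem_univ k)

lemma card_mul_piMin_le : K * piMin ≤ 1 := by
  rw [← h.sum_prior]
  calc (K : ℝ) * piMin = ∑ _k : Fin K, piMin := by simp
    _ ≤ _ := Finset.sum_le_sum fun k _ => h.piMin_le k

lemma piMin_le_one : piMin ≤ 1 := by
  have h1 := h.card_mul_piMin_le
  have h2 : (2 : ℝ) ≤ K := by exact_mod_cast h.two_le_K
  nlinarith [h.piMin_pos]

/-- Bounded number of classes: union bounds and sums over classes or contrasts cost only a factor `1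
/ piMin`. -/
lemma card_le : (K : ℝ) ≤ 1 / piMin := by
  rw [le_div_iff₀ h.piMin_pos]
  exact h.card_mul_piMin_le

lemma isProbabilityMeasure : IsProbabilityMeasure (obsLaw prior mean SW) :=
  isProbabilityMeasure_obsLaw h.prior_nonneg h.sum_prior

lemma sum_prior_mul_linFun (b : Fin p → ℝ) : ∑ k, prior k * linFun b (mean k) = 0 := by
  have := congrArg (linFun b) h.mean_zero
  simpa [map_sum] using this

lemma sum_prior_mul_mean (j : Fin p) : ∑ k, prior k * mean k j = 0 := by
  simpa [linFun_single] using h.sum_prior_mul_linFun (Pi.single j 1)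

lemma integral_featureLaw {f : EuclideanSpace ℝ (Fin p) → ℝ}
    (hi : ∀ k, Integrable f (multivariateGaussian (mean k) SW)) :
    ∫ v, f v ∂(featureLaw prior mean SW)
      = ∑ k, prior k * ∫ v, f v ∂(multivariateGaussian (mean k) SW) := by
  rw [featureLaw, integral_finsetSum_measure]
  · refine Finset.sum_congr rfl fun k _ => ?_
    rw [integral_smul_measure, ENNReal.toReal_ofReal (h.prior_nonneg k), smul_eq_mul]
  · exact fun k _ => (hi k).smul_measure ENNReal.ofReal_ne_top

lemma totalCov_apply (i j : Fin p) :
    totalCov prior mean SW i j = SW i j + ∑ k, prior k * (mean k i * mean k j) := by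
  have hm : ∀ i k, MemLp (fun v : EuclideanSpace ℝ (Fin p) => v i) 2
      (multivariateGaussian (mean k) SW) := fun i k => by
    have := memLp_linFun_add (μ := mean k) (S := SW) (Pi.single i 1) 0 2 (by simp)
    simpa [linFun_single] using this
  have hE : ∀ i k, ∫ v : EuclideanSpace ℝ (Fin p), v i ∂(multivariateGaussian (mean k) SW)
      = mean k i := fun i k => by
    have := integral_linFun (μ := mean k) (S := SW) (Pi.single i 1)
    simpa [linFun_single] using this
  have hE0 : ∀ i, ∫ v, v i ∂(featureLaw prior mean SW) = 0 := fun i => by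
    rw [h.integral_featureLaw fun k => (hm i k).integrable (by norm_num)]
    simp_rw [hE]
    exact h.sum_prior_mul_mean i
  rw [totalCov, Matrix.of_apply, covariance, hE0, hE0]
  simp only [sub_zero]
  have hij : ∀ k, Integrable (fun v : EuclideanSpace ℝ (Fin p) => v i * v j)
      (multivariateGaussian (mean k) SW) := fun k => (hm i k).integrable_mul (hm j k)
  rw [h.integral_featureLaw hij]
  have hcov : ∀ k, ∫ v : EuclideanSpace ℝ (Fin p), v i * v j ∂(multivariateGaussian (mean k) SW)
      = SW i j + mean k i * mean k j := fun k => by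
    have h1 := covariance_eq_sub (hm i k) (hm j k)
    rw [covariance_eval_multivariateGaussian h.posSemidef, hE, hE] at h1
    simp only [Pi.mul_apply] at h1
    linarith
  simp_rw [hcov, mul_add, Finset.sum_add_distrib, ← Finset.sum_mul, h.sum_prior, one_mul]

lemma dotProduct_totalCov (b b' : Fin p → ℝ) :
    b ⬝ᵥ totalCov prior mean SW *ᵥ b'
      = b ⬝ᵥ SW *ᵥ b' + ∑ k, prior k * (linFun b (mean k) * linFun b' (mean k)) := by
  have : totalCov prior mean SW
      = SW + ∑ k, prior k • Matrix.vecMulVec (mean k) (mean k) := by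
    ext i j
    rw [h.totalCov_apply, Matrix.add_apply, Matrix.sum_apply]
    simp [Matrix.vecMulVec_apply]
  have e : ∀ (b : Fin p → ℝ) (k : Fin K), b ⬝ᵥ (mean k).ofLp = linFun b (mean k) := fun b k => by
    rw [linFun_apply]; rfl
  rw [this, Matrix.add_mulVec, dotProduct_add, Matrix.sum_mulVec, dotProduct_sum]
  congr 1
  refine Finset.sum_congr rfl fun k _ => ?_
  rw [Matrix.smul_mulVec, Matrix.vecMulVec_mulVec, dotProduct_smul, dotProduct_smul,
    dotProduct_comm _ b', e, e]
  simp

lemma sum_classMoment_zero (b : Fin p → ℝ) :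
    ∑ k, prior k * classMoment mean SW b 0 k = b ⬝ᵥ totalCov prior mean SW *ᵥ b := by
  rw [h.dotProduct_totalCov]
  simp only [classMoment, Pi.zero_apply, add_zero, mul_add, Finset.sum_add_distrib,
    ← Finset.sum_mul, h.sum_prior, one_mul, sq]
  ring

lemma integral_linFun_sq (b : Fin p → ℝ) :
    ∫ y, affFun b 0 y ^ 2 ∂(obsLaw prior mean SW) = b ⬝ᵥ totalCov prior mean SW *ᵥ b := by
  rw [integral_affFun_sq h.prior_nonneg h.posSemidef, h.sum_classMoment_zero]

lemma totalCov_mul_Bstar :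
    totalCov prior mean SW * Bstar prior mean SW = contrasts prior mean := by
  rw [Bstar, Matrix.mul_nonsing_inv_cancel_left]
  exact h.posDef.det_pos.ne'.isUnit

lemma dotProduct_contrasts (b : Fin p → ℝ) (l : Fin (K - 1)) :
    ∑ k, prior k * (linFun b (mean k) * scoreFun prior l k)
      = b ⬝ᵥ totalCov prior mean SW *ᵥ (Bstar prior mean SW).col l := by
  have : totalCov prior mean SW *ᵥ (Bstar prior mean SW).col l
      = (contrasts prior mean).col l := by
    rw [← h.totalCov_mul_Bstar]
    ext i
    simp [Matrix.mulVec, Matrix.mul_apply, dotProduct]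
  rw [this, dotProduct]
  simp only [Matrix.col_apply, contrasts_eq_sum h.prior_pos, linFun_apply, Finset.mul_sum,
    Finset.sum_mul]
  rw [Finset.sum_comm]
  refine Finset.sum_congr rfl fun j _ => Finset.sum_congr rfl fun k _ => by ring

/-- The second moment of the score plus a linear functional. -/
lemma sum_classMoment_score (b : Fin p → ℝ) (l : Fin (K - 1)) :
    ∑ k, prior k * classMoment mean SW b (scoreFun prior l) k
      = b ⬝ᵥ totalCov prior mean SW *ᵥ b
        + 2 * (b ⬝ᵥ totalCov prior mean SW *ᵥ (Bstar prior mean SW).col l) + 1 := by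
  rw [← h.dotProduct_contrasts b l, h.dotProduct_totalCov b b, ← sum_scoreFun_sq h.prior_pos l,
    ← one_mul (b ⬝ᵥ SW *ᵥ b), ← h.sum_prior, Finset.sum_mul, Finset.mul_sum,
    ← Finset.sum_add_distrib, ← Finset.sum_add_distrib, ← Finset.sum_add_distrib]
  refine Finset.sum_congr rfl fun k _ => ?_
  rw [classMoment]
  ring

lemma dotProduct_totalCov_comm (b b' : Fin p → ℝ) :
    b ⬝ᵥ totalCov prior mean SW *ᵥ b' = b' ⬝ᵥ totalCov prior mean SW *ᵥ b := by
  have hT : (totalCov prior mean SW)ᵀ = totalCov prior mean SW := by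
    simpa using h.posDef.isHermitian.eq
  rw [Matrix.dotProduct_mulVec, ← Matrix.mulVec_transpose, hT, dotProduct_comm]

end IsPopulation

/-- The population residual of the score of the contrast `l`. -/
noncomputable def residual (prior : Fin K → ℝ) (mean : Fin K → EuclideanSpace ℝ (Fin p))
    (SW : Matrix (Fin p) (Fin p) ℝ) (l : Fin (K - 1)) (y : EuclideanSpace ℝ (Fin p) × Fin K) : ℝ :=
  affFun (-(Bstar prior mean SW).col l) (scoreFun prior l) y

namespace IsPopulation

variable (h : IsPopulation prior mean SW piMin)
include h

lemma sum_classMoment_residual (l : Fin (K - 1)) :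
    ∑ k, prior k * classMoment mean SW (-(Bstar prior mean SW).col l) (scoreFun prior l) k
      = 1 - (Bstar prior mean SW).col l ⬝ᵥ totalCov prior mean SW *ᵥ (Bstar prior mean SW).col l := by
  rw [h.sum_classMoment_score]
  simp only [Matrix.mulVec_neg, neg_dotProduct, dotProduct_neg]
  ring

/-- The residual has second moment `1` minus this energy, and that is nonnegative. This a priori
control of `B*` is what makes the slow rate usable. -/
lemma Bstar_energy_le_one (l : Fin (K - 1)) :
    (Bstar prior mean SW).col l ⬝ᵥ totalCov prior mean SW *ᵥ (Bstar prior mean SW).col l ≤ 1 := by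
  have h1 := h.sum_classMoment_residual l
  have h2 : 0 ≤ ∑ k, prior k *
      classMoment mean SW (-(Bstar prior mean SW).col l) (scoreFun prior l) k :=
    Finset.sum_nonneg fun k _ => mul_nonneg (h.prior_nonneg k) (classMoment_nonneg h.posSemidef _ _ k)
  linarith

lemma sum_classMoment_residual_le (l : Fin (K - 1)) :
    ∑ k, prior k * classMoment mean SW (-(Bstar prior mean SW).col l) (scoreFun prior l) k ≤ 1 := by
  rw [h.sum_classMoment_residual]
  have := dotProduct_mulVec_nonneg h.posDef.posSemidef ((Bstar prior mean SW).col l)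
  linarith

lemma integral_residual (l : Fin (K - 1)) :
    ∫ y, residual prior mean SW l y ∂(obsLaw prior mean SW) = 0 := by
  simp only [residual]
  rw [integral_affFun h.prior_nonneg]
  simp only [mul_add, Finset.sum_add_distrib, h.sum_prior_mul_linFun,
    sum_scoreFun_eq_zero h.prior_pos, add_zero]

lemma integral_residual_sq_le (l : Fin (K - 1)) :
    ∫ y, residual prior mean SW l y ^ 2 ∂(obsLaw prior mean SW) ≤ 1 := by
  simp only [residual]
  rw [integral_affFun_sq h.prior_nonneg h.posSemidef]
  exact h.sum_classMoment_residual_le l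

omit h in
lemma integrable_affFun_mul (b b' : Fin p → ℝ) (c c' : Fin K → ℝ) :
    Integrable (fun y => affFun b c y * affFun b' c' y) (obsLaw prior mean SW) :=
  (memLp_two_affFun b c).integrable_mul (memLp_two_affFun b' c')

/-- The residual is uncorrelated with the feature vector. -/
lemma integral_linFun_mul_residual (b : Fin p → ℝ) (l : Fin (K - 1)) :
    ∫ y, affFun b 0 y * residual prior mean SW l y ∂(obsLaw prior mean SW) = 0 := by
  set B := (Bstar prior mean SW).col l
  -- Polarisation, so that only second moments of affine functionals have to be computed.
  have e : ∀ y, affFun b 0 y * residual prior mean SW l y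
      = (affFun (b - B) (scoreFun prior l) y ^ 2 - affFun b 0 y ^ 2
          - affFun (-B) (scoreFun prior l) y ^ 2) / 2 := fun y => by
    have := affFun_add b (-B) 0 (scoreFun prior l) y
    rw [zero_add, ← sub_eq_add_neg] at this
    rw [this, residual]
    ring
  simp_rw [e]
  have i1 := integrable_affFun_pow (prior := prior) (mean := mean) (SW := SW) (b - B)
    (scoreFun prior l) 2
  have i2 := integrable_affFun_pow (prior := prior) (mean := mean) (SW := SW) b 0 2
  have i3 := integrable_affFun_pow (prior := prior) (mean := mean) (SW := SW) (-B)
    (scoreFun prior l) 2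
  have i12 : Integrable (fun y => affFun (b - B) (scoreFun prior l) y ^ 2 - affFun b 0 y ^ 2)
    (obsLaw prior mean SW) := i1.sub i2
  rw [integral_div, integral_sub i12 i3, integral_sub i1 i2, h.integral_linFun_sq,
    integral_affFun_sq h.prior_nonneg h.posSemidef, integral_affFun_sq h.prior_nonneg h.posSemidef,
    h.sum_classMoment_score, h.sum_classMoment_score]
  have := h.dotProduct_totalCov_comm b B
  simp only [sub_dotProduct, Matrix.mulVec_sub, dotProduct_sub, Matrix.mulVec_neg, neg_dotProduct,
    dotProduct_neg]
  change (_ - _ - (_ - _) +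
    2 * (b ⬝ᵥ totalCov prior mean SW *ᵥ B - B ⬝ᵥ totalCov prior mean SW *ᵥ B) + 1 - _ - (_ + 2 * -(B ⬝ᵥ totalCov prior mean SW *ᵥ B) + 1)) / 2 = 0
  linarith

/-! ### Exponential moments -/

/-- Each class carries mass at least `piMin`. Hence every Gaussian component has tails on the scale
of the second moment of the mixture. -/
lemma classMoment_le (b : Fin p → ℝ) (c : Fin K → ℝ) (k : Fin K) :
    classMoment mean SW b c k ≤ (∑ k, prior k * classMoment mean SW b c k) / piMin := by
  rw [le_div_iff₀ h.piMin_pos]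
  have h0 := classMoment_nonneg (mean := mean) h.posSemidef b c
  calc classMoment mean SW b c k * piMin ≤ prior k * classMoment mean SW b c k := by
        rw [mul_comm]; exact mul_le_mul_of_nonneg_right (h.piMin_le k) (h0 k)
    _ ≤ _ := Finset.single_le_sum (f := fun k => prior k * classMoment mean SW b c k)
        (fun i _ => mul_nonneg (h.prior_nonneg i) (h0 i)) (Finset.mem_univ k)

/-- The fourth moment of an affine functional is controlled by the second one. -/
lemma integral_affFun_pow_four_le (b : Fin p → ℝ) (c : Fin K → ℝ) {σ2 : ℝ} (hσ : 0 < σ2)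
    (hle : ∑ k, prior k * classMoment mean SW b c k ≤ σ2) :
    ∫ y, affFun b c y ^ 4 ∂(obsLaw prior mean SW) ≤ 256 / piMin ^ 2 * σ2 ^ 2 := by
  have hpi := h.piMin_pos
  set V := σ2 / piMin with hV
  have hV0 : 0 < V := by positivity
  have hcm : ∀ k, classMoment mean SW b c k ≤ V := fun k =>
    (h.classMoment_le b c k).trans (div_le_div_of_nonneg_right hle hpi.le)
  have hm := measurable_affFun (p := p) b c
  have h1 : ∫⁻ y, ENNReal.ofReal (affFun b c y ^ 4) ∂(obsLaw prior mean SW)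
      ≤ ENNReal.ofReal (256 * V ^ 2) := by
    have := lintegral_obsLaw_le (prior := prior) (mean := mean) (SW := SW) h.prior_nonneg
      (f := fun y => ENNReal.ofReal (affFun b c y ^ 4)) (by fun_prop)
      (g := fun _ => 256 * V ^ 2) (fun _ => by positivity) (fun k => ?_)
    · rwa [← Finset.sum_mul, h.sum_prior, one_mul] at this
    -- With `t = f² / (8 V)`, `f⁴ = 64 V² t² ≤ 128 V² e^t`, and the integral of `e^t` is at most
    -- `2`.
    · calc ∫⁻ v, ENNReal.ofReal (affFun b c (v, k) ^ 4) ∂(multivariateGaussian (mean k) SW)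
          ≤ ∫⁻ v, ENNReal.ofReal (128 * V ^ 2) *
              ENNReal.ofReal (Real.exp (affFun b c (v, k) ^ 2 / (8 * V)))
              ∂(multivariateGaussian (mean k) SW) := by
            refine lintegral_mono fun v => ?_
            rw [← ENNReal.ofReal_mul (by positivity)]
            refine ENNReal.ofReal_le_ofReal ?_
            have h2 := Real.quadratic_le_exp_of_nonneg
              (show 0 ≤ affFun b c (v, k) ^ 2 / (8 * V) by positivity)
            set t := affFun b c (v, k) ^ 2 / (8 * V) with ht
            have ht0 : 0 ≤ t := by positivity
            have h3 : affFun b c (v, k) ^ 4 = 64 * V ^ 2 * t ^ 2 := by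
              rw [ht]; field_simp; norm_num
            rw [h3]
            have h4 : t ^ 2 ≤ 2 * Real.exp t := by linarith
            nlinarith [sq_nonneg V, mul_le_mul_of_nonneg_left h4 (sq_nonneg V)]
        _ ≤ ENNReal.ofReal (128 * V ^ 2) * 2 := by
            have hmm : Measurable fun v : EuclideanSpace ℝ (Fin p) =>
                ENNReal.ofReal (Real.exp (affFun b c (v, k) ^ 2 / (8 * V))) := by
              have := hm.comp (measurable_pair k)
              simp only [Function.comp_def] at this
              fun_prop
            rw [lintegral_const_mul _ hmm]
            gcongr
            exact lintegral_exp_sq_affFun h.posSemidef b c k hV0 (hcm k)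
        _ = ENNReal.ofReal (256 * V ^ 2) := by
            rw [show (2 : ENNReal) = ENNReal.ofReal 2 by simp, ← ENNReal.ofReal_mul (by positivity)]
            ring_nf
  rw [integral_eq_lintegral_of_nonneg_ae (ae_of_all _ fun y => by positivity)
    (hm.pow_const 4).aestronglyMeasurable]
  refine (ENNReal.toReal_le_of_le_ofReal (by positivity) h1).trans_eq ?_
  rw [hV]; ring

/-- Exponential moments of a product of two affine functionals, the first of which is bounded in
every class. -/
lemma lintegral_sq_mul_exp_le (b b' : Fin p → ℝ) (c c' : Fin K → ℝ) {τ : ℝ} (hτ : 0 < τ)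
    (hb : ∀ k, classMoment mean SW b c k ≤ τ ^ 2)
    (hb' : ∑ k, prior k * classMoment mean SW b' c' k ≤ 1) :
    ∫⁻ y, ENNReal.ofReal ((affFun b c y * affFun b' c' y) ^ 2 *
        Real.exp (piMin / (32 * τ) * |affFun b c y * affFun b' c' y|)) ∂(obsLaw prior mean SW)
      ≤ ENNReal.ofReal (2048 * τ ^ 2) := by
  have hpi := h.piMin_pos
  have hpi1 := h.piMin_le_one
  have hm := measurable_affFun (p := p) b c
  have hm' := measurable_affFun (p := p) b' c'
  -- A scale for each class rather than the uniform scale `2 / piMin`. The summand `1` keeps it away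
  -- from zero while its average over the classes stays at most `2`.
  set v : Fin K → ℝ := fun k => classMoment mean SW b' c' k + 1 with hv
  have hv1 : ∀ k, 1 ≤ v k := fun k => by
    have := classMoment_nonneg (mean := mean) h.posSemidef b' c' k
    simp only [hv]; linarith
  have hv2 : ∀ k, v k ≤ 2 / piMin := fun k => by
    have h1 := (h.classMoment_le b' c' k).trans (div_le_div_of_nonneg_right hb' hpi.le)
    have h2 : 1 ≤ 1 / piMin := by rw [le_div_iff₀ hpi]; linarith
    simp only [hv]
    calc _ ≤ 1 / piMin + 1 / piMin := add_le_add h1 h2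
      _ = _ := by ring
  have hclass : ∀ k, ∫⁻ x, ENNReal.ofReal ((affFun b c (x, k) * affFun b' c' (x, k)) ^ 2 *
        Real.exp (piMin / (32 * τ) * |affFun b c (x, k) * affFun b' c' (x, k)|))
        ∂(multivariateGaussian (mean k) SW) ≤ ENNReal.ofReal (1024 * τ ^ 2 * v k) := fun k => by
    have hvk := zero_lt_one.trans_le (hv1 k)
    set w := √(v k) with hw
    have hw0 : 0 < w := by positivity
    have hww : w ^ 2 = v k := Real.sq_sqrt hvk.le
    have hw2 : w ≤ 2 / piMin := by
      have h1 : 1 ≤ w := by rw [hw]; exact Real.one_le_sqrt.2 (hv1 k)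
      nlinarith [hv2 k]
    have hpt : ∀ s t : ℝ, (s * t) ^ 2 * Real.exp (piMin / (32 * τ) * |s * t|)
        ≤ 256 * τ ^ 2 * v k * (Real.exp (s ^ 2 / (8 * τ ^ 2)) + Real.exp (t ^ 2 / (8 * v k))) := by
      intro s t
      set α := |s| / τ with hα
      set β := |t| / w with hβ
      have hα0 : 0 ≤ α := by positivity
      have hβ0 : 0 ≤ β := by positivity
      have hs : |s| = τ * α := by rw [hα]; field_simp
      have ht : |t| = w * β := by rw [hβ]; field_simp
      have hs2 : s ^ 2 = τ ^ 2 * α ^ 2 := by rw [← sq_abs, hs]; ring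
      have ht2 : t ^ 2 = v k * β ^ 2 := by rw [← sq_abs, ht, ← hww]; ring
      set q := α ^ 2 + β ^ 2 with hq
      have hq0 : 0 ≤ q := by positivity
      have hαβ : α * β ≤ q / 2 := by nlinarith [sq_nonneg (α - β)]
      -- The only place where the crude bound `w ≤ 2 / piMin` enters: `piMin` restricts the range of
      -- the exponent, not the variance proxy.
      have e1 : piMin / (32 * τ) * |s * t| ≤ q / 32 := by
        rw [abs_mul, hs, ht]
        have : piMin / (32 * τ) * (τ * α * (w * β)) = piMin * w * (α * β) / 32 := by
          field_simp
        rw [this]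
        have h2 : piMin * w ≤ 2 := by
          rw [le_div_iff₀ hpi] at hw2; linarith
        have h3 : 0 ≤ α * β := by positivity
        nlinarith
      have e2 : (s * t) ^ 2 ≤ τ ^ 2 * v k * (q ^ 2 / 4) := by
        rw [mul_pow, hs2, ht2]
        have h3 : 0 ≤ α * β := by positivity
        have : α ^ 2 * β ^ 2 ≤ q ^ 2 / 4 := by nlinarith
        calc τ ^ 2 * α ^ 2 * (v k * β ^ 2) = τ ^ 2 * v k * (α ^ 2 * β ^ 2) := by ring
          _ ≤ _ := by gcongr
      have e3 : q ^ 2 ≤ 2048 * Real.exp (q / 32) := by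
        have := Real.quadratic_le_exp_of_nonneg (show 0 ≤ q / 32 by positivity)
        nlinarith
      have e4 : Real.exp (q / 16) ≤ (Real.exp (α ^ 2 / 8) + Real.exp (β ^ 2 / 8)) / 2 := by
        have h1 : Real.exp (q / 16) = Real.exp (α ^ 2 / 16) * Real.exp (β ^ 2 / 16) := by
          rw [← Real.exp_add]; congr 1; rw [hq]; ring
        have h2 : Real.exp (α ^ 2 / 8) = Real.exp (α ^ 2 / 16) ^ 2 := by
          rw [← Real.exp_nat_mul]; congr 1; push_cast; ring
        have h3 : Real.exp (β ^ 2 / 8) = Real.exp (β ^ 2 / 16) ^ 2 := by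
          rw [← Real.exp_nat_mul]; congr 1; push_cast; ring
        rw [h1, h2, h3]
        nlinarith [sq_nonneg (Real.exp (α ^ 2 / 16) - Real.exp (β ^ 2 / 16))]
      have e5 : s ^ 2 / (8 * τ ^ 2) = α ^ 2 / 8 := by rw [hs2]; field_simp
      have e6 : t ^ 2 / (8 * v k) = β ^ 2 / 8 := by rw [ht2]; field_simp
      rw [e5, e6]
      have e7 : Real.exp (q / 32) * Real.exp (q / 32) = Real.exp (q / 16) := by
        rw [← Real.exp_add]; congr 1; ring
      calc (s * t) ^ 2 * Real.exp (piMin / (32 * τ) * |s * t|)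
          ≤ τ ^ 2 * v k * (q ^ 2 / 4) * Real.exp (q / 32) := by
            gcongr
        _ ≤ τ ^ 2 * v k * (2048 * Real.exp (q / 32) / 4) * Real.exp (q / 32) := by gcongr
        _ = 512 * (τ ^ 2 * v k) * Real.exp (q / 16) := by rw [← e7]; ring
        _ ≤ 512 * (τ ^ 2 * v k) * ((Real.exp (α ^ 2 / 8) + Real.exp (β ^ 2 / 8)) / 2) := by gcongr
        _ = _ := by ring
    have hmk := hm.comp (measurable_pair k)
    have hmk' := hm'.comp (measurable_pair k)
    simp only [Function.comp_def] at hmk hmk'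
    calc _ ≤ ∫⁻ x, ENNReal.ofReal (256 * τ ^ 2 * v k) *
            (ENNReal.ofReal (Real.exp (affFun b c (x, k) ^ 2 / (8 * τ ^ 2)))
              + ENNReal.ofReal (Real.exp (affFun b' c' (x, k) ^ 2 / (8 * v k))))
            ∂(multivariateGaussian (mean k) SW) := by
          refine lintegral_mono fun x => ?_
          rw [← ENNReal.ofReal_add (Real.exp_pos _).le (Real.exp_pos _).le,
            ← ENNReal.ofReal_mul (by positivity)]
          exact ENNReal.ofReal_le_ofReal (hpt _ _)
      _ ≤ ENNReal.ofReal (256 * τ ^ 2 * v k) * (2 + 2) := by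
          rw [lintegral_const_mul _ (by fun_prop), lintegral_add_left (by fun_prop)]
          gcongr
          · exact lintegral_exp_sq_affFun h.posSemidef b c k (by positivity) (hb k)
          · exact lintegral_exp_sq_affFun h.posSemidef b' c' k hvk (by simp [hv])
      _ = ENNReal.ofReal (1024 * τ ^ 2 * v k) := by
          rw [show (2 + 2 : ENNReal) = ENNReal.ofReal 4 by norm_num,
            ← ENNReal.ofReal_mul (by positivity)]
          ring_nf
  refine (lintegral_obsLaw_le h.prior_nonneg (by fun_prop) (fun k => ?_) hclass).trans
    (ENNReal.ofReal_le_ofReal ?_)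
  · have := zero_lt_one.trans_le (hv1 k)
    positivity
  -- Averaging `v` over the classes gives at most `2`, so `2048` does not depend on `piMin`.
  · have e : ∑ k, prior k * (1024 * τ ^ 2 * v k)
        = 1024 * τ ^ 2 * (∑ k, prior k * classMoment mean SW b' c' k + 1) := by
      rw [← h.sum_prior, ← Finset.sum_add_distrib, Finset.mul_sum]
      refine Finset.sum_congr rfl fun k _ => ?_
      simp only [hv]
      ring
    rw [e]
    nlinarith [sq_nonneg τ]

/-! ### The scale `τ` -/

omit h in
lemma classMoment_single_le (hSW : SW.PosSemidef) (j : Fin p) (k : Fin K) :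
    classMoment mean SW (Pi.single j 1) 0 k ≤ tau mean SW ^ 2 := by
  have e : classMoment mean SW (Pi.single j 1) 0 k = SW j j + mean k j ^ 2 := by
    simp [classMoment, linFun_single, add_comm]
  have h1 : mean k j ^ 2 ≤ ⨆ k : Fin K, mean k j ^ 2 :=
    le_ciSup (f := fun k => mean k j ^ 2) (Set.finite_range _).bddAbove k
  have h2 : √(SW j j + ⨆ k : Fin K, mean k j ^ 2) ≤ tau mean SW :=
    le_ciSup (f := fun j : Fin p => √(SW j j + ⨆ k : Fin K, mean k j ^ 2))
      (Set.finite_range _).bddAbove j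
  have h3 : 0 ≤ SW j j := by
    have := dotProduct_mulVec_nonneg hSW (Pi.single j 1)
    simpa using this
  rw [e]
  have h4 : 0 ≤ ⨆ k : Fin K, mean k j ^ 2 := (sq_nonneg _).trans h1
  calc SW j j + mean k j ^ 2 ≤ SW j j + ⨆ k : Fin K, mean k j ^ 2 := by linarith
    _ = √(SW j j + ⨆ k : Fin K, mean k j ^ 2) ^ 2 := (Real.sq_sqrt (by linarith)).symm
    _ ≤ _ := by gcongr

lemma totalCov_diag_le (j : Fin p) : totalCov prior mean SW j j ≤ tau mean SW ^ 2 := by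
  have e : totalCov prior mean SW j j
      = ∑ k, prior k * classMoment mean SW (Pi.single j 1) 0 k := by
    rw [h.sum_classMoment_zero]
    simp
  rw [e]
  calc ∑ k, prior k * classMoment mean SW (Pi.single j 1) 0 k
      ≤ ∑ k, prior k * tau mean SW ^ 2 := Finset.sum_le_sum fun k _ =>
        mul_le_mul_of_nonneg_left (classMoment_single_le h.posSemidef j k) (h.prior_nonneg k)
    _ = tau mean SW ^ 2 := by rw [← Finset.sum_mul, h.sum_prior, one_mul]

lemma tau_pos : 0 < tau mean SW := by
  have hp : 0 < p := by have := h.two_le_p; omega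
  have h1 := h.totalCov_diag_le ⟨0, hp⟩
  have h2 := h.posDef.diag_pos (i := (⟨0, hp⟩ : Fin p))
  have h3 : 0 ≤ tau mean SW := Real.iSup_nonneg fun j => Real.sqrt_nonneg _
  rcases h3.eq_or_lt with h4 | h4
  · rw [← h4] at h1
    norm_num at h1
    linarith
  · exact h4

end IsPopulation

end Population

/-! ### Empirical approximation of quadratic forms -/

section Maurey

variable {p : ℕ} (A : Matrix (Fin p) (Fin p) ℝ)

/-- The second moment of a sum of independent random vectors, drawn from the finite family `e` with
weights `ρ`, in the quadratic form of `A`. -/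
lemma sum_prod_mul_quadForm {ι : Type*} [Fintype ι] (ρ : ι → ℝ) (hρ : ∑ a, ρ a = 1)
    (e : ι → Fin p → ℝ) (v : Fin p → ℝ) (hv : ∑ a, ρ a • e a = v) (m : ℕ) (u : Fin p → ℝ) :
    ∑ f : Fin m → ι, (∏ i, ρ (f i)) *
        ((u + ∑ i, e (f i)) ⬝ᵥ A *ᵥ (u + ∑ i, e (f i)))
      = (u + (m : ℝ) • v) ⬝ᵥ A *ᵥ (u + (m : ℝ) • v)
        + m * (∑ a, ρ a * (e a ⬝ᵥ A *ᵥ e a) - v ⬝ᵥ A *ᵥ v) := by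
  -- A single draw: the bias-variance identity around the mean `v`. The induction moves the first
  -- draw into `u`.
  have step : ∀ w : Fin p → ℝ, ∑ a, ρ a * ((w + e a) ⬝ᵥ A *ᵥ (w + e a))
      = (w + v) ⬝ᵥ A *ᵥ (w + v) + (∑ a, ρ a * (e a ⬝ᵥ A *ᵥ e a) - v ⬝ᵥ A *ᵥ v) := by
    intro w
    have e1 : ∑ a, ρ a * (w ⬝ᵥ A *ᵥ e a) = w ⬝ᵥ A *ᵥ v := by
      simp only [← hv, Matrix.mulVec_sum, dotProduct_sum, Matrix.mulVec_smul, dotProduct_smul,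
        smul_eq_mul]
    have e2 : ∑ a, ρ a * (e a ⬝ᵥ A *ᵥ w) = v ⬝ᵥ A *ᵥ w := by
      simp only [← hv, sum_dotProduct, smul_dotProduct, smul_eq_mul]
    simp only [Matrix.mulVec_add, dotProduct_add, add_dotProduct, mul_add, Finset.sum_add_distrib,
      e1, e2, ← Finset.sum_mul, hρ]
    ring
  induction m generalizing u with
  | zero => simp
  | succ m ih =>
    rw [← (Fin.consEquiv fun _ => ι).sum_comp, Fintype.sum_prod_type]
    simp only [Fin.consEquiv_apply, Fin.prod_univ_succ, Fin.sum_univ_succ, Fin.cons_zero,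
      Fin.cons_succ]
    have : ∀ a, ∑ f : Fin m → ι, ρ a * (∏ i, ρ (f i)) *
          ((u + (e a + ∑ i, e (f i))) ⬝ᵥ A *ᵥ (u + (e a + ∑ i, e (f i))))
        = ρ a * (((u + (m : ℝ) • v) + e a) ⬝ᵥ A *ᵥ ((u + (m : ℝ) • v) + e a)
          + m * (∑ a, ρ a * (e a ⬝ᵥ A *ᵥ e a) - v ⬝ᵥ A *ᵥ v)) := fun a => by
      have := ih (u + e a)
      simp only [add_assoc] at this
      simp only [mul_assoc, ← Finset.mul_sum, this]
      rw [add_right_comm u]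
      simp only [add_assoc]
    simp only [this, mul_add, Finset.sum_add_distrib] at *
    rw [← Finset.sum_mul, hρ, step]
    push_cast
    rw [add_smul, one_smul, add_assoc u]
    ring

/-- The vectors `±e_j`. -/
def signedBasis (a : Fin p × Bool) : Fin p → ℝ :=
  if a.2 then Pi.single a.1 1 else -Pi.single a.1 1

lemma signedBasis_quadForm (a : Fin p × Bool) :
    signedBasis a ⬝ᵥ A *ᵥ signedBasis a = A a.1 a.1 := by
  unfold signedBasis
  split_ifs <;> simp [Matrix.mulVec_neg]

variable {A}

/-- If a quadratic form is nonnegative at all sums of `m` signed basis vectors, then it is bounded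
below in terms of the `ℓ₁`-norm. -/
lemma quadForm_ge_of_signedBasis {B : ℝ} {m : ℕ} (hm : 2 ≤ m)
    (hdiag : ∀ j, A j j ≤ B)
    (hA : ∀ f : Fin m → Fin p × Bool,
      0 ≤ (∑ i, signedBasis (f i)) ⬝ᵥ A *ᵥ (∑ i, signedBasis (f i)))
    (v : Fin p → ℝ) :
    -(B / (m - 1) * (∑ j, |v j|) ^ 2) ≤ v ⬝ᵥ A *ᵥ v := by
  have hm1 : (0 : ℝ) < m - 1 := by
    have : (2 : ℝ) ≤ m := by exact_mod_cast hm
    linarith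
  have hm0 : (0 : ℝ) < m := by linarith
  have hN : 0 ≤ ∑ j, |v j| := Finset.sum_nonneg fun j _ => abs_nonneg _
  rcases hN.eq_or_lt with h0 | hpos
  · have : v = 0 := by
      ext j
      have := (Finset.sum_eq_zero_iff_of_nonneg fun j _ => abs_nonneg (v j)).1 h0.symm j (by simp)
      simpa using this
    simp [this]
  set N := ∑ j, |v j| with hNdef
  -- The vector `v / N` is the mean of a random signed basis vector that equals `sign(v j) e_j` with
  -- probability `|v j| / N`.
  set ρ : Fin p × Bool → ℝ := fun a => (if a.2 then max (v a.1) 0 else max (-v a.1) 0) / N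
  have hρ0 : ∀ a, 0 ≤ ρ a := fun a => by
    simp only [ρ]
    split_ifs <;> positivity
  have hρ : ∑ a, ρ a = 1 := by
    rw [Fintype.sum_prod_type]
    simp only [ρ, Fintype.sum_bool, if_true, Bool.false_eq_true, if_false,
      ← Finset.sum_div]
    rw [div_eq_one_iff_eq hpos.ne', hNdef]
    refine Finset.sum_congr rfl fun j _ => ?_
    rcases le_total 0 (v j) with h | h
    · simp [abs_of_nonneg h, h]
    · simp [abs_of_nonpos h, h]
  have hv : ∑ a, ρ a • signedBasis a = N⁻¹ • v := by
    rw [Fintype.sum_prod_type]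
    ext i
    simp only [ρ, signedBasis, Fintype.sum_bool, if_true, Bool.false_eq_true, if_false,
      Finset.sum_apply, Pi.add_apply, Pi.smul_apply, smul_eq_mul, Pi.neg_apply, Pi.single_apply,
      mul_ite, mul_one, mul_zero, mul_neg, Finset.sum_add_distrib, Finset.sum_ite_eq,
      Finset.sum_neg_distrib, Finset.mem_univ]
    rcases le_total 0 (v i) with h | h
    · simp [h]; field_simp
    · simp [h]; field_simp
  have key := sum_prod_mul_quadForm A ρ hρ signedBasis (N⁻¹ • v) hv m 0
  simp only [zero_add, signedBasis_quadForm] at key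
  have h1 : 0 ≤ ∑ f : Fin m → Fin p × Bool, (∏ i, ρ (f i)) *
      ((∑ i, signedBasis (f i)) ⬝ᵥ A *ᵥ (∑ i, signedBasis (f i))) :=
    Finset.sum_nonneg fun f _ => mul_nonneg (Finset.prod_nonneg fun i _ => hρ0 _) (hA f)
  rw [key] at h1
  have h2 : ∑ a, ρ a * A a.1 a.1 ≤ B := by
    calc ∑ a, ρ a * A a.1 a.1 ≤ ∑ a, ρ a * B :=
          Finset.sum_le_sum fun a _ => mul_le_mul_of_nonneg_left (hdiag _) (hρ0 a)
      _ = B := by rw [← Finset.sum_mul, hρ, one_mul]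
  simp only [Matrix.mulVec_smul, dotProduct_smul, smul_dotProduct, smul_eq_mul] at h1
  set q := v ⬝ᵥ A *ᵥ v
  -- The average of the form over sums of `m` draws is `m² q / N² + m (∑ ρ A_jj - q / N²)`; it is
  -- nonnegative, and one factor `m` is divided out.
  have h3 : 0 ≤ (m - 1) * (N⁻¹ * (N⁻¹ * q)) + B := by
    have : 0 ≤ m * ((m - 1) * (N⁻¹ * (N⁻¹ * q)) + B) := by nlinarith
    exact (mul_nonneg_iff_of_pos_left hm0).1 this
  have h4 : -(B / (m - 1) * N ^ 2) = -B / (m - 1) * N ^ 2 := by ring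
  have h5 : q = (m - 1) * (N⁻¹ * (N⁻¹ * q)) / (m - 1) * N ^ 2 := by field_simp
  rw [h4, h5]
  gcongr
  linarith

end Maurey

/-! ### A union bound -/

section Union

variable {Ω : Type*} [MeasurableSpace Ω] {P : Measure Ω}

lemma measure_exists_le {ι : Type*} [Fintype ι] {S : ι → Set Ω} {b : ℝ}
    (h : ∀ i, P (S i) ≤ ENNReal.ofReal b) :
    P {ω | ∃ i, ω ∈ S i} ≤ ENNReal.ofReal (Fintype.card ι * b) := by
  have e : {ω | ∃ i, ω ∈ S i} = ⋃ i, S i := by ext; simp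
  rw [e]
  refine (measure_iUnion_fintype_le P S).trans ((Finset.sum_le_sum fun i _ => h i).trans ?_)
  rw [ENNReal.ofReal_mul (by positivity)]
  simp

end Union

/-! ### Events of high probability -/

section Events

variable {p K n : ℕ} {prior : Fin K → ℝ} {mean : Fin K → EuclideanSpace ℝ (Fin p)}
  {SW : Matrix (Fin p) (Fin p) ℝ} {piMin : ℝ} {Ω : Type*} [MeasurableSpace Ω] {P : Measure Ω}
  {ζ : Fin n → Ω → EuclideanSpace ℝ (Fin p) × Fin K}

namespace IsPopulation

variable (h : IsPopulation prior mean SW piMin)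
include h

lemma feature_sq_tail (hζ : IsIID P (obsLaw prior mean SW) ζ) (j : Fin p) :
    P {ω | 24 * tau mean SW ^ 2 * n ≤ ∑ i, (ζ i ω).1 j ^ 2} ≤ ENNReal.ofReal (Real.exp (-2 * n)) := by
  have hτ := h.tau_pos
  have hm : Measurable fun y : EuclideanSpace ℝ (Fin p) × Fin K =>
      affFun (Pi.single j 1) 0 y ^ 2 / (8 * tau mean SW ^ 2) :=
    ((measurable_affFun _ _).pow_const 2).div_const _
  have hβ : ∫⁻ y, ENNReal.ofReal (Real.exp (affFun (Pi.single j 1) 0 y ^ 2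
      / (8 * tau mean SW ^ 2))) ∂(obsLaw prior mean SW) ≤ ENNReal.ofReal (Real.exp 1) := by
    refine (lintegral_obsLaw_le h.prior_nonneg (by fun_prop) (g := fun _ => 2) (fun _ => by norm_num)
      fun k => ?_).trans (ENNReal.ofReal_le_ofReal ?_)
    · simpa using lintegral_exp_sq_affFun h.posSemidef (Pi.single j 1) 0 k (by positivity)
        (classMoment_single_le h.posSemidef j k)
    · rw [← Finset.sum_mul, h.sum_prior, one_mul]
      have := Real.add_one_le_exp 1
      linarith
  -- The threshold is `3 n = 24 τ² n / (8 τ²)`, against a log moment generating function of at most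
  -- `n`, since `2 ≤ e`.
  have := hζ.chernoff hm hβ (3 * n)
  refine (measure_mono fun ω hω => ?_).trans (this.trans_eq ?_)
  · simp only [Set.mem_ofPred_eq, affFun, linFun_single, Pi.zero_apply, add_zero,
      ← Finset.sum_div] at hω ⊢
    rw [le_div_iff₀ (by positivity)]
    linarith
  · ring_nf

/-- Lower bound for the sample second moments of all linear functionals at once. -/
lemma lower_isometry_aux (hζ : IsIID P (obsLaw prior mean SW) ζ) (hn : 0 < n) {m : ℕ} (hm : 2 ≤ m) :
    P {ω | ¬ ∀ v : Fin p → ℝ, v ⬝ᵥ totalCov prior mean SW *ᵥ v / 2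
        - 24 * tau mean SW ^ 2 / (m - 1) * (∑ j, |v j|) ^ 2
          ≤ (∑ i, linFun v (ζ i ω).1 ^ 2) / n}
      ≤ ENNReal.ofReal ((2 * p) ^ m * Real.exp (-(n * piMin ^ 2 / 2048)))
        + ENNReal.ofReal (p * Real.exp (-2 * n)) := by
  have hτ := h.tau_pos
  have hpi := h.piMin_pos
  have hn' : (0 : ℝ) < n := by exact_mod_cast hn
  have := h.isProbabilityMeasure
  -- There are `(2 p) ^ m` such sums. The tail bound with kurtosis constant `256 / piMin ^ 2` fails
  -- with probability `exp (-n piMin² / 2048)` at each of them; sums that cancel to zero are set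
  -- aside because the tail bound needs positive variance.
  set V : (Fin m → Fin p × Bool) → Fin p → ℝ := fun f => ∑ i, signedBasis (f i) with hV
  have hfam : P {ω | ∃ f : Fin m → Fin p × Bool, ω ∈ {ω | V f ≠ 0 ∧
      ∑ i, affFun (V f) 0 (ζ i ω) ^ 2 ≤ n * (V f ⬝ᵥ totalCov prior mean SW *ᵥ V f / 2)}}
      ≤ ENNReal.ofReal ((2 * p) ^ m * Real.exp (-(n * piMin ^ 2 / 2048))) := by
    refine (measure_exists_le (b := Real.exp (-(n * piMin ^ 2 / 2048)))
      fun f => ?_).trans (le_of_eq ?_)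
    · by_cases hf : V f = 0
      · simp [hf]
      have hpos : 0 < V f ⬝ᵥ totalCov prior mean SW *ᵥ V f := by
        simpa using h.posDef.dotProduct_mulVec_pos hf
      have := hζ.lower_tail_sq (measurable_affFun (V f) 0) hpos (κ := 256 / piMin ^ 2)
        (by positivity) (integrable_affFun_pow _ _ 2) (integrable_affFun_pow _ _ 4)
        (h.integral_linFun_sq _)
        (h.integral_affFun_pow_four_le (V f) 0 hpos (h.sum_classMoment_zero _).le)
      refine (measure_mono fun ω hω => hω.2).trans (this.trans_eq ?_)
      congr 3
      field_simp
      norm_num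
    · congr 2
      simp only [Fintype.card_fun, Fintype.card_prod, Fintype.card_fin, Fintype.card_bool]
      push_cast
      ring
  have hdiag : P {ω | ∃ j : Fin p, ω ∈ {ω | 24 * tau mean SW ^ 2 * n ≤ ∑ i, (ζ i ω).1 j ^ 2}}
      ≤ ENNReal.ofReal (p * Real.exp (-2 * n)) := by
    refine (measure_exists_le fun j => h.feature_sq_tail hζ j).trans ?_
    simp
  refine (measure_mono fun ω hω => ?_).trans ((measure_union_le _ _).trans (add_le_add hfam hdiag))
  by_contra hcon
  simp only [Set.mem_union, Set.mem_ofPred_eq, not_or, not_exists, not_and, not_le] at hcon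
  obtain ⟨hc1, hc2⟩ := hcon
  refine hω fun v => ?_
  -- The sample second moment matrix minus half of `Σ_T`: nonnegative at all the sums, with diagonal
  -- at most `24 τ²`.
  set A : Matrix (Fin p) (Fin p) ℝ :=
    (n : ℝ)⁻¹ • ∑ i, Matrix.vecMulVec (ζ i ω).1.ofLp (ζ i ω).1.ofLp
      - (2 : ℝ)⁻¹ • totalCov prior mean SW with hA
  have hAq : ∀ v : Fin p → ℝ, v ⬝ᵥ A *ᵥ v
      = (∑ i, linFun v (ζ i ω).1 ^ 2) / n - v ⬝ᵥ totalCov prior mean SW *ᵥ v / 2 := fun v => by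
    have e : ∀ x : EuclideanSpace ℝ (Fin p), v ⬝ᵥ Matrix.vecMulVec x.ofLp x.ofLp *ᵥ v
        = linFun v x ^ 2 := fun x => by
      rw [Matrix.vecMulVec_mulVec, dotProduct_smul, dotProduct_comm _ v, linFun_apply]
      simp [dotProduct, sq]
    simp only [hA, Matrix.sub_mulVec, dotProduct_sub, Matrix.smul_mulVec, dotProduct_smul,
      Matrix.sum_mulVec, dotProduct_sum, e, smul_eq_mul]
    ring
  have := quadForm_ge_of_signedBasis (A := A) (B := 24 * tau mean SW ^ 2) hm
    (fun j => ?_) (fun f => ?_) v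
  · rw [hAq] at this
    linarith
  · have h1 := hAq (Pi.single j 1)
    simp only [Matrix.mulVec_single_one, single_one_dotProduct, Matrix.col_apply,
      linFun_single] at h1
    rw [h1]
    have h2 := h.posDef.diag_pos (i := j)
    have h3 : (∑ i, (ζ i ω).1 j ^ 2) / n ≤ 24 * tau mean SW ^ 2 := by
      rw [div_le_iff₀ hn']
      exact (hc2 j).le
    linarith
  · rw [hAq]
    by_cases hf : V f = 0
    · change 0 ≤ (∑ i, linFun (V f) (ζ i ω).1 ^ 2) / n
        - V f ⬝ᵥ totalCov prior mean SW *ᵥ V f / 2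
      rw [hf]
      simp only [zero_dotProduct, zero_div, sub_zero]
      positivity
    · have h1 := hc1 f hf
      simp only [affFun, Pi.zero_apply, add_zero] at h1
      have h2 : V f ⬝ᵥ totalCov prior mean SW *ᵥ V f / 2
          ≤ (∑ i, linFun (V f) (ζ i ω).1 ^ 2) / n := by
        rw [le_div_iff₀ hn']
        linarith
      exact sub_nonneg.2 h2

lemma log_p_pos : 0 < Real.log p :=
  Real.log_pos (by exact_mod_cast h.two_le_p)

lemma half_le_log_p : 1 / 2 ≤ Real.log p := by
  have h2 : (2 : ℝ) ≤ p := by exact_mod_cast h.two_le_p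
  have := Real.log_two_gt_d9
  have := Real.log_le_log (by norm_num) h2
  linarith

lemma exp_log_p : Real.exp (Real.log p) = p :=
  Real.exp_log (by have := h.two_le_p; positivity)

/-- Lower bound for the sample second moments of all linear functionals at once, in terms of
`log p / n`. -/
lemma lower_isometry (hζ : IsIID P (obsLaw prior mean SW) ζ) (hn : 0 < n)
    (hlog : 24576 * Real.log p ≤ n * piMin ^ 2) :
    P {ω | ¬ ∀ v : Fin p → ℝ, v ⬝ᵥ totalCov prior mean SW *ᵥ v / 2
        - 589824 / piMin ^ 2 * tau mean SW ^ 2 * (Real.log p / n) * (∑ j, |v j|) ^ 2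
          ≤ (∑ i, linFun v (ζ i ω).1 ^ 2) / n}
      ≤ ENNReal.ofReal (2 * Real.exp (-(n * piMin ^ 2 / 4096))) := by
  have hτ := h.tau_pos
  have hpi := h.piMin_pos
  have hpi1 := h.piMin_le_one
  have hn' : (0 : ℝ) < n := by exact_mod_cast hn
  have hl := h.log_p_pos
  have hp2 : (2 : ℝ) ≤ p := by exact_mod_cast h.two_le_p
  have hpi2 : piMin ^ 2 ≤ 1 := by nlinarith
  -- With `m = ⌊y⌋` and `2 p ≤ p²`, the union bound uses at most half of the exponent. The
  -- hypothesis gives `y ≥ 3`, hence `m - 1 ≥ y / 3`, and `589824 = 24 · 3 · 8192`.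
  set y : ℝ := n * piMin ^ 2 / (8192 * Real.log p) with hy
  have hy3 : 3 ≤ y := by rw [hy, le_div_iff₀ (by positivity)]; linarith
  set m := ⌊y⌋₊ with hm
  have hm1 : (m : ℝ) ≤ y := Nat.floor_le (by linarith)
  have hm2 : y - 1 < m := Nat.sub_one_lt_floor y
  have hm3 : 2 ≤ m := Nat.le_floor (by norm_num; linarith)
  have haux := h.lower_isometry_aux hζ hn hm3
  have hy' : y * (8192 * Real.log p) = n * piMin ^ 2 := by rw [hy]; field_simp
  refine (measure_mono fun ω hω => ?_).trans (haux.trans ?_)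
  · intro hall
    refine hω fun v => le_trans ?_ (hall v)
    have h1 : 24 * tau mean SW ^ 2 / (m - 1)
        ≤ 589824 / piMin ^ 2 * tau mean SW ^ 2 * (Real.log p / n) := by
      have h2 : y / 3 ≤ m - 1 := by linarith
      calc 24 * tau mean SW ^ 2 / (m - 1) ≤ 24 * tau mean SW ^ 2 / (y / 3) := by gcongr
        _ = _ := by rw [hy]; field_simp; norm_num
    gcongr
  · rw [← ENNReal.ofReal_add (by positivity) (by positivity)]
    refine ENNReal.ofReal_le_ofReal ?_
    have h1 : (2 * p : ℝ) ^ m * Real.exp (-(n * piMin ^ 2 / 2048))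
        ≤ Real.exp (-(n * piMin ^ 2 / 4096)) := by
      have h2 : (2 * p : ℝ) ≤ Real.exp (2 * Real.log p) := by
        have : Real.exp (2 * Real.log p) = (p : ℝ) ^ 2 := by
          rw [mul_comm, Real.exp_mul, h.exp_log_p]; norm_num
        rw [this]; nlinarith
      calc _ ≤ Real.exp (2 * Real.log p) ^ m * Real.exp (-(n * piMin ^ 2 / 2048)) := by gcongr
        _ = Real.exp (m * (2 * Real.log p) - n * piMin ^ 2 / 2048) := by
          rw [← Real.exp_nat_mul, ← Real.exp_add]; rfl
        _ ≤ _ := by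
          apply Real.exp_le_exp.2
          have : m * Real.log p ≤ y * Real.log p := by gcongr
          linarith
    have h2 : (p : ℝ) * Real.exp (-2 * n) ≤ Real.exp (-(n * piMin ^ 2 / 4096)) := by
      conv_lhs => rw [← h.exp_log_p]
      rw [← Real.exp_add]
      apply Real.exp_le_exp.2
      nlinarith
    linarith

end IsPopulation

end Events

/-! ### The good event -/

section Good

variable {p K n : ℕ} {prior : Fin K → ℝ} {mean : Fin K → EuclideanSpace ℝ (Fin p)}
  {SW : Matrix (Fin p) (Fin p) ℝ} {piMin : ℝ} {Ω : Type*} [MeasurableSpace Ω] {P : Measure Ω}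
  {ζ : Fin n → Ω → EuclideanSpace ℝ (Fin p) × Fin K}

/-- The `j`-th row of the inverse square root of the total covariance matrix. -/
noncomputable def whiteningRow (prior : Fin K → ℝ) (mean : Fin K → EuclideanSpace ℝ (Fin p))
    (SW : Matrix (Fin p) (Fin p) ℝ) (j : Fin p) : Fin p → ℝ :=
  (CFC.sqrt (totalCov prior mean SW))⁻¹ j

namespace IsPopulation

variable (h : IsPopulation prior mean SW piMin)
include h

lemma classFreq_tail [IsProbabilityMeasure P] (hζ : IsIID P (obsLaw prior mean SW) ζ)
    (hn : 0 < n) {A : ℝ} (hA : 0 < A) (k : Fin K) :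
    P {ω | √(A * n) ≤ |∑ i, ((if (ζ i ω).2 = k then 1 else 0) - prior k)|}
      ≤ ENNReal.ofReal (1 / A) := by
  set c : Fin K → ℝ := fun l => (if l = k then 1 else 0) - prior k with hc
  have hlin : ∀ v : EuclideanSpace ℝ (Fin p), linFun 0 v = 0 := fun v => by simp [linFun_apply]
  have h1 := hζ.chebyshev (measurable_affFun 0 c) (memLp_two_affFun 0 c) (V := 1) (by
    rw [integral_affFun h.prior_nonneg]
    simp only [hlin, hc, zero_add, mul_sub, Finset.sum_sub_distrib, ← Finset.sum_mul,
      h.sum_prior]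
    simp) (by
    rw [integral_affFun_sq h.prior_nonneg h.posSemidef]
    have : ∀ l, classMoment mean SW 0 c l ≤ 1 := fun l => by
      simp only [classMoment, hlin, hc, zero_dotProduct, zero_add, add_zero]
      have h0 := h.prior_nonneg k
      have h1 := h.prior_le_one k
      split_ifs <;> nlinarith
    calc ∑ l, prior l * classMoment mean SW 0 c l ≤ ∑ l, prior l * 1 :=
          Finset.sum_le_sum fun l _ => mul_le_mul_of_nonneg_left (this l) (h.prior_nonneg l)
      _ = 1 := by rw [← Finset.sum_mul, h.sum_prior, one_mul]) hA hn
  simpa only [affFun, hlin, hc, zero_add] using h1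

lemma residual_tail [IsProbabilityMeasure P] (hζ : IsIID P (obsLaw prior mean SW) ζ)
    (hn : 0 < n) {A : ℝ} (hA : 0 < A) (l : Fin (K - 1)) :
    P {ω | √(A * n) ≤ |∑ i, residual prior mean SW l (ζ i ω)|} ≤ ENNReal.ofReal (1 / A) :=
  hζ.chebyshev (measurable_affFun _ _) (memLp_two_affFun _ _) (h.integral_residual l)
    (h.integral_residual_sq_le l) hA hn

/-- Bernstein's inequality with `t₀ = piMin / (32 τ)` and `V = 2048 τ²`: the admissible range is `2
V t₀ = 128 piMin τ`, and `8192 = 4 · 2048`. It serves both the feature means, where the second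
factor is the constant `1`, and the noise. -/
lemma bernstein_affFun (hζ : IsIID P (obsLaw prior mean SW) ζ) (j : Fin p) (b : Fin p → ℝ)
    (c : Fin K → ℝ) (hb : ∑ k, prior k * classMoment mean SW b c k ≤ 1)
    (h0 : ∫ y, affFun (Pi.single j 1) 0 y * affFun b c y ∂(obsLaw prior mean SW) = 0)
    {B : ℝ} (hB : 0 ≤ B) (hBL : B * √(Real.log p / n) ≤ 128 * piMin) (hn : 0 < n) :
    P {ω | n * (B * tau mean SW * √(Real.log p / n))
        ≤ |∑ i, affFun (Pi.single j 1) 0 (ζ i ω) * affFun b c (ζ i ω)|}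
      ≤ ENNReal.ofReal (2 * Real.exp (-(B ^ 2 / 8192 * Real.log p))) := by
  have hτ := h.tau_pos
  have := h.isProbabilityMeasure
  have hl := h.log_p_pos
  have hn' : (0 : ℝ) < n := by exact_mod_cast hn
  have hm : Measurable fun y : EuclideanSpace ℝ (Fin p) × Fin K =>
      affFun (Pi.single j 1) 0 y * affFun b c y := (measurable_affFun _ _).mul (measurable_affFun _ _)
  have h1 := hζ.bernstein hm (integrable_affFun_mul _ _ _ _) h0 (by positivity)
    (h.lintegral_sq_mul_exp_le (Pi.single j 1) b 0 c hτ
      (classMoment_single_le h.posSemidef j) hb)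
    (a := B * tau mean SW * √(Real.log p / n)) (by positivity) (by
      have : 2 * (2048 * tau mean SW ^ 2) * (piMin / (32 * tau mean SW))
          = 128 * piMin * tau mean SW := by field_simp; ring
      rw [this]
      nlinarith)
  refine h1.trans_eq ?_
  congr 3
  rw [mul_pow, mul_pow, Real.sq_sqrt (by positivity)]
  field_simp
  ring

lemma feature_mean_tail (hζ : IsIID P (obsLaw prior mean SW) ζ) (j : Fin p)
    {B : ℝ} (hB : 0 ≤ B) (hBL : B * √(Real.log p / n) ≤ 128 * piMin) (hn : 0 < n) :
    P {ω | n * (B * tau mean SW * √(Real.log p / n)) ≤ |∑ i, (ζ i ω).1 j|}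
      ≤ ENNReal.ofReal (2 * Real.exp (-(B ^ 2 / 8192 * Real.log p))) := by
  have hlin : ∀ v : EuclideanSpace ℝ (Fin p), linFun 0 v = 0 := fun v => by simp [linFun_apply]
  have h1 := h.bernstein_affFun hζ j 0 1 (by
    simp [classMoment, hlin, h.sum_prior]) (by
    simp only [affFun, hlin, linFun_single, Pi.zero_apply, Pi.one_apply, zero_add, add_zero,
      mul_one]
    have := integral_affFun (prior := prior) (mean := mean) (SW := SW) h.prior_nonneg
      (Pi.single j 1) 0
    simp only [affFun, linFun_single, Pi.zero_apply, add_zero] at this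
    rw [this, h.sum_prior_mul_mean]) hB hBL hn
  simpa only [affFun, hlin, linFun_single, Pi.zero_apply, Pi.one_apply, zero_add, add_zero,
      mul_one] using h1

lemma noise_tail (hζ : IsIID P (obsLaw prior mean SW) ζ) (j : Fin p) (l : Fin (K - 1))
    {B : ℝ} (hB : 0 ≤ B) (hBL : B * √(Real.log p / n) ≤ 128 * piMin) (hn : 0 < n) :
    P {ω | n * (B * tau mean SW * √(Real.log p / n))
        ≤ |∑ i, (ζ i ω).1 j * residual prior mean SW l (ζ i ω)|}
      ≤ ENNReal.ofReal (2 * Real.exp (-(B ^ 2 / 8192 * Real.log p))) := by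
  have h1 := h.bernstein_affFun hζ j _ _ (h.sum_classMoment_residual_le l)
    (h.integral_linFun_mul_residual _ l) hB hBL hn
  have e : ∀ y : EuclideanSpace ℝ (Fin p) × Fin K, affFun (Pi.single j 1) 0 y = y.1 j := fun y => by
    simp [affFun, linFun_single]
  simpa only [e, residual] using h1

omit h in
lemma sqrt_totalCov_transpose :
    (CFC.sqrt (totalCov prior mean SW))ᵀ = CFC.sqrt (totalCov prior mean SW) := by
  have := (CFC.sqrt_nonneg (totalCov prior mean SW)).isSelfAdjoint
  rw [IsSelfAdjoint, Matrix.star_eq_conjTranspose] at this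
  simpa using this

lemma sqrt_totalCov_mul_self :
    CFC.sqrt (totalCov prior mean SW) * CFC.sqrt (totalCov prior mean SW)
      = totalCov prior mean SW :=
  CFC.sqrt_mul_sqrt_self _ h.posDef.posSemidef.nonneg

lemma isUnit_det_sqrt_totalCov : IsUnit (CFC.sqrt (totalCov prior mean SW)).det := by
  have h1 := congrArg Matrix.det h.sqrt_totalCov_mul_self
  rw [Matrix.det_mul] at h1
  refine isUnit_iff_ne_zero.2 fun h0 => h.posDef.det_pos.ne' ?_
  rw [← h1, h0, mul_zero]

lemma whiteningRow_energy (j : Fin p) :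
    whiteningRow prior mean SW j ⬝ᵥ totalCov prior mean SW *ᵥ whiteningRow prior mean SW j = 1 := by
  set R := CFC.sqrt (totalCov prior mean SW) with hR
  have hu := h.isUnit_det_sqrt_totalCov
  have e : R⁻¹ * totalCov prior mean SW * (R⁻¹)ᵀ = 1 := by
    have hRR : totalCov prior mean SW = R * R := h.sqrt_totalCov_mul_self.symm
    have hRT : Rᵀ = R := sqrt_totalCov_transpose
    rw [Matrix.transpose_nonsing_inv, hRT, hRR, ← mul_assoc, Matrix.nonsing_inv_mul _ hu, one_mul,
      Matrix.mul_nonsing_inv _ hu]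
  have e2 := congrFun (congrFun e j) j
  rw [Matrix.one_apply_eq, mul_assoc] at e2
  rw [← e2]
  simp only [Matrix.mul_apply, dotProduct, Matrix.mulVec, Matrix.transpose_apply]
  rfl

/-- For bounded `p`, where the union bound with the fixed constant `200` is too weak. Both factors
have second moment at most `1`, so their fourth moments bound the second moment of the product, free
of `τ`. -/
lemma whitened_noise_tail [IsProbabilityMeasure P] (hζ : IsIID P (obsLaw prior mean SW) ζ)
    (j : Fin p) (l : Fin (K - 1)) {A : ℝ} (hA : 0 < A) (hn : 0 < n) :
    P {ω | √(A * n) ≤ |∑ i, linFun (whiteningRow prior mean SW j) (ζ i ω).1 *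
        residual prior mean SW l (ζ i ω)|} ≤ ENNReal.ofReal (256 / piMin ^ 2 / A) := by
  set b := whiteningRow prior mean SW j
  set b' := -(Bstar prior mean SW).col l
  set c' := scoreFun prior l
  have hi4 := integrable_affFun_pow (prior := prior) (mean := mean) (SW := SW) b 0 4
  have hi4' := integrable_affFun_pow (prior := prior) (mean := mean) (SW := SW) b' c' 4
  have hsum : Integrable (fun y => (affFun b 0 y ^ 4 + affFun b' c' y ^ 4) / 2)
      (obsLaw prior mean SW) := (hi4.add hi4').div_const 2
  have hm : Measurable fun y : EuclideanSpace ℝ (Fin p) × Fin K => affFun b 0 y * affFun b' c' y :=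
    (measurable_affFun _ _).mul (measurable_affFun _ _)
  have hpt : ∀ y : EuclideanSpace ℝ (Fin p) × Fin K, (affFun b 0 y * affFun b' c' y) ^ 2
      ≤ (affFun b 0 y ^ 4 + affFun b' c' y ^ 4) / 2 := fun y => by
    nlinarith [sq_nonneg (affFun b 0 y ^ 2 - affFun b' c' y ^ 2)]
  have hsq : Integrable (fun y => (affFun b 0 y * affFun b' c' y) ^ 2) (obsLaw prior mean SW) :=
    hsum.mono' (hm.pow_const 2).aestronglyMeasurable (ae_of_all _ fun y => by
      rw [Real.norm_of_nonneg (sq_nonneg _)]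
      exact hpt y)
  have h1 := hζ.chebyshev hm ((memLp_two_iff_integrable_sq hm.aestronglyMeasurable).2 hsq)
    (h.integral_linFun_mul_residual b l) (V := 256 / piMin ^ 2) (by
      refine (integral_mono hsq hsum hpt).trans ?_
      rw [integral_div, integral_add hi4 hi4']
      have k1 := h.integral_affFun_pow_four_le b 0 (σ2 := 1) one_pos
        (by rw [h.sum_classMoment_zero, h.whiteningRow_energy])
      have k2 := h.integral_affFun_pow_four_le b' c' (σ2 := 1) one_pos
        (h.sum_classMoment_residual_le l)
      linarith) hA hn
  simpa only [affFun, residual, Pi.zero_apply, add_zero] using h1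

end IsPopulation

/-- A sample whose empirical averages are close to the population averages. The noise is controlled
either in the maximum norm or in the norm of the inverse covariance matrix. -/
structure IsGoodSample (prior : Fin K → ℝ) (mean : Fin K → EuclideanSpace ℝ (Fin p))
    (SW : Matrix (Fin p) (Fin p) ℝ) (piMin A B : ℝ) (p₀ : ℕ)
    (y : Fin n → EuclideanSpace ℝ (Fin p) × Fin K) : Prop where
  classFreq : ∀ k, |∑ i, ((if (y i).2 = k then 1 else 0) - prior k)| ≤ √(A * n)
  residual_sum : ∀ l, |∑ i, residual prior mean SW l (y i)| ≤ √(A * n)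
  feature_sum : ∀ j, |∑ i, (y i).1 j| ≤ n * (B * tau mean SW * √(Real.log p / n))
  isometry : ∀ v : Fin p → ℝ, v ⬝ᵥ totalCov prior mean SW *ᵥ v / 2
    - 589824 / piMin ^ 2 * tau mean SW ^ 2 * (Real.log p / n) * (∑ j, |v j|) ^ 2
      ≤ (∑ i, linFun v (y i).1 ^ 2) / n
  noise : (∀ j l, |∑ i, (y i).1 j * residual prior mean SW l (y i)|
      ≤ n * (200 * tau mean SW * √(Real.log p / n))) ∨
    p < p₀ ∧ ∀ j l,
      |∑ i, linFun (whiteningRow prior mean SW j) (y i).1 * residual prior mean SW l (y i)| ≤ √(A * n)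

lemma IsPopulation.measure_not_isGoodSample_le [IsProbabilityMeasure P]
    (h : IsPopulation prior mean SW piMin)
    (hζ : IsIID P (obsLaw prior mean SW) ζ) (hn : 0 < n) {A B δ : ℝ} (hA : 0 < A) (hB : 0 ≤ B)
    (hδ : 0 ≤ δ) {p₀ : ℕ}
    (hlog : 24576 * Real.log p ≤ n * piMin ^ 2)
    (hBL : B * √(Real.log p / n) ≤ 128 * piMin) (h200 : 200 * √(Real.log p / n) ≤ 128 * piMin)
    (h1 : 1 / piMin * (1 / A) ≤ δ)
    (h3 : p * (2 * Real.exp (-(B ^ 2 / 8192 * Real.log p))) ≤ δ)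
    (h4 : 2 * Real.exp (-(n * piMin ^ 2 / 4096)) ≤ δ)
    (h5 : p₀ ≤ p → p * (1 / piMin) * (2 * Real.exp (-(200 ^ 2 / 8192 * Real.log p))) ≤ δ)
    (h6 : p < p₀ → p * (1 / piMin) * (256 / piMin ^ 2 / A) ≤ δ) :
    P {ω | ¬ IsGoodSample prior mean SW piMin A B p₀ fun i => ζ i ω} ≤ ENNReal.ofReal (5 * δ) := by
  have hK := h.card_le
  have hpi := h.piMin_pos
  have hK1 : ((K - 1 : ℕ) : ℝ) ≤ 1 / piMin := by
    refine le_trans ?_ hK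
    exact_mod_cast Nat.sub_le _ _
  have e1 : P {ω | ∃ k, ω ∈ {ω | √(A * n)
      ≤ |∑ i, ((if (ζ i ω).2 = k then 1 else 0) - prior k)|}} ≤ ENNReal.ofReal δ := by
    refine (measure_exists_le fun k => h.classFreq_tail hζ hn hA k).trans
      (ENNReal.ofReal_le_ofReal (le_trans ?_ h1))
    simp only [Fintype.card_fin]
    gcongr
  have e2 : P {ω | ∃ l, ω ∈ {ω | √(A * n) ≤ |∑ i, residual prior mean SW l (ζ i ω)|}}
      ≤ ENNReal.ofReal δ := by
    refine (measure_exists_le fun k => h.residual_tail hζ hn hA k).trans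
      (ENNReal.ofReal_le_ofReal (le_trans ?_ h1))
    simp only [Fintype.card_fin]
    gcongr
  have e3 : P {ω | ∃ j, ω ∈ {ω | n * (B * tau mean SW * √(Real.log p / n))
      ≤ |∑ i, (ζ i ω).1 j|}} ≤ ENNReal.ofReal δ := by
    refine (measure_exists_le fun j => h.feature_mean_tail hζ j hB hBL hn).trans
      (ENNReal.ofReal_le_ofReal (le_trans ?_ h3))
    simp only [Fintype.card_fin]
    rfl
  have e4 := (h.lower_isometry hζ hn hlog).trans (ENNReal.ofReal_le_ofReal h4)
  have e5 : P {ω | ¬ ((∀ j l, |∑ i, (ζ i ω).1 j * residual prior mean SW l (ζ i ω)|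
      ≤ n * (200 * tau mean SW * √(Real.log p / n))) ∨
    (p < p₀ ∧ ∀ j l, |∑ i, linFun (whiteningRow prior mean SW j) (ζ i ω).1 *
      residual prior mean SW l (ζ i ω)| ≤ √(A * n)))} ≤ ENNReal.ofReal δ := by
    rcases lt_or_ge p p₀ with hp | hp
    · have := measure_exists_le fun jl : Fin p × Fin (K - 1) =>
        h.whitened_noise_tail hζ jl.1 jl.2 hA hn
      refine (measure_mono fun ω hω => ?_).trans (this.trans (ENNReal.ofReal_le_ofReal
        (le_trans ?_ (h6 hp))))
      · simp only [Set.mem_ofPred_eq, not_or, not_forall, not_le, hp, true_and] at hω ⊢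
        obtain ⟨-, j, l, hjl⟩ := hω
        exact ⟨(j, l), hjl.le⟩
      · simp only [Fintype.card_prod, Fintype.card_fin, Nat.cast_mul]
        gcongr
    · have := measure_exists_le fun jl : Fin p × Fin (K - 1) =>
        h.noise_tail hζ jl.1 jl.2 (by norm_num) h200 hn
      refine (measure_mono fun ω hω => ?_).trans (this.trans (ENNReal.ofReal_le_ofReal
        (le_trans ?_ (h5 hp))))
      · simp only [Set.mem_ofPred_eq, not_or, not_forall, not_le] at hω ⊢
        obtain ⟨⟨j, l, hjl⟩, -⟩ := hω
        exact ⟨(j, l), hjl.le⟩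
      · simp only [Fintype.card_prod, Fintype.card_fin, Nat.cast_mul]
        gcongr
  set S1 := {ω | ∃ k, ω ∈ {ω | √(A * n)
      ≤ |∑ i, ((if (ζ i ω).2 = k then 1 else 0) - prior k)|}}
  set S2 := {ω | ∃ l, ω ∈ {ω | √(A * n) ≤ |∑ i, residual prior mean SW l (ζ i ω)|}}
  set S3 := {ω | ∃ j, ω ∈ {ω | n * (B * tau mean SW * √(Real.log p / n))
      ≤ |∑ i, (ζ i ω).1 j|}}
  refine (measure_mono (t := S1 ∪ (S2 ∪ (S3 ∪ (_ ∪ _)))) fun ω hω => ?_).trans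
    ((measure_union_le _ _).trans (add_le_add e1 ((measure_union_le _ _).trans (add_le_add e2
    ((measure_union_le _ _).trans (add_le_add e3 ((measure_union_le _ _).trans
      (add_le_add e4 e5)))))))) |>.trans_eq ?_
  · by_contra hcon
    simp only [Set.mem_union, not_or, Set.mem_ofPred_eq, not_not] at hcon
    obtain ⟨c1, c2, c3, c4, c5⟩ := hcon
    refine hω ⟨fun k => ?_, fun l => ?_, fun j => ?_, c4, ?_⟩
    · by_contra hc; exact c1 ⟨k, (not_le.1 hc).le⟩
    · by_contra hc; exact c2 ⟨l, (not_le.1 hc).le⟩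
    · by_contra hc; exact c3 ⟨j, (not_le.1 hc).le⟩
    · by_contra hc
      exact c5 (not_or.1 hc)
  · rw [← ENNReal.ofReal_add hδ hδ, ← ENNReal.ofReal_add hδ (by linarith),
      ← ENNReal.ofReal_add hδ (by linarith), ← ENNReal.ofReal_add hδ (by linarith)]
    ring_nf

end Good

/-! ### Mixed norms -/

/-! ### Decomposability of the mixed norm and the restricted eigenvalue cone -/

section MixedNorm

variable {q r : ℕ} (A B : Matrix (Fin q) (Fin r) ℝ) (S : Finset (Fin q))

lemma rowNorm_nonneg (i : Fin q) : 0 ≤ rowNorm A i := Real.sqrt_nonneg _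

lemma rowNorm_sq (i : Fin q) : rowNorm A i ^ 2 = ∑ j, A i j ^ 2 :=
  Real.sq_sqrt (Finset.sum_nonneg fun _ _ => sq_nonneg _)

lemma rowNorm_eq_norm (i : Fin q) : rowNorm A i = ‖(WithLp.toLp 2 (A i) : EuclideanSpace ℝ (Fin r))‖ := by
  rw [EuclideanSpace.norm_eq, rowNorm]
  simp

lemma rowNorm_sub_le (i : Fin q) : rowNorm (A - B) i ≤ rowNorm A i + rowNorm B i := by
  simp only [rowNorm_eq_norm]
  exact norm_sub_le (WithLp.toLp 2 (A i) : EuclideanSpace ℝ (Fin r)) (WithLp.toLp 2 (B i))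

lemma abs_le_rowNorm (i : Fin q) (j : Fin r) : |A i j| ≤ rowNorm A i :=
  Real.abs_le_sqrt (Finset.single_le_sum (f := fun j => A i j ^ 2) (fun _ _ => sq_nonneg _)
    (Finset.mem_univ j))

lemma sum_abs_le_sqrt_mul_rowNorm (i : Fin q) : ∑ j, |A i j| ≤ √r * rowNorm A i := by
  rw [rowNorm, ← Real.sqrt_mul (by positivity)]
  apply Real.le_sqrt_of_sq_le
  have := sq_sum_le_card_mul_sum_sq (s := Finset.univ) (f := fun j => |A i j|)
  simpa using this

lemma norm12_nonneg : 0 ≤ norm12 A := Finset.sum_nonneg fun i _ => rowNorm_nonneg A i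

lemma frobSq_nonneg : 0 ≤ frobSq A :=
  Finset.sum_nonneg fun _ _ => Finset.sum_nonneg fun _ _ => sq_nonneg _

lemma frobSq_eq_sum_rowNorm_sq : frobSq A = ∑ i, rowNorm A i ^ 2 := by
  simp only [frobSq, rowNorm_sq]

lemma frobSq_le_norm12_sq : frobSq A ≤ norm12 A ^ 2 := by
  rw [frobSq_eq_sum_rowNorm_sq]
  exact Finset.sum_sq_le_sq_sum_of_nonneg fun i _ => rowNorm_nonneg A i

lemma sum_abs_le_sqrt_mul_norm12 : ∑ i, ∑ j, |A i j| ≤ √r * norm12 A := by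
  rw [norm12, Finset.mul_sum]
  exact Finset.sum_le_sum fun i _ => sum_abs_le_sqrt_mul_rowNorm A i

lemma norm12_sub_le : norm12 (A - B) ≤ norm12 A + norm12 B := by
  rw [norm12, norm12, norm12, ← Finset.sum_add_distrib]
  exact Finset.sum_le_sum fun i _ => rowNorm_sub_le A B i

lemma rowNorm_rowRestrict (i : Fin q) :
    rowNorm (rowRestrict S A) i = if i ∈ S then rowNorm A i else 0 := by
  split_ifs with hi <;> simp [rowNorm, rowRestrict, hi]

lemma norm12_rowRestrict : norm12 (rowRestrict S A) = ∑ i ∈ S, rowNorm A i := by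
  simp only [norm12, rowNorm_rowRestrict, Finset.sum_ite_mem, Finset.univ_inter]

lemma frobSq_rowRestrict : frobSq (rowRestrict S A) = ∑ i ∈ S, rowNorm A i ^ 2 := by
  simp only [frobSq_eq_sum_rowNorm_sq, rowNorm_rowRestrict, ite_pow, ne_eq, OfNat.ofNat_ne_zero,
    not_false_eq_true, zero_pow, Finset.sum_ite_mem, Finset.univ_inter]

lemma norm12_eq_add : norm12 A = norm12 (rowRestrict S A) + norm12 (rowRestrict Sᶜ A) := by
  rw [norm12_rowRestrict, norm12_rowRestrict, Finset.sum_add_sum_compl]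
  rfl

lemma norm12_rowRestrict_sq_le :
    norm12 (rowRestrict S A) ^ 2 ≤ S.card * frobSq (rowRestrict S A) := by
  rw [norm12_rowRestrict, frobSq_rowRestrict]
  exact sq_sum_le_card_mul_sum_sq

lemma rowNorm_eq_zero_of_notMem {i : Fin q} (hi : i ∉ rowSupport A) : rowNorm A i = 0 := by
  by_contra h
  exact hi (by simp [rowSupport, h])

lemma norm12_rowSupport_compl : norm12 (rowRestrict (rowSupport A)ᶜ A) = 0 := by
  rw [norm12_rowRestrict]
  exact Finset.sum_eq_zero fun i hi => rowNorm_eq_zero_of_notMem A (Finset.mem_compl.1 hi)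

/-- Triangle inequality on the support of `A`. Off the support `A` vanishes, so there the rows of `B
- A` are rows of `B` and count with a negative sign. -/
lemma norm12_sub_norm12_le :
    norm12 A - norm12 B ≤ norm12 (rowRestrict (rowSupport A) (B - A))
      - norm12 (rowRestrict (rowSupport A)ᶜ (B - A)) := by
  set S := rowSupport A
  have h1 : norm12 A = ∑ i ∈ S, rowNorm A i := by
    rw [norm12_eq_add A S, norm12_rowSupport_compl, add_zero, norm12_rowRestrict]
  rw [h1, norm12_eq_add B S]
  simp only [norm12_rowRestrict]
  have h2 : ∑ i ∈ S, rowNorm A i ≤ ∑ i ∈ S, rowNorm B i + ∑ i ∈ S, rowNorm (B - A) i := by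
    rw [← Finset.sum_add_distrib]
    refine Finset.sum_le_sum fun i _ => ?_
    have := rowNorm_sub_le B (B - A) i
    rwa [sub_sub_cancel] at this
  have h3 : ∑ i ∈ Sᶜ, rowNorm (B - A) i ≤ ∑ i ∈ Sᶜ, rowNorm B i := by
    refine Finset.sum_le_sum fun i hi => ?_
    have := rowNorm_sub_le B A i
    rw [rowNorm_eq_zero_of_notMem A (Finset.mem_compl.1 hi)] at this
    linarith
  linarith

lemma frobSq_mul_eq_sum {t : ℕ} (R : Matrix (Fin t) (Fin q) ℝ) :
    frobSq (R * A) = ∑ l, A.col l ⬝ᵥ (Rᵀ * R) *ᵥ A.col l := by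
  rw [frobSq, Finset.sum_comm]
  refine Finset.sum_congr rfl fun l _ => ?_
  rw [← Matrix.mulVec_mulVec, Matrix.dotProduct_mulVec, Matrix.vecMul_transpose, dotProduct]
  refine Finset.sum_congr rfl fun i _ => ?_
  rw [sq]
  rfl

lemma trace_eq_sum (T : Matrix (Fin q) (Fin q) ℝ) :
    Matrix.trace (Aᵀ * T * A) = ∑ l, A.col l ⬝ᵥ T *ᵥ A.col l := by
  simp only [Matrix.trace, Matrix.diag_apply]
  refine Finset.sum_congr rfl fun l _ => ?_
  rw [Matrix.mul_assoc, Matrix.mul_apply]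
  simp [dotProduct, Matrix.mulVec, Matrix.mul_apply]

variable {A}

/-- On the cone, the restricted eigenvalue condition controls the whole Frobenius norm. -/
lemma GroupRE.frobSq_le {t p s K : ℕ} {R : Matrix (Fin t) (Fin p) ℝ} {γ : ℝ}
    (hRE : GroupRE s 3 K R γ) (hs : 1 ≤ s) {S : Finset (Fin p)} (hS : S.card = s)
    (D : Matrix (Fin p) (Fin (K - 1)) ℝ)
    (hcone : norm12 (rowRestrict Sᶜ D) ≤ 3 * norm12 (rowRestrict S D)) :
    frobSq D ≤ 4 * γ * frobSq (R * D) := by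
  obtain ⟨hγ, hRE⟩ := hRE
  set w := rowNorm D with hw
  have hw0 : ∀ i, 0 ≤ w i := rowNorm_nonneg D
  -- `J` collects `s` rows of largest norm. The cone condition passes from `S` to `J`, and every row
  -- outside `J` is at most the average over `J`. Therefore the squares off `J` sum to at most `3`
  -- times those on `J`, whence the factor `4`.
  obtain ⟨J, hJ, hmax⟩ := Finset.exists_max_image (Finset.powersetCard s Finset.univ)
    (fun J => ∑ i ∈ J, w i) ⟨S, by simp [Finset.mem_powersetCard, hS]⟩
  have hJs : J.card = s := (Finset.mem_powersetCard.1 hJ).2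
  have hSJ : ∑ i ∈ S, w i ≤ ∑ i ∈ J, w i := hmax S (by simp [Finset.mem_powersetCard, hS])
  have hswap : ∀ i ∈ J, ∀ j ∉ J, w j ≤ w i := by
    intro i hi j hj
    have hj' : j ∉ J.erase i := fun h => hj (Finset.mem_of_mem_erase h)
    have hc : (insert j (J.erase i)).card = s := by
      rw [Finset.card_insert_of_notMem hj', Finset.card_erase_of_mem hi]
      omega
    have := hmax (insert j (J.erase i)) (by simp only [Finset.mem_powersetCard]; exact ⟨Finset.subset_univ _, hc⟩)
    rw [Finset.sum_insert hj', ← Finset.add_sum_erase J w hi] at this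
    linarith
  have hs0 : (0 : ℝ) < s := by exact_mod_cast hs
  have htail : ∀ j ∉ J, s * w j ≤ ∑ i ∈ J, w i := fun j hj => by
    calc (s : ℝ) * w j = ∑ _i ∈ J, w j := by simp [hJs]
      _ ≤ _ := Finset.sum_le_sum fun i hi => hswap i hi j hj
  have hsplit : ∀ T : Finset (Fin p), ∑ i ∈ Tᶜ, w i = ∑ i, w i - ∑ i ∈ T, w i := fun T => by
    rw [← Finset.sum_add_sum_compl T w]; ring
  simp only [norm12_rowRestrict] at hcone
  have hconeJ : ∑ i ∈ Jᶜ, w i ≤ 3 * ∑ i ∈ J, w i := by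
    rw [hsplit] at hcone ⊢
    linarith
  have hre := hRE J hJs.le D (by simpa only [norm12_rowRestrict] using hconeJ)
  rw [frobSq_rowRestrict, div_le_iff₀ hγ] at hre
  have hcs : (∑ i ∈ J, w i) ^ 2 ≤ s * ∑ i ∈ J, w i ^ 2 := hJs ▸ sq_sum_le_card_mul_sum_sq
  have hJ0 : 0 ≤ ∑ i ∈ J, w i := Finset.sum_nonneg fun i _ => hw0 i
  have hoff : ∑ j ∈ Jᶜ, w j ^ 2 ≤ 3 * ∑ i ∈ J, w i ^ 2 := by
    have h1 : s * ∑ j ∈ Jᶜ, w j ^ 2 ≤ s * (3 * ∑ i ∈ J, w i ^ 2) := by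
      calc s * ∑ j ∈ Jᶜ, w j ^ 2 = ∑ j ∈ Jᶜ, w j * (s * w j) := by
            rw [Finset.mul_sum]; exact Finset.sum_congr rfl fun j _ => by ring
        _ ≤ ∑ j ∈ Jᶜ, w j * ∑ i ∈ J, w i := Finset.sum_le_sum fun j hj =>
            mul_le_mul_of_nonneg_left (htail j (Finset.mem_compl.1 hj)) (hw0 j)
        _ = (∑ j ∈ Jᶜ, w j) * ∑ i ∈ J, w i := by rw [Finset.sum_mul]
        _ ≤ (3 * ∑ i ∈ J, w i) * ∑ i ∈ J, w i := mul_le_mul_of_nonneg_right hconeJ hJ0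
        _ ≤ _ := by nlinarith
    exact le_of_mul_le_mul_left h1 hs0
  rw [frobSq_eq_sum_rowNorm_sq, ← Finset.sum_add_sum_compl J]
  linarith

end MixedNorm

/-! ### The deterministic oracle inequality -/

/-- Off the cone the penalty outweighs the noise, so `lam * dl` is bounded by `D * N + N ^ 2`. With
`X = N² / lam²` this makes the isometry defect `T * dl ^ 2` a small fraction of `D ^ 2 + N ^ 2`, and
`D` is of order `N`. -/
lemma oracle_off_cone {D a N lam dl T X : ℝ} (hlam : 0 < lam)
    (hdl : 0 ≤ dl) (hT : 0 ≤ T) (hX : N ^ 2 = X * lam ^ 2) (hTX : T * X ≤ 1 / 256)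
    (h1 : a ^ 2 / 4 + lam * dl / 4 ≤ D * N + N ^ 2)
    (h2 : D ^ 2 / 2 ≤ a ^ 2 + T * dl ^ 2) :
    D ^ 2 ≤ 145 * N ^ 2 ∧ dl ^ 2 ≤ 4672 * N ^ 2 * X := by
  have hX0 : 0 ≤ X := by
    have h3 : 0 ≤ X * lam ^ 2 := hX ▸ sq_nonneg N
    exact nonneg_of_mul_nonneg_left h3 (by positivity)
  have e1 : lam * dl ≤ 4 * (D * N + N ^ 2) := by nlinarith [sq_nonneg a]
  have e2 : (lam * dl) ^ 2 ≤ 32 * (D ^ 2 + N ^ 2) * N ^ 2 := by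
    calc (lam * dl) ^ 2 ≤ (4 * (D * N + N ^ 2)) ^ 2 := by gcongr
      _ = 16 * (D + N) ^ 2 * N ^ 2 := by ring
      _ ≤ _ := by
        have : 16 * (D + N) ^ 2 ≤ 32 * (D ^ 2 + N ^ 2) := by nlinarith [sq_nonneg (D - N)]
        gcongr
  have e3 : dl ^ 2 ≤ 32 * (D ^ 2 + N ^ 2) * X := by
    have : lam ^ 2 * dl ^ 2 ≤ lam ^ 2 * (32 * (D ^ 2 + N ^ 2) * X) := by
      calc lam ^ 2 * dl ^ 2 = (lam * dl) ^ 2 := by ring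
        _ ≤ _ := e2
        _ = _ := by rw [hX]; ring
    exact le_of_mul_le_mul_left this (by positivity)
  have e4 : T * dl ^ 2 ≤ (D ^ 2 + N ^ 2) / 8 := by
    calc T * dl ^ 2 ≤ T * (32 * (D ^ 2 + N ^ 2) * X) := by gcongr
      _ = 32 * (D ^ 2 + N ^ 2) * (T * X) := by ring
      _ ≤ 32 * (D ^ 2 + N ^ 2) * (1 / 256) := by gcongr
      _ = _ := by ring
  have e5 : D ^ 2 ≤ 145 * N ^ 2 := by
    nlinarith [sq_nonneg (D - 16 * N), mul_nonneg hlam.le hdl]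
  refine ⟨e5, e3.trans (mul_le_mul_of_nonneg_right ?_ hX0)⟩
  linarith

/-- Fast rate: `u` is the penalty on the support, bounded through the restricted eigenvalue
condition by a multiple of `D`, and then absorbed into `D ^ 2`. -/
lemma oracle_fast {D a N u c : ℝ} (hc : 0 ≤ c) (hu : u ^ 2 ≤ c * D ^ 2)
    (h1 : a ^ 2 ≤ 5 * u + 4 * (D * N) + 4 * N ^ 2) (h2 : D ^ 2 / 2 ≤ a ^ 2 + D ^ 2 / 8) :
    D ^ 2 ≤ 400 * c + 272 * N ^ 2 := by
  have h3 : 5 * u ≤ D ^ 2 / 16 + 100 * c := by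
    refine (le_abs_self _).trans (abs_le_of_sq_le_sq ?_ (by positivity))
    nlinarith [sq_nonneg (D ^ 2 / 16 - 100 * c)]
  nlinarith [sq_nonneg (D - 32 * N)]

/-- Slow rate: the penalty `v` of the target is kept as it stands, and the isometry defect is paid
for with the mixed norm `b` of the target. -/
lemma oracle_slow {D a N v T b dl X : ℝ} (hT : 0 ≤ T) (hTX : T * X ≤ 1 / 256)
    (h1 : a ^ 2 ≤ 5 * v + 4 * (D * N) + 4 * N ^ 2)
    (h2 : D ^ 2 / 2 ≤ a ^ 2 + T * dl ^ 2) (h3 : dl ^ 2 ≤ 15 * b ^ 2 + 8 * (D ^ 2 + N ^ 2) * X) :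
    D ^ 2 ≤ 20 * v + 60 * (T * b ^ 2) + 148 * N ^ 2 := by
  have e : T * dl ^ 2 ≤ 15 * (T * b ^ 2) + (D ^ 2 + N ^ 2) / 32 := by
    calc T * dl ^ 2 ≤ T * (15 * b ^ 2 + 8 * (D ^ 2 + N ^ 2) * X) := by gcongr
      _ = 15 * (T * b ^ 2) + 8 * (D ^ 2 + N ^ 2) * (T * X) := by ring
      _ ≤ 15 * (T * b ^ 2) + 8 * (D ^ 2 + N ^ 2) * (1 / 256) := by gcongr
      _ = _ := by ring
  nlinarith [sq_nonneg (D - 16 * N)]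

/-- Bounding the error norm by `b + bh` leaves the surplus `-3 * (lam * bh)`. As `a ^ 2` is
nonnegative, this surplus bounds the estimator and with it `dl`. -/
lemma sq_mixed_le_slow {D a N lam b bh dl X : ℝ} (hD : 0 ≤ D) (hN : 0 ≤ N) (hlam : 0 < lam)
    (hb : 0 ≤ b) (hdl : 0 ≤ dl) (hX : N ^ 2 = X * lam ^ 2)
    (h1 : a ^ 2 / 4 ≤ lam / 4 * dl + D * N + N ^ 2 + lam * (b - bh)) (h3 : dl ≤ b + bh) :
    a ^ 2 ≤ 5 * (lam * b) + 4 * (D * N) + 4 * N ^ 2 - 3 * (lam * bh) ∧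
      dl ^ 2 ≤ 15 * b ^ 2 + 8 * (D ^ 2 + N ^ 2) * X := by
  have e0 : lam * dl ≤ lam * b + lam * bh := by nlinarith
  have e1 : a ^ 2 ≤ 5 * (lam * b) + 4 * (D * N) + 4 * N ^ 2 - 3 * (lam * bh) := by nlinarith
  refine ⟨e1, ?_⟩
  have e2 : lam * dl ≤ 8 / 3 * (lam * b) + 4 / 3 * (D * N + N ^ 2) := by
    nlinarith [sq_nonneg a]
  have e3 : (lam * dl) ^ 2 ≤ 15 * (lam * b) ^ 2 + 8 * (D ^ 2 + N ^ 2) * N ^ 2 := by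
    have hw : 0 ≤ D * N + N ^ 2 := by positivity
    have hlb : 0 ≤ lam * b := by positivity
    calc (lam * dl) ^ 2 ≤ (8 / 3 * (lam * b) + 4 / 3 * (D * N + N ^ 2)) ^ 2 := by gcongr
      _ ≤ 2 * (8 / 3 * (lam * b)) ^ 2 + 2 * (4 / 3 * (D * N + N ^ 2)) ^ 2 := by
        nlinarith [sq_nonneg (8 / 3 * (lam * b) - 4 / 3 * (D * N + N ^ 2))]
      _ = 128 / 9 * (lam * b) ^ 2 + 32 / 9 * (D + N) ^ 2 * N ^ 2 := by ring
      _ ≤ _ := by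
        have : 32 / 9 * (D + N) ^ 2 ≤ 8 * (D ^ 2 + N ^ 2) := by
          nlinarith [sq_nonneg (D - N), sq_nonneg D, sq_nonneg N]
        have h2 : 128 / 9 * (lam * b) ^ 2 ≤ 15 * (lam * b) ^ 2 := by gcongr; norm_num
        gcongr
  have : lam ^ 2 * dl ^ 2 ≤ lam ^ 2 * (15 * b ^ 2 + 8 * (D ^ 2 + N ^ 2) * X) := by
    calc lam ^ 2 * dl ^ 2 = (lam * dl) ^ 2 := by ring
      _ ≤ _ := e3
      _ = _ := by rw [hX]; ring
  exact le_of_mul_le_mul_left this (by positivity)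

/-- The constant in the oracle inequality. -/
noncomputable def oracleConst (C C₂ A₁ : ℝ) : ℝ :=
  400 * C ^ 2 + 1000 * A₁ + 20 * (C * (128 * C₂ + 1)) + 60 * C₂ + 20000 * A₁ ^ 2

/-- The scalar form of the oracle inequality. The errors are `D` in prediction and `dS + dC` in
mixed norm, split into the parts on and off the support. -/
lemma oracle_bound {D a N lam b bh dS dC τ L s γ κ C C₂ A₁ n : ℝ}
    (hD : 0 ≤ D) (hN : 0 ≤ N) (hlam : 0 < lam) (hb : 0 ≤ b) (hbh : 0 ≤ bh)
    (hdS : 0 ≤ dS) (hdC : 0 ≤ dC) (hτ : 0 < τ) (hL : 0 < L) (hs : 1 ≤ s) (hγ : 0 < γ) (hκ : 1 ≤ κ)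
    (hC : 1 ≤ C) (hC₂ : 0 < C₂) (hA₁ : 0 ≤ A₁) (hn : 0 < n)
    (h1 : a ^ 2 / 2 ≤ lam / 4 * (dS + dC) + (D + a) * N + lam * (b - bh))
    (h2 : D ^ 2 / 2 ≤ a ^ 2 + C₂ * τ ^ 2 * L * (dS + dC) ^ 2)
    (h3 : b - bh ≤ dS - dC) (h3' : dS + dC ≤ b + bh)
    (h4 : dC ≤ 3 * dS → dS ^ 2 ≤ s * γ * D ^ 2) (h5 : b ^ 2 ≤ s * γ * κ)
    (h6 : lam ^ 2 = C ^ 2 * τ ^ 2 * κ * L) (h7 : N ^ 2 ≤ A₁ / n) (h8 : 1 ≤ γ * τ ^ 2)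
    (h9 : 1 / 2 ≤ n * L) (h10 : 256 * C₂ * A₁ ≤ n) :
    D ^ 2 ≤ oracleConst C C₂ A₁ * (κ * (τ ^ 2 * L * s * γ)) ∧
      (3 * dS < dC → (dS + dC) ^ 2 ≤ oracleConst C C₂ A₁ * γ * (κ * (τ ^ 2 * L * s * γ))) := by
  set r := τ ^ 2 * L * s * γ with hr
  have hr0 : 0 < r := by positivity
  have hκ0 : 0 < κ := by linarith
  have hC0 : 0 < C := by linarith
  have hrκ : r ≤ κ * r := le_mul_of_one_le_left hr0.le hκ
  have hLr : L ≤ r := by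
    have e : r = L * (s * (γ * τ ^ 2)) := by rw [hr]; ring
    rw [e]
    exact le_mul_of_one_le_right hL.le (one_le_mul_of_one_le_of_one_le hs h8)
  -- The remainder is parametric. Since `n L ≥ 1/2` and `L ≤ r`, it is dominated by the rate.
  have hAn : A₁ / n ≤ 2 * A₁ * L := by
    rw [div_le_iff₀ hn]
    nlinarith only [mul_le_mul_of_nonneg_left h9 hA₁]
  have hNr : N ^ 2 ≤ 2 * A₁ * (κ * r) :=
    (h7.trans hAn).trans (mul_le_mul_of_nonneg_left (hLr.trans hrκ) (by positivity))
  set X := N ^ 2 / lam ^ 2 with hX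
  have hX0 : 0 ≤ X := by positivity
  have hXe : N ^ 2 = X * lam ^ 2 := by rw [hX]; field_simp
  have hCκ : 1 ≤ C ^ 2 * κ := one_le_mul_of_one_le_of_one_le (one_le_pow₀ hC) hκ
  have hXL : τ ^ 2 * L * X ≤ A₁ / n := by
    refine le_trans ?_ h7
    have e : N ^ 2 = (C ^ 2 * κ) * (τ ^ 2 * L * X) := by rw [hXe, h6]; ring
    rw [e]
    exact le_mul_of_one_le_left (by positivity) hCκ
  have hXγ : X ≤ 2 * A₁ * γ := by
    have h12 : τ ^ 2 * X ≤ 2 * A₁ := by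
      have : L * (τ ^ 2 * X) ≤ L * (2 * A₁) := by
        calc L * (τ ^ 2 * X) = τ ^ 2 * L * X := by ring
          _ ≤ 2 * A₁ * L := hXL.trans hAn
          _ = _ := by ring
      exact le_of_mul_le_mul_left this hL
    calc X ≤ (γ * τ ^ 2) * X := le_mul_of_one_le_left hX0 h8
      _ = (τ ^ 2 * X) * γ := by ring
      _ ≤ _ := by gcongr
  set T := C₂ * τ ^ 2 * L with hT
  have hT0 : 0 ≤ T := by positivity
  have hTX : T * X ≤ 1 / 256 := by
    have e1 : C₂ * (A₁ / n) ≤ 1 / 256 := by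
      rw [← mul_div_assoc, div_le_div_iff₀ hn (by norm_num)]
      linarith only [h10]
    calc T * X = C₂ * (τ ^ 2 * L * X) := by rw [hT]; ring
      _ ≤ C₂ * (A₁ / n) := by gcongr
      _ ≤ _ := e1
  -- `a N ≤ a² / 4 + N²` moves the empirical prediction error to the left.
  have h1' : a ^ 2 / 4 ≤ lam / 4 * (dS + dC) + D * N + N ^ 2 + lam * (b - bh) := by
    nlinarith only [sq_nonneg (a / 2 - N), h1]
  have hκr0 : 0 < κ * r := by positivity
  have hM : ∀ {x : ℝ}, x ≤ (400 * C ^ 2 + 1000 * A₁) * (κ * r) ∨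
      x ≤ (1000 * A₁ + 20 * (C * (128 * C₂ + 1)) + 60 * C₂) * (κ * r) →
      x ≤ oracleConst C C₂ A₁ * (κ * r) := by
    intro x hx
    unfold oracleConst
    rcases hx with hx | hx <;> refine hx.trans (mul_le_mul_of_nonneg_right ?_ hκr0.le)
    · have : 0 ≤ 20 * (C * (128 * C₂ + 1)) + 60 * C₂ + 20000 * A₁ ^ 2 := by positivity
      linarith only [this]
    · have : 0 ≤ 400 * C ^ 2 + 20000 * A₁ ^ 2 := by positivity
      linarith only [this]
  have hbb : lam * (b - bh) ≤ lam * (dS - dC) := mul_le_mul_of_nonneg_left h3 hlam.le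
  rcases le_or_gt dC (3 * dS) with hcone | hcone
  · refine ⟨hM ?_, fun h => absurd hcone (not_le.2 h)⟩
    -- On the cone the isometry defect is at most `128 C₂ r · D² / 8`; it can be absorbed precisely
    -- when this factor is at most `1`.
    rcases le_or_gt (128 * C₂ * r) 1 with hrs | hrs
    · left
      have h4' := h4 hcone
      have hdl : T * (dS + dC) ^ 2 ≤ D ^ 2 / 8 := by
        have e1 : (dS + dC) ^ 2 ≤ 16 * (s * γ * D ^ 2) := by
          calc (dS + dC) ^ 2 ≤ (4 * dS) ^ 2 := by gcongr; linarith only [hcone]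
            _ = 16 * dS ^ 2 := by ring
            _ ≤ _ := by gcongr
        calc T * (dS + dC) ^ 2 ≤ T * (16 * (s * γ * D ^ 2)) := by gcongr
          _ = (128 * C₂ * r) * (D ^ 2 / 8) := by rw [hT, hr]; ring
          _ ≤ 1 * (D ^ 2 / 8) := by gcongr
          _ = _ := one_mul _
      have ha : a ^ 2 ≤ 5 * (lam * dS) + 4 * (D * N) + 4 * N ^ 2 := by
        nlinarith only [mul_nonneg hlam.le hdC, h1', hbb]
      have hu : (lam * dS) ^ 2 ≤ C ^ 2 * (κ * r) * D ^ 2 := by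
        rw [mul_pow, h6]
        calc C ^ 2 * τ ^ 2 * κ * L * dS ^ 2 ≤ C ^ 2 * τ ^ 2 * κ * L * (s * γ * D ^ 2) := by gcongr
          _ = _ := by rw [hr]; ring
      have := oracle_fast (by positivity) hu ha (h2.trans (by linarith only [hdl]))
      nlinarith only [this, hNr, mul_nonneg hA₁ hκr0.le]
    -- Here `1 < 128 C₂ r`, so `r ≤ 128 C₂ r²`: the slow rate, of order `√r`, is already of order
    -- `r`.
    · right
      obtain ⟨ha, hdl⟩ := sq_mixed_le_slow hD hN hlam hb (add_nonneg hdS hdC) hXe h1' h3'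
      have ha' : a ^ 2 ≤ 5 * (lam * b) + 4 * (D * N) + 4 * N ^ 2 := by
        linarith only [ha, mul_nonneg hlam.le hbh]
      have := oracle_slow hT0 hTX ha' h2 hdl
      have hv : lam * b ≤ C * (128 * C₂ + 1) * (κ * r) := by
        refine (le_abs_self _).trans (abs_le_of_sq_le_sq ?_ (by positivity))
        calc (lam * b) ^ 2 = lam ^ 2 * b ^ 2 := by ring
          _ ≤ lam ^ 2 * (s * γ * κ) := by gcongr
          _ = C ^ 2 * κ ^ 2 * r * 1 := by rw [h6, hr]; ring
          _ ≤ C ^ 2 * κ ^ 2 * r * (128 * C₂ * r) := by gcongr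
          _ = C ^ 2 * (128 * C₂) * (κ * r) ^ 2 := by ring
          _ ≤ C ^ 2 * (128 * C₂ + 1) ^ 2 * (κ * r) ^ 2 := by
            gcongr
            nlinarith only [hC₂, sq_nonneg C₂]
          _ = _ := by ring
      have hTb : T * b ^ 2 ≤ C₂ * (κ * r) := by
        calc T * b ^ 2 ≤ T * (s * γ * κ) := by gcongr
          _ = _ := by rw [hT, hr]; ring
      nlinarith only [this, hv, hTb, hNr, mul_nonneg hA₁ hκr0.le]
  -- `3 dS < dC` is what makes `(dS + dC) / 4 + dS - dC` smaller than `-(dS + dC) / 4`.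
  · have h1o : a ^ 2 / 4 + lam * (dS + dC) / 4 ≤ D * N + N ^ 2 := by
      nlinarith only [h1', hbb, mul_pos hlam (sub_pos.2 hcone), mul_nonneg hlam.le hdC]
    obtain ⟨e1, e2⟩ := oracle_off_cone hlam (add_nonneg hdS hdC) hT0 hXe hTX h1o h2
    refine ⟨hM (Or.inl ?_), fun _ => ?_⟩
    · nlinarith only [e1, hNr, mul_nonneg hA₁ hκr0.le, mul_nonneg (sq_nonneg C) hκr0.le]
    · calc (dS + dC) ^ 2 ≤ 4672 * N ^ 2 * X := e2
        _ ≤ 4672 * (2 * A₁ * (κ * r)) * (2 * A₁ * γ) := by gcongr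
        _ = 18688 * A₁ ^ 2 * γ * (κ * r) := by ring
        _ ≤ _ := by
          refine mul_le_mul_of_nonneg_right (mul_le_mul_of_nonneg_right ?_ hγ.le) hκr0.le
          unfold oracleConst
          have : 0 ≤ 400 * C ^ 2 + 1000 * A₁ + 20 * (C * (128 * C₂ + 1)) + 60 * C₂
            + 1312 * A₁ ^ 2 := by positivity
          linarith only [this]

/-! ### Consequences for a good sample -/

lemma basic_inequality {n p r : ℕ} {Y : Matrix (Fin n) (Fin r) ℝ} {X : Matrix (Fin n) (Fin p) ℝ}
    {lam : ℝ} (B Bh : Matrix (Fin p) (Fin r) ℝ) (h : objective Y X lam Bh ≤ objective Y X lam B) :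
    frobSq (X * (Bh - B)) / n / 2
      ≤ (∑ l, ∑ i, (Y - X * B) i l * (X * (Bh - B)) i l) / n + lam * (norm12 B - norm12 Bh) := by
  have e : frobSq (Y - X * Bh) = frobSq (Y - X * B)
      - 2 * ∑ l, ∑ i, (Y - X * B) i l * (X * (Bh - B)) i l + frobSq (X * (Bh - B)) := by
    rw [Finset.sum_comm]
    simp only [frobSq, Finset.mul_sum, ← Finset.sum_sub_distrib, ← Finset.sum_add_distrib]
    refine Finset.sum_congr rfl fun i _ => Finset.sum_congr rfl fun l _ => ?_
    have : X * Bh = X * B + X * (Bh - B) := by rw [← Matrix.mul_add, add_sub_cancel]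
    rw [this]
    simp only [Matrix.sub_apply, Matrix.add_apply]
    ring
  simp only [objective, e] at h
  have e2 : ∀ x : ℝ, (2 * (n : ℝ))⁻¹ * x = x / n / 2 := fun x => by
    rw [mul_inv]; ring
  rw [e2, e2] at h
  have e3 : ∀ u v w : ℝ, (u - 2 * v + w) / n / 2 = u / n / 2 - v / n + w / n / 2 := fun u v w => by
    ring
  rw [e3] at h
  linarith

section Good

variable {p K n : ℕ} {prior : Fin K → ℝ} {mean : Fin K → EuclideanSpace ℝ (Fin p)}
  {SW : Matrix (Fin p) (Fin p) ℝ} {piMin A B : ℝ} {p₀ : ℕ}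
  {y : Fin n → EuclideanSpace ℝ (Fin p) × Fin K}

/-- The vector of sample means. -/
noncomputable def sampleMean (y : Fin n → EuclideanSpace ℝ (Fin p) × Fin K) (j : Fin p) : ℝ :=
  (∑ i, (y i).1 j) / n

/-- The data matrix, from which `c` times the column means are subtracted. -/
noncomputable def design (c : ℝ) (y : Fin n → EuclideanSpace ℝ (Fin p) × Fin K) :
    Matrix (Fin n) (Fin p) ℝ :=
  Matrix.of fun i j => (y i).1 j - c * sampleMean y j

lemma sum_linFun_eq (hn : 0 < n) (v : Fin p → ℝ) :
    ∑ i, linFun v (y i).1 = n * (sampleMean y ⬝ᵥ v) := by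
  have hn' : (n : ℝ) ≠ 0 := by positivity
  simp only [linFun_apply, dotProduct, sampleMean, Finset.mul_sum]
  rw [Finset.sum_comm]
  refine Finset.sum_congr rfl fun j _ => ?_
  rw [← Finset.mul_sum]
  field_simp

lemma design_mul_apply {r : ℕ} (c : ℝ) (M : Matrix (Fin p) (Fin r) ℝ) (i : Fin n) (l : Fin r) :
    (design c y * M) i l = linFun (M.col l) (y i).1 - c * (sampleMean y ⬝ᵥ M.col l) := by
  simp only [Matrix.mul_apply, design, Matrix.of_apply, linFun_apply, dotProduct, Matrix.col_apply,
    Finset.mul_sum, ← Finset.sum_sub_distrib]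
  exact Finset.sum_congr rfl fun j _ => by ring

/-- Either nothing is subtracted or the columns are centred. This removes the constant that centring
adds to the regression error and so treats both designs at once. -/
lemma mul_sum_design_mul (hn : 0 < n) {r : ℕ} {c : ℝ} (hc : c = 0 ∨ c = 1)
    (M : Matrix (Fin p) (Fin r) ℝ) (l : Fin r) : c * ∑ i, (design c y * M) i l = 0 := by
  simp only [design_mul_apply, Finset.sum_sub_distrib, sum_linFun_eq hn]
  rcases hc with rfl | rfl <;> simp

lemma response_apply (z : Fin n → Fin K) (i : Fin n) (l : Fin (K - 1)) :
    response z i l = scores z (z i) l := by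
  simp [response, indicatorMatrix, Matrix.mul_apply]

namespace IsGoodSample

variable (g : IsGoodSample prior mean SW piMin A B p₀ y)
include g

lemma abs_sampleMean_dotProduct_le (hn : 0 < n) (v : Fin p → ℝ) :
    |sampleMean y ⬝ᵥ v| ≤ B * tau mean SW * √(Real.log p / n) * ∑ j, |v j| := by
  have hn' : (0 : ℝ) < n := by positivity
  rw [dotProduct, Finset.mul_sum]
  refine (Finset.abs_sum_le_sum_abs _ _).trans (Finset.sum_le_sum fun j _ => ?_)
  rw [abs_mul]
  gcongr
  rw [sampleMean, abs_div, abs_of_pos hn', div_le_iff₀ hn', mul_comm]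
  exact g.feature_sum j

lemma abs_classSize_div_sub_le (hn : 0 < n) (hA : 0 ≤ A) (k : Fin K) :
    |classSize (fun i => (y i).2) k / n - prior k| ≤ √(A / n) := by
  have hn' : (0 : ℝ) < n := by positivity
  have h1 := g.classFreq k
  have e : ∑ i, ((if (y i).2 = k then (1 : ℝ) else 0) - prior k)
      = classSize (fun i => (y i).2) k - n * prior k := by
    simp [classSize, Finset.sum_sub_distrib]
  rw [e] at h1
  have e2 : √(A / n) = √(A * n) / n := by
    rw [eq_div_iff hn'.ne', ← Real.sqrt_sq hn'.le, ← Real.sqrt_mul (by positivity),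
      Real.sqrt_sq hn'.le]
    congr 1
    field_simp
  rw [e2, le_div_iff₀ hn']
  refine le_of_eq_of_le ?_ h1
  conv_lhs => rw [← abs_of_pos hn', ← abs_mul]
  congr 1
  rw [abs_of_pos hn']
  field_simp

/-- The sample scores are close to the population scores. -/
lemma abs_scores_sub_le (h : IsPopulation prior mean SW piMin) (hn : 0 < n) (hA : 0 ≤ A)
    (hnA : 4 * A ≤ n * piMin ^ 2) (k : Fin K) (l : Fin (K - 1)) :
    |scores (fun i => (y i).2) k l - scoreFun prior l k|
      ≤ 3 * (K * √(A / n)) / (piMin / 2) ^ 5 := by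
  have hn' : (0 : ℝ) < n := by positivity
  have hpi := h.piMin_pos
  rw [scores_eq_scoreFun hn]
  -- Keeps all class frequencies above `piMin / 2`, where the scores are Lipschitz.
  have hsmall : √(A / n) ≤ piMin / 2 := by
    rw [Real.sqrt_le_left (by positivity), div_le_iff₀ hn']
    linarith
  refine abs_scoreFun_sub_le (by positivity) (Real.sqrt_nonneg _) (fun k => ?_) (fun k => ?_) ?_
    h.sum_prior (fun k => g.abs_classSize_div_sub_le hn hA k) l k
  · have h1 := abs_le.1 (g.abs_classSize_div_sub_le hn hA k)
    have h2 := h.piMin_le k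
    linarith [h1.1]
  · have h2 := h.piMin_le k
    linarith
  · rw [← Finset.sum_div, div_eq_one_iff_eq hn'.ne']
    simp only [classSize]
    have := Finset.card_eq_sum_card_fiberwise (s := (Finset.univ : Finset (Fin n)))
      (t := (Finset.univ : Finset (Fin K))) (f := fun i => (y i).2) (by simp)
    rw [Finset.card_univ, Fintype.card_fin] at this
    exact_mod_cast this.symm

/-- Lower bound for the prediction error of a matrix. -/
lemma frobSq_design_ge (h : IsPopulation prior mean SW piMin) (hn : 0 < n) {c : ℝ}
    (hc : c = 0 ∨ c = 1) (M : Matrix (Fin p) (Fin (K - 1)) ℝ) :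
    frobSq (CFC.sqrt (totalCov prior mean SW) * M) / 2
      ≤ frobSq (design c y * M) / n
        + (589824 / piMin ^ 2 + B ^ 2) / piMin * tau mean SW ^ 2 * (Real.log p / n)
          * norm12 M ^ 2 := by
  have hn' : (0 : ℝ) < n := by positivity
  have hpi := h.piMin_pos
  have hτ := h.tau_pos
  have hl := h.log_p_pos
  set L := Real.log p / n with hL
  have hL0 : 0 ≤ L := by positivity
  have hcol : ∀ l, M.col l ⬝ᵥ totalCov prior mean SW *ᵥ M.col l / 2
      ≤ (∑ i, (design c y * M) i l ^ 2) / n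
        + (589824 / piMin ^ 2 + B ^ 2) * tau mean SW ^ 2 * L * norm12 M ^ 2 := fun l => by
    have h1 := g.isometry (M.col l)
    have h2 := g.abs_sampleMean_dotProduct_le hn (M.col l)
    -- Centring loses at most the squared sample mean of the functional, which has the same order
    -- `τ² (log p / n) ‖v‖₁²` as the isometry defect.
    have h3 : ∑ i, linFun (M.col l) (y i).1 ^ 2
        ≤ ∑ i, (design c y * M) i l ^ 2 + n * (sampleMean y ⬝ᵥ M.col l) ^ 2 := by
      simp only [design_mul_apply, sub_sq, Finset.sum_add_distrib, Finset.sum_sub_distrib,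
        ← Finset.sum_mul, ← Finset.mul_sum, sum_linFun_eq hn, Finset.sum_const, Finset.card_univ,
        Fintype.card_fin, nsmul_eq_mul]
      rcases hc with rfl | rfl
      · have := mul_nonneg hn'.le (sq_nonneg (sampleMean y ⬝ᵥ M.col l))
        nlinarith
      · nlinarith
    have h4 : (∑ i, linFun (M.col l) (y i).1 ^ 2) / n
        ≤ (∑ i, (design c y * M) i l ^ 2) / n + (sampleMean y ⬝ᵥ M.col l) ^ 2 := by
      rw [div_add' _ _ _ hn'.ne']
      gcongr
      linarith
    have h5 : (sampleMean y ⬝ᵥ M.col l) ^ 2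
        ≤ B ^ 2 * tau mean SW ^ 2 * L * (∑ j, |M.col l j|) ^ 2 := by
      calc (sampleMean y ⬝ᵥ M.col l) ^ 2 = |sampleMean y ⬝ᵥ M.col l| ^ 2 := (sq_abs _).symm
        _ ≤ (B * tau mean SW * √L * ∑ j, |M.col l j|) ^ 2 := by gcongr
        _ = _ := by rw [mul_pow, mul_pow, mul_pow, Real.sq_sqrt hL0]
    have h6 : ∑ j, |M.col l j| ≤ norm12 M := Finset.sum_le_sum fun j _ => abs_le_rowNorm M j l
    have h7 : (∑ j, |M.col l j|) ^ 2 ≤ norm12 M ^ 2 := by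
      have : 0 ≤ ∑ j, |M.col l j| := Finset.sum_nonneg fun j _ => abs_nonneg _
      gcongr
    have h8 : (589824 / piMin ^ 2 + B ^ 2) * tau mean SW ^ 2 * L * (∑ j, |M.col l j|) ^ 2
        ≤ (589824 / piMin ^ 2 + B ^ 2) * tau mean SW ^ 2 * L * norm12 M ^ 2 := by gcongr
    linarith
  have hK : ((K - 1 : ℕ) : ℝ) ≤ 1 / piMin :=
    le_trans (by exact_mod_cast Nat.sub_le _ _) h.card_le
  rw [frobSq_mul_eq_sum, IsPopulation.sqrt_totalCov_transpose, h.sqrt_totalCov_mul_self, Finset.sum_div]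
  refine (Finset.sum_le_sum fun l _ => hcol l).trans ?_
  rw [Finset.sum_add_distrib, ← Finset.sum_div, Finset.sum_comm]
  refine add_le_add le_rfl ?_
  rw [Finset.sum_const, Finset.card_univ, Fintype.card_fin, nsmul_eq_mul]
  calc ((K - 1 : ℕ) : ℝ) * ((589824 / piMin ^ 2 + B ^ 2) * tau mean SW ^ 2 * L * norm12 M ^ 2)
      ≤ 1 / piMin * ((589824 / piMin ^ 2 + B ^ 2) * tau mean SW ^ 2 * L * norm12 M ^ 2) := by gcongr
    _ = _ := by ring

/-- Bound for the main part of the noise. -/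
lemma sum_residual_mul_linFun_le (h : IsPopulation prior mean SW piMin) (hn : 0 < n) (hA : 0 ≤ A)
    (M : Matrix (Fin p) (Fin (K - 1)) ℝ) :
    (∑ l, ∑ i, residual prior mean SW l (y i) * linFun (M.col l) (y i).1) / n
      ≤ 200 * tau mean SW * √(Real.log p / n) * (√(K - 1 : ℕ) * norm12 M)
        + √(frobSq (CFC.sqrt (totalCov prior mean SW) * M)) * √(p₀ * A / piMin / n) := by
  have hn' : (0 : ℝ) < n := by positivity
  have hpi := h.piMin_pos
  have hτ := h.tau_pos
  have hM := norm12_nonneg M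
  have hK : ((K - 1 : ℕ) : ℝ) ≤ 1 / piMin :=
    le_trans (by exact_mod_cast Nat.sub_le _ _) h.card_le
  rcases g.noise with hcase | ⟨hp, hcase⟩
  · have h1 : ∑ l, ∑ i, residual prior mean SW l (y i) * linFun (M.col l) (y i).1
        = ∑ j, ∑ l, M j l * ∑ i, (y i).1 j * residual prior mean SW l (y i) := by
      rw [Finset.sum_comm (γ := Fin p)]
      refine Finset.sum_congr rfl fun l _ => ?_
      simp only [linFun_apply, Finset.mul_sum]
      rw [Finset.sum_comm]
      exact Finset.sum_congr rfl fun j _ => Finset.sum_congr rfl fun i _ => by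
        rw [Matrix.col_apply]; ring
    have h2 : ∑ l, ∑ i, residual prior mean SW l (y i) * linFun (M.col l) (y i).1
        ≤ n * (200 * tau mean SW * √(Real.log p / n)) * ∑ j, ∑ l, |M j l| := by
      rw [h1, Finset.mul_sum]
      refine Finset.sum_le_sum fun j _ => ?_
      rw [Finset.mul_sum]
      refine Finset.sum_le_sum fun l _ => ?_
      refine (le_abs_self _).trans ?_
      rw [abs_mul, mul_comm]
      gcongr
      exact hcase j l
    have h3 := sum_abs_le_sqrt_mul_norm12 M
    have h4 : 0 ≤ √(frobSq (CFC.sqrt (totalCov prior mean SW) * M)) * √(p₀ * A / piMin / n) := by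
      positivity
    refine le_trans ?_ (le_add_of_nonneg_right h4)
    rw [div_le_iff₀ hn']
    refine h2.trans ?_
    have : n * (200 * tau mean SW * √(Real.log p / n)) * ∑ j, ∑ l, |M j l|
        ≤ n * (200 * tau mean SW * √(Real.log p / n)) * (√(K - 1 : ℕ) * norm12 M) := by gcongr
    linarith
  · set R := CFC.sqrt (totalCov prior mean SW) with hR
    have hu : IsUnit R.det := h.isUnit_det_sqrt_totalCov
    have hRT : Rᵀ = R := IsPopulation.sqrt_totalCov_transpose
    set ξ : Fin p → Fin (K - 1) → ℝ := fun j l =>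
      ∑ i, linFun (whiteningRow prior mean SW j) (y i).1 * residual prior mean SW l (y i) with hξ
    -- Duality `vᵀx = (R v)ᵀ(R⁻¹ x)`, so that Cauchy–Schwarz yields the `Σ_T`-norm of `M`.
    have hlin : ∀ (l : Fin (K - 1)) (x : EuclideanSpace ℝ (Fin p)), linFun (M.col l) x
        = ∑ j, (R * M) j l * linFun (whiteningRow prior mean SW j) x := fun l x => by
      have e1 : ∀ v : Fin p → ℝ, linFun v x = x.ofLp ⬝ᵥ v := fun v => by
        rw [linFun_apply, dotProduct]; exact Finset.sum_congr rfl fun _ _ => mul_comm _ _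
      have e2 : ∀ j, linFun (whiteningRow prior mean SW j) x = (R⁻¹ *ᵥ x.ofLp) j := fun j => by
        rw [linFun_apply]; rfl
      have e3 : (fun j => (R * M) j l) = R *ᵥ M.col l := by
        ext j; simp [Matrix.mul_apply, Matrix.mulVec, dotProduct]
      simp only [e2]
      change _ = (fun j => (R * M) j l) ⬝ᵥ (R⁻¹ *ᵥ x.ofLp)
      rw [e1, e3, Matrix.dotProduct_mulVec, ← Matrix.mulVec_transpose,
        Matrix.transpose_nonsing_inv, hRT, Matrix.mulVec_mulVec, Matrix.nonsing_inv_mul _ hu,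
        Matrix.one_mulVec, dotProduct_comm]
    have h1 : ∑ l, ∑ i, residual prior mean SW l (y i) * linFun (M.col l) (y i).1
        = ∑ jl : Fin p × Fin (K - 1), (R * M) jl.1 jl.2 * ξ jl.1 jl.2 := by
      rw [Fintype.sum_prod_type, Finset.sum_comm (γ := Fin p)]
      refine Finset.sum_congr rfl fun l _ => ?_
      simp only [hlin, hξ, Finset.mul_sum]
      rw [Finset.sum_comm]
      exact Finset.sum_congr rfl fun j _ => Finset.sum_congr rfl fun i _ => by ring
    have h2 : ∑ jl : Fin p × Fin (K - 1), (R * M) jl.1 jl.2 * ξ jl.1 jl.2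
        ≤ √(frobSq (R * M)) * √(p * (K - 1 : ℕ) * (A * n)) := by
      refine (Real.sum_mul_le_sqrt_mul_sqrt _ _ _).trans ?_
      rw [Fintype.sum_prod_type]
      change √(frobSq (R * M)) * _ ≤ _
      gcongr
      calc ∑ jl : Fin p × Fin (K - 1), ξ jl.1 jl.2 ^ 2
          ≤ ∑ _jl : Fin p × Fin (K - 1), A * n := by
            refine Finset.sum_le_sum fun jl _ => ?_
            rw [← sq_abs, ← Real.sq_sqrt (show 0 ≤ A * n by positivity)]
            gcongr
            exact hcase jl.1 jl.2
        _ = _ := by simp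
    have h3 : √(p * (K - 1 : ℕ) * (A * n)) / n ≤ √(p₀ * A / piMin / n) := by
      apply Real.le_sqrt_of_sq_le
      rw [div_pow, Real.sq_sqrt (by positivity), div_le_iff₀ (by positivity)]
      have hp' : (p : ℝ) ≤ p₀ := by exact_mod_cast hp.le
      calc p * (K - 1 : ℕ) * (A * n) ≤ p₀ * (1 / piMin) * (A * n) := by gcongr
        _ = _ := by field_simp
    have h4 : 0 ≤ 200 * tau mean SW * √(Real.log p / n) * (√(K - 1 : ℕ) * norm12 M) := by
      positivity
    rw [h1]
    calc _ ≤ √(frobSq (R * M)) * √(p * (K - 1 : ℕ) * (A * n)) / n := by gcongr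
      _ = √(frobSq (R * M)) * (√(p * (K - 1 : ℕ) * (A * n)) / n) := by ring
      _ ≤ √(frobSq (R * M)) * √(p₀ * A / piMin / n) := by gcongr
      _ ≤ _ := by linarith

end IsGoodSample

/-- The constant that bounds the squared norm of the remainder of the noise, times `n`. -/
noncomputable def remainderConst (piMin A : ℝ) (p₀ : ℕ) : ℝ :=
  p₀ * A / piMin + 9 * A / piMin ^ 3 / (piMin / 2) ^ 10

namespace IsGoodSample

variable (g : IsGoodSample prior mean SW piMin A B p₀ y)
include g

/-- Bound for the noise. -/
lemma noise_le (h : IsPopulation prior mean SW piMin) (hn : 0 < n) (hA : 0 ≤ A) (hB : 0 ≤ B)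
    (hnA : 4 * A ≤ n * piMin ^ 2) (hBA : B ^ 2 * A ≤ 40000 * n) {c : ℝ} (hc : c = 0 ∨ c = 1)
    (M : Matrix (Fin p) (Fin (K - 1)) ℝ) :
    (∑ l, ∑ i, (response (fun i => (y i).2) - design c y * Bstar prior mean SW) i l
        * (design c y * M) i l) / n
      ≤ 400 * tau mean SW * √(Real.log p / n) * (√(K - 1 : ℕ) * norm12 M)
        + (√(frobSq (CFC.sqrt (totalCov prior mean SW) * M)) + √(frobSq (design c y * M) / n))
          * √(remainderConst piMin A p₀ / n) := by
  have hn' : (0 : ℝ) < n := by positivity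
  have hpi := h.piMin_pos
  have hτ := h.tau_pos
  have hMn := norm12_nonneg M
  have hK : ((K - 1 : ℕ) : ℝ) ≤ 1 / piMin :=
    le_trans (by exact_mod_cast Nat.sub_le _ _) h.card_le
  set d : Fin n → Fin (K - 1) → ℝ := fun i l =>
    scores (fun i => (y i).2) (y i).2 l - scoreFun prior l (y i).2 with hd
  set U := design c y * M with hU
  -- Three parts of the error: the population residual, the error `d` of the sample scores, and a
  -- constant from centring, which is orthogonal to the centred design.
  have hE : ∀ i l, (response (fun i => (y i).2) - design c y * Bstar prior mean SW) i l
      = residual prior mean SW l (y i) + d i l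
        + c * (sampleMean y ⬝ᵥ (Bstar prior mean SW).col l) := fun i l => by
    rw [Matrix.sub_apply, response_apply, design_mul_apply, residual, affFun, hd]
    have : linFun (-(Bstar prior mean SW).col l) (y i).1
        = -linFun ((Bstar prior mean SW).col l) (y i).1 := by simp [linFun_apply]
    rw [this]
    ring
  have hsplit : ∑ l, ∑ i, (response (fun i => (y i).2) - design c y * Bstar prior mean SW) i l
        * U i l
      = ∑ l, ∑ i, residual prior mean SW l (y i) * linFun (M.col l) (y i).1
        - ∑ l, c * (sampleMean y ⬝ᵥ M.col l) * ∑ i, residual prior mean SW l (y i)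
        + ∑ l, ∑ i, d i l * U i l := by
    rw [← Finset.sum_sub_distrib, ← Finset.sum_add_distrib]
    refine Finset.sum_congr rfl fun l _ => ?_
    have h0 := mul_sum_design_mul (y := y) hn hc M l
    have e1 : ∑ i, c * (sampleMean y ⬝ᵥ (Bstar prior mean SW).col l) * U i l = 0 := by
      rw [← Finset.mul_sum, mul_right_comm, h0, zero_mul]
    simp only [hE, add_mul, Finset.sum_add_distrib, e1, add_zero]
    congr 1
    rw [Finset.mul_sum, ← Finset.sum_sub_distrib]
    refine Finset.sum_congr rfl fun i _ => ?_
    rw [hU, design_mul_apply]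
    ring
  have hmain := g.sum_residual_mul_linFun_le h hn hA M
  -- A product of two small averages. `B ^ 2 * A ≤ 40000 * n` reduces it to the size of the main
  -- noise term.
  have hcenter : (-∑ l, c * (sampleMean y ⬝ᵥ M.col l) * ∑ i, residual prior mean SW l (y i)) / n
      ≤ 200 * tau mean SW * √(Real.log p / n) * (√(K - 1 : ℕ) * norm12 M) := by
    have h1 : ∀ l, -(c * (sampleMean y ⬝ᵥ M.col l) * ∑ i, residual prior mean SW l (y i))
        ≤ B * tau mean SW * √(Real.log p / n) * √(A * n) * ∑ j, |M j l| := fun l => by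
      refine (neg_le_abs _).trans ?_
      rw [abs_mul, abs_mul]
      have hc1 : |c| ≤ 1 := by rcases hc with rfl | rfl <;> simp
      have h2 := g.abs_sampleMean_dotProduct_le hn (M.col l)
      have h3 := g.residual_sum l
      calc |c| * |sampleMean y ⬝ᵥ M.col l| * |∑ i, residual prior mean SW l (y i)|
          ≤ 1 * (B * tau mean SW * √(Real.log p / n) * ∑ j, |M.col l j|) * √(A * n) := by gcongr
        _ = _ := by simp only [Matrix.col_apply]; ring
    have h2 : B * √(A * n) ≤ 200 * n := by
      refine (le_abs_self _).trans (abs_le_of_sq_le_sq ?_ (by positivity))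
      rw [mul_pow, Real.sq_sqrt (by positivity)]
      nlinarith
    rw [div_le_iff₀ hn', ← Finset.sum_neg_distrib]
    calc _ ≤ ∑ l, B * tau mean SW * √(Real.log p / n) * √(A * n) * ∑ j, |M j l| :=
          Finset.sum_le_sum fun l _ => h1 l
      _ = (B * √(A * n)) * (tau mean SW * √(Real.log p / n)) * ∑ j, ∑ l, |M j l| := by
          rw [← Finset.mul_sum, Finset.sum_comm (γ := Fin p)]; ring
      _ ≤ (200 * n) * (tau mean SW * √(Real.log p / n)) * (√(K - 1 : ℕ) * norm12 M) := by
          have := sum_abs_le_sqrt_mul_norm12 M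
          gcongr
      _ = _ := by ring
  -- The score errors depend on the whole sample, so they are handled by Cauchy–Schwarz; this
  -- produces the empirical prediction error in the bound.
  have hscore : (∑ l, ∑ i, d i l * U i l) / n
      ≤ √(frobSq U / n) * √(9 * A / piMin ^ 3 / (piMin / 2) ^ 10 / n) := by
    have h1 : ∑ l, ∑ i, d i l * U i l
        ≤ √(∑ q : Fin n × Fin (K - 1), d q.1 q.2 ^ 2) * √(frobSq U) := by
      have e : ∑ l, ∑ i, d i l * U i l = ∑ q : Fin n × Fin (K - 1), d q.1 q.2 * U q.1 q.2 := by
        rw [Fintype.sum_prod_type, Finset.sum_comm]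
      have e2 : frobSq U = ∑ q : Fin n × Fin (K - 1), U q.1 q.2 ^ 2 := by
        rw [Fintype.sum_prod_type]; rfl
      rw [e, e2]
      exact Real.sum_mul_le_sqrt_mul_sqrt _ _ _
    have h2 : ∑ q : Fin n × Fin (K - 1), d q.1 q.2 ^ 2
        ≤ 9 * A / piMin ^ 3 / (piMin / 2) ^ 10 := by
      have hb : ∀ q : Fin n × Fin (K - 1), d q.1 q.2 ^ 2
          ≤ 9 * (1 / piMin) ^ 2 * (A / n) / (piMin / 2) ^ 10 := fun q => by
        have hq := g.abs_scores_sub_le h hn hA hnA (y q.1).2 q.2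
        have hK' := h.card_le
        calc d q.1 q.2 ^ 2 = |d q.1 q.2| ^ 2 := (sq_abs _).symm
          _ ≤ (3 * (K * √(A / n)) / (piMin / 2) ^ 5) ^ 2 := by gcongr
          _ ≤ (3 * (1 / piMin * √(A / n)) / (piMin / 2) ^ 5) ^ 2 := by gcongr
          _ = _ := by
            rw [div_pow, mul_pow, mul_pow, Real.sq_sqrt (by positivity), ← pow_mul]; ring
      calc _ ≤ ∑ _q : Fin n × Fin (K - 1), 9 * (1 / piMin) ^ 2 * (A / n) / (piMin / 2) ^ 10 :=
            Finset.sum_le_sum fun q _ => hb q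
        _ = (K - 1 : ℕ) * (9 * (1 / piMin) ^ 2 * A / (piMin / 2) ^ 10) := by
            rw [Finset.sum_const, Finset.card_univ, Fintype.card_prod, Fintype.card_fin,
              Fintype.card_fin, nsmul_eq_mul, Nat.cast_mul]
            field_simp
        _ ≤ 1 / piMin * (9 * (1 / piMin) ^ 2 * A / (piMin / 2) ^ 10) := by gcongr
        _ = _ := by ring
    have h3 : ∀ u v : ℝ, 0 ≤ u → 0 ≤ v → √u * √v / n = √(v / n) * √(u / n) := fun u v hu hv => by
      rw [Real.sqrt_div hv, Real.sqrt_div hu, div_mul_div_comm, Real.mul_self_sqrt hn'.le, mul_comm]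
    rw [← h3 _ _ (by positivity) (frobSq_nonneg U)]
    gcongr
    exact h1.trans (by gcongr)
  have hr1 : √(p₀ * A / piMin / n) ≤ √(remainderConst piMin A p₀ / n) := by
    refine Real.sqrt_le_sqrt (div_le_div_of_nonneg_right ?_ hn'.le)
    exact le_add_of_nonneg_right (by positivity)
  have hr2 : √(9 * A / piMin ^ 3 / (piMin / 2) ^ 10 / n) ≤ √(remainderConst piMin A p₀ / n) := by
    refine Real.sqrt_le_sqrt (div_le_div_of_nonneg_right ?_ hn'.le)
    exact le_add_of_nonneg_left (by positivity)
  rw [hsplit, add_div, sub_div]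
  rw [neg_div] at hcenter
  have f1 : √(frobSq (CFC.sqrt (totalCov prior mean SW) * M)) * √(p₀ * A / piMin / n)
      ≤ √(frobSq (CFC.sqrt (totalCov prior mean SW) * M)) * √(remainderConst piMin A p₀ / n) := by
    gcongr
  have f2 : √(frobSq U / n) * √(9 * A / piMin ^ 3 / (piMin / 2) ^ 10 / n)
      ≤ √(frobSq U / n) * √(remainderConst piMin A p₀ / n) := by gcongr
  linarith

end IsGoodSample

end Good

/-! ### Error bounds for the estimator -/

section Estimator

variable {p K n s : ℕ} {prior : Fin K → ℝ} {mean : Fin K → EuclideanSpace ℝ (Fin p)}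
  {SW : Matrix (Fin p) (Fin p) ℝ} {piMin A B γ : ℝ} {p₀ : ℕ}
  {y : Fin n → EuclideanSpace ℝ (Fin p) × Fin K}

lemma diag_le_lambdaMax {q : ℕ} {T : Matrix (Fin q) (Fin q) ℝ} (hT : T.IsHermitian) (j : Fin q) :
    T j j ≤ lambdaMax T := by
  have hfin : BddAbove (spectrum ℝ T) := T.finite_real_spectrum.bddAbove
  have h1 : T ≤ algebraMap ℝ _ (lambdaMax T) :=
    le_algebraMap_of_spectrum_le (fun x hx => le_csSup hfin hx) hT
  have h2 := (Matrix.le_iff.1 h1).diag_nonneg (i := j)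
  simp [Matrix.algebraMap_matrix_apply] at h2
  exact h2

namespace IsPopulation

variable (h : IsPopulation prior mean SW piMin)
include h

lemma frobSq_sqrt_mul (M : Matrix (Fin p) (Fin (K - 1)) ℝ) :
    frobSq (CFC.sqrt (totalCov prior mean SW) * M)
      = ∑ l, M.col l ⬝ᵥ totalCov prior mean SW *ᵥ M.col l := by
  rw [frobSq_mul_eq_sum, sqrt_totalCov_transpose, h.sqrt_totalCov_mul_self]

lemma cast_K_sub_one : ((K - 1 : ℕ) : ℝ) = K - 1 := by
  have := h.two_le_K
  rw [Nat.cast_sub (by omega)]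
  simp

lemma one_le_K_sub_one : (1 : ℝ) ≤ K - 1 := by
  have : (2 : ℝ) ≤ K := by exact_mod_cast h.two_le_K
  linarith

/-- The restricted eigenvalue condition bounds the diagonal of the covariance matrix below. -/
lemma one_div_le_diag (hs : 1 ≤ s)
    (hRE : GroupRE s 3 K (CFC.sqrt (totalCov prior mean SW)) γ) (j : Fin p) :
    1 / γ ≤ totalCov prior mean SW j j := by
  have hK := h.two_le_K
  set l₀ : Fin (K - 1) := ⟨0, by omega⟩
  have hrow : ∀ i, rowNorm (Matrix.single j l₀ (1 : ℝ)) i = if i = j then 1 else 0 := fun i => by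
    split_ifs with hi
    · subst hi
      simp [rowNorm, Matrix.single_apply]
    · simp [rowNorm, Ne.symm hi]
  have h1 := hRE.2 {j} (by simpa using hs) (Matrix.single j l₀ 1) (by
    rw [norm12_rowRestrict, norm12_rowRestrict, Finset.sum_eq_zero fun i hi => ?_]
    · rw [Finset.sum_singleton, hrow]; simp
    · rw [hrow, if_neg (by simpa using hi)])
  rw [frobSq_rowRestrict, Finset.sum_singleton, hrow, h.frobSq_sqrt_mul] at h1
  simp only [if_true, one_pow] at h1
  refine h1.trans (le_of_eq ?_)
  rw [Finset.sum_eq_single l₀]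
  · have : (Matrix.single j l₀ (1 : ℝ)).col l₀ = Pi.single j 1 := by
      ext i; simp [Matrix.single_apply, Pi.single_apply, eq_comm]
    rw [this]
    simp
  · intro l _ hl
    have : (Matrix.single j l₀ (1 : ℝ)).col l = 0 := by
      ext i; simp [Ne.symm hl]
    simp [this]
  · simp

/-- Makes `log p / n` at most the rate `r`, so that the parametric remainder is negligible. -/
lemma one_le_gamma_mul_tau_sq (hs : 1 ≤ s)
    (hRE : GroupRE s 3 K (CFC.sqrt (totalCov prior mean SW)) γ) : 1 ≤ γ * tau mean SW ^ 2 := by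
  have hp : 0 < p := by have := h.two_le_p; omega
  have h1 := (h.one_div_le_diag hs hRE ⟨0, hp⟩).trans (h.totalCov_diag_le _)
  rwa [div_le_iff₀ hRE.1, mul_comm] at h1

lemma one_le_lambdaMax_mul_gamma (hs : 1 ≤ s)
    (hRE : GroupRE s 3 K (CFC.sqrt (totalCov prior mean SW)) γ) :
    1 ≤ lambdaMax (totalCov prior mean SW) * γ := by
  have hp : 0 < p := by have := h.two_le_p; omega
  have h1 := (h.one_div_le_diag hs hRE ⟨0, hp⟩).trans (diag_le_lambdaMax h.posDef.isHermitian _)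
  rwa [div_le_iff₀ hRE.1] at h1

end IsPopulation

/-- The error bounds hold for every good sample. -/
lemma IsGoodSample.error_bounds (g : IsGoodSample prior mean SW piMin A B p₀ y)
    (h : IsPopulation prior mean SW piMin) (hn : 0 < n) (hA : 0 ≤ A) (hB : 0 ≤ B)
    (hnA : 4 * A ≤ n * piMin ^ 2) (hBA : B ^ 2 * A ≤ 40000 * n)
    (hn₂ : 256 * ((589824 / piMin ^ 2 + B ^ 2) / piMin) * remainderConst piMin A p₀ ≤ n)
    {c : ℝ} (hc : c = 0 ∨ c = 1) (hs : (rowSupport (Bstar prior mean SW)).card = s) (hs1 : 1 ≤ s)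
    (hRE : GroupRE s 3 K (CFC.sqrt (totalCov prior mean SW)) γ) {C lam : ℝ} (hC : 1600 ≤ C)
    (hlam : lam = C * tau mean SW * √(((K : ℝ) - 1) * Real.log p / n))
    {Bh : Matrix (Fin p) (Fin (K - 1)) ℝ}
    (hmin : IsMinOn (objective (response fun i => (y i).2) (design c y) lam) Set.univ Bh) :
    let M := oracleConst C ((589824 / piMin ^ 2 + B ^ 2) / piMin) (remainderConst piMin A p₀)
    let ρ := ((K : ℝ) - 1) * (tau mean SW ^ 2 * (Real.log p / n) * s * γ)
    frobSq (CFC.sqrt (totalCov prior mean SW) * (Bh - Bstar prior mean SW)) ≤ M * ρ ∧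
      frobSq (Bh - Bstar prior mean SW) ≤ 4 * M * γ * ρ := by
  intro M ρ
  have hn' : (0 : ℝ) < n := by positivity
  have hpi := h.piMin_pos
  have hτ := h.tau_pos
  have hl := h.log_p_pos
  have hκ := h.one_le_K_sub_one
  have hκ0 : (0 : ℝ) < K - 1 := by linarith
  have hγ := hRE.1
  have hs1' : (1 : ℝ) ≤ s := by exact_mod_cast hs1
  have hC0 : 0 < C := by linarith
  set R := CFC.sqrt (totalCov prior mean SW) with hR
  set Bs := Bstar prior mean SW with hBs
  set S := rowSupport Bs with hS
  set δ := Bh - Bs with hδ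
  set L := Real.log p / n with hL
  have hL0 : 0 < L := by positivity
  have hlam' : lam = C * tau mean SW * (√(K - 1 : ℕ) * √L) := by
    rw [hlam, h.cast_K_sub_one, ← Real.sqrt_mul hκ0.le, mul_div_assoc]
  have hlam0 : 0 < lam := by
    rw [hlam', h.cast_K_sub_one]; positivity
  have hA₁ : 0 ≤ remainderConst piMin A p₀ := by unfold remainderConst; positivity
  have hsplit := norm12_eq_add δ S
  have hfR := frobSq_nonneg (R * δ)
  have hfX : 0 ≤ frobSq (design c y * δ) / n := div_nonneg (frobSq_nonneg _) hn'.le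
  have hbasic := basic_inequality Bs Bh (isMinOn_iff.1 hmin Bs (Set.mem_univ _))
  have hnoise := g.noise_le h hn hA hB hnA hBA hc δ
  have hiso := g.frobSq_design_ge h hn hc δ
  have hδ0 := norm12_nonneg δ
  have hRE4 : ∀ D : Matrix (Fin p) (Fin (K - 1)) ℝ,
      norm12 (rowRestrict Sᶜ D) ≤ 3 * norm12 (rowRestrict S D) →
      norm12 (rowRestrict S D) ^ 2 ≤ s * γ * frobSq (R * D) := fun D hD => by
    have h1 := hRE.2 S hs.le D hD
    rw [div_le_iff₀ hγ] at h1
    have h2 := norm12_rowRestrict_sq_le D S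
    rw [hs] at h2
    calc _ ≤ s * frobSq (rowRestrict S D) := h2
      _ ≤ s * (frobSq (R * D) * γ) := by gcongr
      _ = _ := by ring
  have hBs12 : norm12 Bs = norm12 (rowRestrict S Bs) := by
    rw [norm12_eq_add Bs S, norm12_rowSupport_compl, add_zero]
  -- `B*` lies in the cone itself, so with the restricted eigenvalue condition this bounds
  -- `‖B*‖_{1,2}²` by `s γ (K - 1)`.
  have hBenergy : frobSq (R * Bs) ≤ K - 1 := by
    rw [h.frobSq_sqrt_mul]
    refine (Finset.sum_le_sum fun l _ => h.Bstar_energy_le_one l).trans ?_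
    simp [h.cast_K_sub_one]
  have key := oracle_bound (D := √(frobSq (R * δ))) (a := √(frobSq (design c y * δ) / n))
    (N := √(remainderConst piMin A p₀ / n)) (lam := lam) (b := norm12 Bs) (bh := norm12 Bh)
    (dS := norm12 (rowRestrict S δ)) (dC := norm12 (rowRestrict Sᶜ δ)) (τ := tau mean SW) (L := L)
    (s := s) (γ := γ) (κ := (K : ℝ) - 1) (C := C)
    (C₂ := (589824 / piMin ^ 2 + B ^ 2) / piMin) (A₁ := remainderConst piMin A p₀) (n := n)
    (Real.sqrt_nonneg _) (Real.sqrt_nonneg _) hlam0 (norm12_nonneg _) (norm12_nonneg _)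
    (norm12_nonneg _) (norm12_nonneg _) hτ hL0 hs1' hγ hκ (by linarith) (by positivity) hA₁ hn'
    (by
      rw [Real.sq_sqrt hfX, ← hsplit]
      -- `C ≥ 1600` makes the noise level at most `lam / 4`.
      have h1 : 400 * tau mean SW * √L * (√(K - 1 : ℕ) * norm12 δ) ≤ lam / 4 * norm12 δ := by
        rw [hlam']
        calc _ = 400 * (tau mean SW * (√(K - 1 : ℕ) * √L) * norm12 δ) := by ring
          _ ≤ C / 4 * (tau mean SW * (√(K - 1 : ℕ) * √L) * norm12 δ) := by gcongr; linarith
          _ = _ := by ring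
      linarith)
    (by rw [Real.sq_sqrt hfX, Real.sq_sqrt hfR, ← hsplit]; exact hiso)
    (norm12_sub_norm12_le Bs Bh)
    (by
      rw [← hsplit, add_comm]
      exact norm12_sub_le Bh Bs)
    (fun hcone => by rw [Real.sq_sqrt hfR]; exact hRE4 δ hcone)
    (by
      rw [hBs12]
      refine (hRE4 Bs ?_).trans (by gcongr)
      rw [norm12_rowSupport_compl]
      exact mul_nonneg (by norm_num) (norm12_nonneg _))
    (by
      rw [hlam, mul_pow, mul_pow, Real.sq_sqrt (by positivity)]
      ring)
    (by rw [Real.sq_sqrt (by positivity)])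
    (h.one_le_gamma_mul_tau_sq hs1 hRE)
    (by
      have := h.half_le_log_p
      rw [hL, mul_div_cancel₀ _ hn'.ne']
      exact this) hn₂
  rw [Real.sq_sqrt hfR, ← hsplit] at key
  obtain ⟨k1, k2⟩ := key
  refine ⟨k1, ?_⟩
  have hρ : 0 ≤ M * ρ := hfR.trans k1
  rcases le_or_gt (norm12 (rowRestrict Sᶜ δ)) (3 * norm12 (rowRestrict S δ)) with hcone | hcone
  · calc frobSq δ ≤ 4 * γ * frobSq (R * δ) := hRE.frobSq_le hs1 hs δ hcone
      _ ≤ 4 * γ * (M * ρ) := by gcongr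
      _ = _ := by ring
  · calc frobSq δ ≤ norm12 δ ^ 2 := frobSq_le_norm12_sq δ
      _ ≤ M * γ * ρ := k2 hcone
      _ = γ * (M * ρ) := by ring
      _ ≤ 4 * (γ * (M * ρ)) := by
        have : 0 ≤ γ * (M * ρ) := by positivity
        linarith
      _ = _ := by ring

/-- A bound for the estimator that holds for every sample. -/
lemma norm12_le_of_isMinOn {Y : Matrix (Fin n) (Fin (K - 1)) ℝ} {X : Matrix (Fin n) (Fin p) ℝ}
    {lam : ℝ} (hlam : 0 < lam) {Bh : Matrix (Fin p) (Fin (K - 1)) ℝ}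
    (hmin : IsMinOn (objective Y X lam) Set.univ Bh) :
    norm12 Bh ≤ (2 * (n : ℝ))⁻¹ * frobSq Y / lam := by
  have h1 := isMinOn_iff.1 hmin 0 (Set.mem_univ _)
  have h0 : norm12 (0 : Matrix (Fin p) (Fin (K - 1)) ℝ) = 0 := by simp [norm12, rowNorm]
  simp only [objective, Matrix.mul_zero, sub_zero, h0, mul_zero, add_zero] at h1
  rw [le_div_iff₀ hlam]
  have : 0 ≤ (2 * (n : ℝ))⁻¹ * frobSq (Y - X * Bh) := mul_nonneg (by positivity) (frobSq_nonneg _)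
  linarith

lemma frobSq_mul_le {a b c : ℕ} (R : Matrix (Fin a) (Fin b) ℝ) (M : Matrix (Fin b) (Fin c) ℝ) :
    frobSq (R * M) ≤ frobSq R * frobSq M := by
  have e : frobSq M = ∑ l, ∑ j, M j l ^ 2 := Finset.sum_comm
  rw [frobSq, frobSq, e, Finset.sum_mul]
  refine Finset.sum_le_sum fun i _ => ?_
  rw [Finset.mul_sum]
  refine Finset.sum_le_sum fun l _ => ?_
  rw [Matrix.mul_apply]
  exact Finset.sum_mul_sq_le_sq_mul_sq _ _ _

end Estimator

/-! ### Choice of the constants -/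

/-- For a suitable choice of the constants, good samples have large probability and satisfy the
assumptions of the error bounds. -/
lemma exists_constants {piMin ε : ℝ} (hpi : 0 < piMin) (hε : 0 < ε) :
    ∃ (A B c₀ : ℝ) (p₀ N₀ : ℕ), 0 < A ∧ 0 ≤ B ∧ 0 < c₀ ∧ ∀ n p : ℕ, 0 < n → N₀ ≤ n → 2 ≤ p →
      Real.log p ≤ c₀ * n →
      24576 * Real.log p ≤ n * piMin ^ 2 ∧ B * √(Real.log p / n) ≤ 128 * piMin ∧
      200 * √(Real.log p / n) ≤ 128 * piMin ∧ 1 / piMin * (1 / A) ≤ ε ∧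
      p * (2 * Real.exp (-(B ^ 2 / 8192 * Real.log p))) ≤ ε ∧
      2 * Real.exp (-(n * piMin ^ 2 / 4096)) ≤ ε ∧
      (p₀ ≤ p → p * (1 / piMin) * (2 * Real.exp (-(200 ^ 2 / 8192 * Real.log p))) ≤ ε) ∧
      (p < p₀ → p * (1 / piMin) * (256 / piMin ^ 2 / A) ≤ ε) ∧
      4 * A ≤ n * piMin ^ 2 ∧ B ^ 2 * A ≤ 40000 * n ∧
      256 * ((589824 / piMin ^ 2 + B ^ 2) / piMin) * remainderConst piMin A p₀ ≤ n := by
  -- Beyond `p₀` the union bound for the noise is at most `2 / (piMin p)`, since `200² / 8192 ≥ 2`.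
  obtain ⟨p₀, hp₀⟩ := exists_nat_ge (2 / (piMin * ε))
  -- The summands serve the union bounds over the classes and, for `p < p₀`, over the whitened noise
  -- coordinates.
  set A := 1 / (piMin * ε) + p₀ * (256 / piMin ^ 3) / ε with hA
  have hA0 : 0 < A := by positivity
  -- Gives `2 p · p^{-(1 + 4/ε)} = 2 exp (-(4/ε) log p)`, small even for `p = 2`. Unlike the `200`
  -- of the noise, `B` may depend on `ε` because it does not enter the tuning parameter.
  set B := √(8192 * (1 + 4 / ε)) with hB
  have hB2 : B ^ 2 = 8192 * (1 + 4 / ε) := Real.sq_sqrt (by positivity)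
  set c₀ := piMin ^ 2 / (40000 + B ^ 2) with hc₀
  obtain ⟨N₀, hN₀⟩ := exists_nat_ge (8192 / (piMin ^ 2 * ε) + 4 * A / piMin ^ 2 + B ^ 2 * A / 40000 +
    256 * ((589824 / piMin ^ 2 + B ^ 2) / piMin) * remainderConst piMin A p₀)
  refine ⟨A, B, c₀, p₀, N₀, hA0, Real.sqrt_nonneg _, by positivity, fun n p hn hnN hp hlog => ?_⟩
  have hn' : (0 : ℝ) < n := by exact_mod_cast hn
  have hnN' : (N₀ : ℝ) ≤ n := by exact_mod_cast hnN
  have hp' : (2 : ℝ) ≤ p := by exact_mod_cast hp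
  have hl : 1 / 2 ≤ Real.log p := by
    have := Real.log_two_gt_d9
    have := Real.log_le_log (by norm_num) hp'
    linarith
  have hexp : Real.exp (Real.log p) = p := Real.exp_log (by linarith)
  have hR0 : 0 ≤ 256 * ((589824 / piMin ^ 2 + B ^ 2) / piMin) * remainderConst piMin A p₀ := by
    unfold remainderConst; positivity
  have hq1 : 0 < 8192 / (piMin ^ 2 * ε) := by positivity
  have hq2 : 0 < 4 * A / piMin ^ 2 := by positivity
  have hq3 : 0 ≤ B ^ 2 * A / 40000 := by positivity
  have hdiv : Real.log p / n ≤ c₀ := by rwa [div_le_iff₀ hn']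
  have hcD : c₀ * (40000 + B ^ 2) = piMin ^ 2 := by rw [hc₀]; field_simp
  have hc₀0 : 0 < c₀ := by positivity
  refine ⟨?_, ?_, ?_, ?_, ?_, ?_, fun hpp => ?_, fun hpp => ?_, ?_, ?_, ?_⟩
  · have : 24576 * c₀ ≤ piMin ^ 2 := by nlinarith [mul_nonneg hc₀0.le (sq_nonneg B)]
    calc 24576 * Real.log p ≤ 24576 * (c₀ * n) := by gcongr
      _ = 24576 * c₀ * n := by ring
      _ ≤ piMin ^ 2 * n := by gcongr
      _ = _ := by ring
  · refine (le_abs_self _).trans (abs_le_of_sq_le_sq ?_ (by positivity))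
    rw [mul_pow, Real.sq_sqrt (show 0 ≤ Real.log p / n by positivity)]
    calc B ^ 2 * (Real.log p / n) ≤ B ^ 2 * c₀ := by gcongr
      _ ≤ _ := by nlinarith [sq_nonneg piMin]
  · refine (le_abs_self _).trans (abs_le_of_sq_le_sq ?_ (by positivity))
    rw [mul_pow, Real.sq_sqrt (by positivity)]
    calc 200 ^ 2 * (Real.log p / n) ≤ 200 ^ 2 * c₀ := by gcongr
      _ ≤ _ := by nlinarith [mul_nonneg hc₀0.le (sq_nonneg B)]
  · rw [one_div_mul_one_div, div_le_iff₀ (by positivity)]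
    have : 1 / (piMin * ε) ≤ A := le_add_of_nonneg_right (by positivity)
    calc 1 = ε * (piMin * (1 / (piMin * ε))) := by field_simp
      _ ≤ _ := by gcongr
  · have e : p * (2 * Real.exp (-(B ^ 2 / 8192 * Real.log p)))
        = 2 * Real.exp (-(4 / ε * Real.log p)) := by
      have : -(B ^ 2 / 8192 * Real.log p) = -(4 / ε * Real.log p) + -Real.log p := by
        rw [hB2]; ring
      rw [this, Real.exp_add, Real.exp_neg (Real.log p), hexp]
      field_simp
    rw [e]
    have h1 : Real.exp (-(4 / ε * Real.log p)) ≤ ε / 2 := by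
      rw [Real.exp_neg, inv_le_comm₀ (Real.exp_pos _) (by positivity)]
      have h2 := Real.add_one_le_exp (4 / ε * Real.log p)
      have h3 : 4 / ε * (1 / 2) ≤ 4 / ε * Real.log p := by gcongr
      have h4 : (ε / 2)⁻¹ = 4 / ε * (1 / 2) := by field_simp; norm_num
      linarith
    linarith
  · have h1 : Real.exp (-(n * piMin ^ 2 / 4096)) ≤ ε / 2 := by
      rw [Real.exp_neg, inv_le_comm₀ (Real.exp_pos _) (by positivity)]
      have h2 := Real.add_one_le_exp (n * piMin ^ 2 / 4096)
      have h3 : 8192 / (piMin ^ 2 * ε) ≤ n := by linarith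
      have h4 : (ε / 2)⁻¹ = 8192 / (piMin ^ 2 * ε) * piMin ^ 2 / 4096 := by field_simp; norm_num
      have h5 : 8192 / (piMin ^ 2 * ε) * piMin ^ 2 / 4096 ≤ n * piMin ^ 2 / 4096 := by gcongr
      linarith
    linarith
  · have h1 : Real.exp (-(200 ^ 2 / 8192 * Real.log p)) ≤ ((p : ℝ) ^ 2)⁻¹ := by
      rw [Real.exp_neg]
      gcongr
      rw [← hexp, ← Real.exp_nat_mul, hexp]
      apply Real.exp_le_exp.2
      push_cast
      nlinarith
    have h2 : 2 / (piMin * ε) ≤ p := hp₀.trans (by exact_mod_cast hpp)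
    rw [div_le_iff₀ (by positivity)] at h2
    calc p * (1 / piMin) * (2 * Real.exp (-(200 ^ 2 / 8192 * Real.log p)))
        ≤ p * (1 / piMin) * (2 * ((p : ℝ) ^ 2)⁻¹) := by gcongr
      _ = 2 / (piMin * p) := by field_simp
      _ ≤ ε := by
        rw [div_le_iff₀ (by positivity)]
        linarith
  · have h1 : p₀ * (256 / piMin ^ 3) / ε ≤ A := le_add_of_nonneg_left (by positivity)
    have h2 : (p : ℝ) ≤ p₀ := by exact_mod_cast hpp.le
    rw [div_le_iff₀ hε] at h1
    rw [← mul_div_assoc, div_le_iff₀ hA0]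
    calc p * (1 / piMin) * (256 / piMin ^ 2) = p * (256 / piMin ^ 3) := by field_simp
      _ ≤ p₀ * (256 / piMin ^ 3) := by gcongr
      _ ≤ _ := by linarith
  · have h3 : 4 * A / piMin ^ 2 ≤ n := by linarith
    rwa [div_le_iff₀ (by positivity)] at h3
  · have h3 : B ^ 2 * A / 40000 ≤ n := by linarith
    rw [div_le_iff₀ (by positivity)] at h3
    linarith
  · linarith

/-! ### Assembly -/

/-- `O_p` is required for every `n ≥ 1`; finitely many sample sizes are covered by the largest of
their almost sure bounds. -/
lemma isBigOInProb_of_eventually {Ω : ℕ → Type u} [∀ n, MeasurableSpace (Ω n)]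
    {P : ∀ n, Measure (Ω n)} {b : ∀ n, Ω n → ℝ} {a : ℕ → ℝ}
    (hlarge : ∀ ε : ℝ, 0 < ε → ∃ M : ℝ, ∀ᶠ n in atTop,
      P n {ω | M < |b n ω| / a n} < ENNReal.ofReal ε)
    (hsmall : ∀ n, 1 ≤ n → ∃ M : ℝ, ∀ᵐ ω ∂(P n), |b n ω| / a n ≤ M) :
    IsBigOInProb P b a := by
  intro ε hε
  obtain ⟨M, hM⟩ := hlarge ε hε
  obtain ⟨N, hN⟩ := eventually_atTop.1 hM
  choose! m hm using hsmall
  refine ⟨max M (∑ n ∈ Finset.range N, |m n|), fun n hn => ?_⟩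
  rcases lt_or_ge n N with h | h
  · have h1 : m n ≤ ∑ n ∈ Finset.range N, |m n| := (le_abs_self _).trans
      (Finset.single_le_sum (f := fun n => |m n|) (fun _ _ => abs_nonneg _) (Finset.mem_range.2 h))
    have h2 : P n {ω | max M (∑ n ∈ Finset.range N, |m n|) < |b n ω| / a n} = 0 := by
      refine measure_mono_null (fun ω hω => ?_) (ae_iff.1 (hm n hn))
      simp only [Set.mem_ofPred_eq, not_le] at hω ⊢
      exact (h1.trans (le_max_right _ _)).trans_lt hω
    rw [h2]
    simpa using hε
  · refine lt_of_le_of_lt (measure_mono fun ω hω => ?_) (hN n h)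
    simp only [Set.mem_ofPred_eq] at hω ⊢
    exact (le_max_left _ _).trans_lt hω

/-! ### Rates, and a sample-free bound for small `n` -/

section Rates

variable {p K n s : ℕ} {prior : Fin K → ℝ} {mean : Fin K → EuclideanSpace ℝ (Fin p)}
  {SW : Matrix (Fin p) (Fin p) ℝ} {piMin γ : ℝ}

lemma trace_eq_frobSq_sqrt (h : IsPopulation prior mean SW piMin)
    (D : Matrix (Fin p) (Fin (K - 1)) ℝ) :
    Matrix.trace (Dᵀ * totalCov prior mean SW * D)
      = frobSq (CFC.sqrt (totalCov prior mean SW) * D) := by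
  rw [trace_eq_sum, h.frobSq_sqrt_mul]

lemma design_zero (x : Fin n → EuclideanSpace ℝ (Fin p)) (z : Fin n → Fin K) :
    design 0 (fun i => (x i, z i)) = dataMatrix x := by
  ext i j
  simp [design, dataMatrix]

lemma design_one (x : Fin n → EuclideanSpace ℝ (Fin p)) (z : Fin n → Fin K) :
    design 1 (fun i => (x i, z i)) = centerColumns (dataMatrix x) := by
  ext i j
  simp [design, dataMatrix, centerColumns, sampleMean]

lemma rate_pos (h : IsPopulation prior mean SW piMin) (hn : 0 < n) (hs : 1 ≤ s) (hγ : 0 < γ) :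
    0 < tau mean SW ^ 2 * γ ^ 2 * (((K : ℝ) - 1) * s * Real.log p / n) := by
  have hn' : (0 : ℝ) < n := by positivity
  have hτ := h.tau_pos
  have hl := h.log_p_pos
  have hκ : (0 : ℝ) < K - 1 := by linarith [h.one_le_K_sub_one]
  positivity

/-- The estimation error is bounded by a number that does not depend on the sample. -/
lemma exists_norm12_sub_le {Bs : Matrix (Fin p) (Fin (K - 1)) ℝ} {lam : ℝ} (hlam : 0 < lam) :
    ∃ R : ℝ, ∀ (z : Fin n → Fin K) (X : Matrix (Fin n) (Fin p) ℝ)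
      (Bh : Matrix (Fin p) (Fin (K - 1)) ℝ),
      IsMinOn (objective (response z) X lam) Set.univ Bh → norm12 (Bh - Bs) ≤ R := by
  -- The response depends on the labels alone, so summing over all label vectors bounds it
  -- uniformly.
  refine ⟨(2 * (n : ℝ))⁻¹ * (∑ z : Fin n → Fin K, frobSq (response z)) / lam + norm12 Bs,
    fun z X Bh hmin => ?_⟩
  have h1 : frobSq (response z) ≤ ∑ z : Fin n → Fin K, frobSq (response z) :=
    Finset.single_le_sum (f := fun z : Fin n → Fin K => frobSq (response z))
      (fun _ _ => frobSq_nonneg _) (Finset.mem_univ z)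
  calc norm12 (Bh - Bs) ≤ norm12 Bh + norm12 Bs := norm12_sub_le _ _
    _ ≤ (2 * (n : ℝ))⁻¹ * frobSq (response z) / lam + norm12 Bs := by
      gcongr
      exact norm12_le_of_isMinOn hlam hmin
    _ ≤ _ := by gcongr

end Rates

end OptimalScoring

theorem theorem6 :
    ∃ C₀ : ℝ, 0 < C₀ ∧ ∀ C : ℝ, C₀ ≤ C →
    -- for each sample size `n`: dimension, number of classes, and parameters of the population
    ∀ (p K : ℕ → ℕ)
      (prior : ∀ n, Fin (K n) → ℝ)
      (mean : ∀ n, Fin (K n) → EuclideanSpace ℝ (Fin (p n)))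
      (SW : ∀ n, Matrix (Fin (p n)) (Fin (p n)) ℝ)
      (piMin piMax : ℝ)
      (s : ℕ → ℕ) (γ : ℕ → ℝ)
      -- for each `n`: a probability space with the sample, and the estimator
      (Ω : ℕ → Type u) [∀ n, MeasurableSpace (Ω n)]
      (P : ∀ n, Measure (Ω n)) [∀ n, IsProbabilityMeasure (P n)]
      (x : ∀ n, Fin n → Ω n → EuclideanSpace ℝ (Fin (p n)))
      (z : ∀ n, Fin n → Ω n → Fin (K n))
      (X : ∀ n, Ω n → Matrix (Fin n) (Fin (p n)) ℝ)
      (lam : ℕ → ℝ)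
      (Bhat : ∀ n, Ω n → Matrix (Fin (p n)) (Fin (K n - 1)) ℝ),
    (∀ n, 2 ≤ p n) →
    (∀ n, 2 ≤ K n) →
    -- class probabilities
    0 < piMin → piMax < 1 →
    (∀ n k, piMin ≤ prior n k ∧ prior n k ≤ piMax) →
    (∀ n, ∑ k, prior n k = 1) →
    -- covariance matrices, and overall mean zero
    (∀ n, (SW n).PosSemidef) →
    (∀ n, (totalCov (prior n) (mean n) (SW n)).PosDef) →
    (∀ n, ∑ k, prior n k • mean n k = 0) →
    -- the sample
    (∀ n, IsSample (P n) (x n) (z n) (prior n) (mean n) (SW n)) →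
    -- the data matrix, either raw or column-centered
    ((∀ n ω, X n ω = dataMatrix fun i => x n i ω) ∨
      (∀ n ω, X n ω = centerColumns (dataMatrix fun i => x n i ω))) →
    -- sparsity
    (∀ n, s n = (rowSupport (Bstar (prior n) (mean n) (SW n))).card) →
    (∀ n, 1 ≤ s n) →
    -- sample size
    ((fun n => Real.log (p n)) =o[atTop] fun n : ℕ => (n : ℝ)) →
    ((fun n => (s n : ℝ) ^ 2 * Real.log (p n)) =o[atTop] fun n : ℕ => (n : ℝ)) →
    -- restricted eigenvalue condition
    (∀ n, GroupRE (s n) 3 (K n) (CFC.sqrt (totalCov (prior n) (mean n) (SW n))) (γ n)) →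
    -- tuning parameter and estimator
    (∀ n, lam n = C * tau (mean n) (SW n) * √(((K n : ℝ) - 1) * Real.log (p n) / n)) →
    (∀ n, ∀ᵐ ω ∂(P n), IsMinOn
      (objective (response fun i => z n i ω) (X n ω) (lam n)) Set.univ (Bhat n ω)) →
    IsBigOInProb P
      (fun n ω => Matrix.trace
        ((Bhat n ω - Bstar (prior n) (mean n) (SW n))ᵀ * totalCov (prior n) (mean n) (SW n) *
          (Bhat n ω - Bstar (prior n) (mean n) (SW n))))
      (fun n => lambdaMax (totalCov (prior n) (mean n) (SW n)) * tau (mean n) (SW n) ^ 2 *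
        γ n ^ 2 * (((K n : ℝ) - 1) * s n * Real.log (p n) / n)) ∧
    IsBigOInProb P
      (fun n ω => frobSq (Bhat n ω - Bstar (prior n) (mean n) (SW n)))
      (fun n => tau (mean n) (SW n) ^ 2 * γ n ^ 2 *
        (((K n : ℝ) - 1) * s n * Real.log (p n) / n)) := by
  -- `1600 = 4 · (200 + 200)`: the noise and the centring term, compared with `lam / 4`.
  refine ⟨1600, by norm_num, fun C hC p K prior mean SW piMin piMax s γ Ω _ P _ x z X lam Bhat
    hp hK hpi _ hprior hsum hSW hT hmean hsample hX hs hs1 hlog _ hRE hlam hmin => ?_⟩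
  have hpop n : IsPopulation (prior n) (mean n) (SW n) piMin :=
    ⟨hp n, hK n, hpi, fun k => (hprior n k).1, hsum n, hSW n, hT n, hmean n⟩
  obtain ⟨c, hc, hXc⟩ : ∃ c : ℝ, (c = 0 ∨ c = 1) ∧
      ∀ n ω, X n ω = design c fun i => (x n i ω, z n i ω) := by
    rcases hX with hX | hX
    · exact ⟨0, .inl rfl, fun n ω => by rw [hX, design_zero]⟩
    · exact ⟨1, .inr rfl, fun n ω => by rw [hX, design_one]⟩
  have hγ n : 0 < γ n := (hRE n).1
  have hΛ n : 0 < lambdaMax (totalCov (prior n) (mean n) (SW n)) := by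
    have h1 := (hpop n).one_le_lambdaMax_mul_gamma (hs1 n) (hRE n)
    exact pos_of_mul_pos_left (by linarith) (hγ n).le
  have hrate n (hn : 1 ≤ n) := rate_pos (hpop n) hn (hs1 n) (hγ n)
  have hlarge : ∀ ε : ℝ, 0 < ε → ∃ M : ℝ, ∀ᶠ n in atTop,
      P n {ω | ¬ (frobSq (CFC.sqrt (totalCov (prior n) (mean n) (SW n)) *
          (Bhat n ω - Bstar (prior n) (mean n) (SW n))) ≤
        M * (lambdaMax (totalCov (prior n) (mean n) (SW n)) * tau (mean n) (SW n) ^ 2 *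
          γ n ^ 2 * (((K n : ℝ) - 1) * s n * Real.log (p n) / n)) ∧
        frobSq (Bhat n ω - Bstar (prior n) (mean n) (SW n)) ≤
          M * (tau (mean n) (SW n) ^ 2 * γ n ^ 2 *
            (((K n : ℝ) - 1) * s n * Real.log (p n) / n)))} < ENNReal.ofReal ε := by
    intro ε hε
    -- Five bad events of probability at most `ε / 6` each leave room for the strict inequality.
    obtain ⟨A, B, c₀, p₀, N₀, hA, hB, hc₀, hconst⟩ :=
      exists_constants hpi (show 0 < ε / 6 by positivity)
    set M := oracleConst C ((589824 / piMin ^ 2 + B ^ 2) / piMin) (remainderConst piMin A p₀)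
    refine ⟨4 * |M|, ?_⟩
    filter_upwards [hlog.def hc₀, eventually_ge_atTop N₀, eventually_gt_atTop 0] with n h1 h2 hn
    have h := hpop n
    have hn' : (0 : ℝ) < n := by positivity
    have hl : Real.log (p n) ≤ c₀ * n := by
      simpa [abs_of_nonneg h.log_p_pos.le] using h1
    obtain ⟨q1, q2, q3, q4, q5, q6, q7, q8, q9, q10, q11⟩ := hconst n (p n) hn h2 (hp n) hl
    have hbad := h.measure_not_isGoodSample_le (hsample n).isIID hn hA hB (by positivity)
      q1 q2 q3 q4 q5 q6 q7 q8
    calc _ ≤ P n ({ω | ¬ IsGoodSample (prior n) (mean n) (SW n) piMin A B p₀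
              fun i => (x n i ω, z n i ω)} ∪
            {ω | ¬ IsMinOn (objective (response fun i => z n i ω) (X n ω) (lam n)) Set.univ
              (Bhat n ω)}) := by
          refine measure_mono fun ω hω => ?_
          by_contra hω'
          simp only [Set.mem_union, Set.mem_ofPred_eq, not_or, not_not] at hω hω'
          refine hω ?_
          obtain ⟨g, hm⟩ := hω'
          rw [hXc] at hm
          obtain ⟨e1, e2⟩ := g.error_bounds h hn hA.le hB q9 q10 q11 hc (hs n).symm (hs1 n) (hRE n)
            hC (hlam n) hm
          set ρ := ((K n : ℝ) - 1) * (tau (mean n) (SW n) ^ 2 * (Real.log (p n) / n) * s n * γ n)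
          have hρ : 0 ≤ ρ := by
            have := h.one_le_K_sub_one
            have := h.log_p_pos
            have := hγ n
            have : (0 : ℝ) ≤ K n - 1 := by linarith
            positivity
          have e3 : M * ρ ≤ 4 * |M| * ρ := by
            gcongr
            linarith [le_abs_self M, abs_nonneg M]
          -- The prediction bound has a single `γ`; the factor `λ_max γ ≥ 1` supplies the form with
          -- `λ_max γ²`.
          have e4 := h.one_le_lambdaMax_mul_gamma (hs1 n) (hRE n)
          constructor
          · calc _ ≤ M * ρ := e1
              _ ≤ 4 * |M| * ρ := e3
              _ ≤ 4 * |M| * ρ * (lambdaMax (totalCov (prior n) (mean n) (SW n)) * γ n) :=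
                le_mul_of_one_le_right (by positivity) e4
              _ = _ := by ring
          · calc _ ≤ 4 * M * γ n * ρ := e2
              _ ≤ 4 * |M| * γ n * ρ := by
                gcongr
                · exact (hγ n).le
                · exact le_abs_self M
              _ = _ := by ring
      _ ≤ ENNReal.ofReal (5 * (ε / 6)) + 0 := by
          refine (measure_union_le _ _).trans (add_le_add hbad ?_)
          exact (ae_iff.1 (hmin n)).le
      _ < ENNReal.ofReal ε := by
          rw [add_zero, ENNReal.ofReal_lt_ofReal_iff hε]
          linarith
  have hsmall : ∀ n, 1 ≤ n → ∃ R : ℝ, ∀ᵐ ω ∂(P n),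
      frobSq (Bhat n ω - Bstar (prior n) (mean n) (SW n)) ≤ R := by
    intro n hn
    have h := hpop n
    have hlam0 : 0 < lam n := by
      have hn' : (0 : ℝ) < n := by exact_mod_cast hn
      have hτ := h.tau_pos
      have hl := h.log_p_pos
      have hκ : (0 : ℝ) < K n - 1 := by linarith [h.one_le_K_sub_one]
      have : 0 < C := by linarith
      rw [hlam]
      positivity
    obtain ⟨R, hR⟩ := exists_norm12_sub_le (n := n) (Bs := Bstar (prior n) (mean n) (SW n)) hlam0
    refine ⟨R ^ 2, (hmin n).mono fun ω hω => (frobSq_le_norm12_sq _).trans ?_⟩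
    have := norm12_nonneg (Bhat n ω - Bstar (prior n) (mean n) (SW n))
    gcongr
    exact hR _ _ _ hω
  constructor
  · refine isBigOInProb_of_eventually (fun ε hε => ?_) fun n hn => ?_
    · obtain ⟨M, hM⟩ := hlarge ε hε
      refine ⟨M, (hM.and (eventually_ge_atTop 1)).mono fun n hn => ?_⟩
      refine (measure_mono fun ω hω hω' => ?_).trans_lt hn.1
      simp only [Set.mem_ofPred_eq] at hω
      have hr := mul_pos (hΛ n) (hrate n hn.2)
      rw [← mul_assoc, ← mul_assoc] at hr
      rw [lt_div_iff₀ hr, trace_eq_frobSq_sqrt (hpop n), abs_of_nonneg (frobSq_nonneg _)] at hω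
      exact hω.not_ge hω'.1
    · obtain ⟨R, hR⟩ := hsmall n hn
      refine ⟨frobSq (CFC.sqrt (totalCov (prior n) (mean n) (SW n))) * R /
        (lambdaMax (totalCov (prior n) (mean n) (SW n)) *
        tau (mean n) (SW n) ^ 2 * γ n ^ 2 * (((K n : ℝ) - 1) * s n * Real.log (p n) / n)),
        hR.mono fun ω hω => ?_⟩
      have hr := mul_pos (hΛ n) (hrate n hn)
      rw [← mul_assoc, ← mul_assoc] at hr
      rw [trace_eq_frobSq_sqrt (hpop n), abs_of_nonneg (frobSq_nonneg _)]
      refine div_le_div_of_nonneg_right ((frobSq_mul_le _ _).trans ?_) hr.le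
      exact mul_le_mul_of_nonneg_left hω (frobSq_nonneg _)
  · refine isBigOInProb_of_eventually (fun ε hε => ?_) fun n hn => ?_
    · obtain ⟨M, hM⟩ := hlarge ε hε
      refine ⟨M, (hM.and (eventually_ge_atTop 1)).mono fun n hn => ?_⟩
      refine (measure_mono fun ω hω hω' => ?_).trans_lt hn.1
      simp only [Set.mem_ofPred_eq] at hω
      rw [lt_div_iff₀ (hrate n hn.2), abs_of_nonneg (frobSq_nonneg _)] at hω
      exact hω.not_ge hω'.2
    · obtain ⟨R, hR⟩ := hsmall n hn
      refine ⟨R / (tau (mean n) (SW n) ^ 2 * γ n ^ 2 *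
        (((K n : ℝ) - 1) * s n * Real.log (p n) / n)),
        hR.mono fun ω hω => ?_⟩
      rw [abs_of_nonneg (frobSq_nonneg _)]
      exact div_le_div_of_nonneg_right hω (hrate n hn).le
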